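/- **Setting.** Let $r:\mathbb R\to\mathbb R$ be $C^4$, let $d,K\in\mathbb N$ and let $\lambda,B_x,B_y,B_u,B_w,B_v>0$. For $u=\mathrm{vec}(u_1,\dots,u_K)$ with $u_k\in\mathbb R^d$, and $w,v\in\mathbb R^K$, put $\Lambda(x)=\sum_k w_k r(u_k^\top x)$ and $\Delta(x)=\sum_k v_k r(u_k^\top x)$. An input consists of $n$ labelled source points $(x_i,y_i)$, $i\le n$, of $n'$ target points $x_i$, $n<i\le N:=n+n'$, and of a query $x_{N+1}$, with $\|x_i\|\le B_x$, $|y_i|\le B_y$. Let $\gamma(a,q)=-q\log\varsigma(a)-(1-q)\log(1-\varsigma(a))$ with $\varsigma(a)=1/(1+e^{-a})$ be the sigmoid cross entropy, and, for a normalisation $c>0$ ($c=1/n$ for the mean, $c=1$ for the sum), $$L(u,w)=c\sum_{i\le n}\gamma(\Lambda(x_i),y_i),\qquad \Omega(u,v)=\frac1n\sum_{i\le n}\gamma(\Delta(x_i),0)+\frac1{n'}\sum_{n<i\le N}\gamma(\Delta(x_i),1).$$ Let $\mathcal W\subseteq\{(u,w,v):\|w\|\le B_w,\ \|v\|\le B_v,\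 \max_k\|u_k\|\le B_u\}$ be a set onto which the Euclidean projection $\Pi_{\mathcal W}$ (nearest-point map) is computed by one ReLU feed-forward block $\theta\mapsto\theta+A_2\,\mathrm{ReLU}(A_1[1;\theta])$ with $D_{\mathrm{MLP}}$ hidden units and $\|A_1\|+\|A_2\|\le C_{\mathrm{MLP}}$. A transformer layer sends a matrix $X$ with $N+1$ columns (tokens) first to $Y=X+\frac1{N+1}\sum_{m=1}^{M}V_mX\,\mathrm{ReLU}((Q_mX)^\top K_mX)$ and then to $Y+W_2\,\mathrm{ReLU}(W_1Y)$; $M$ is its number of heads and the number $D'$ of rows of $W_1$ is its width. The norm $\|\theta\|_{\mathrm{TF}}$ of a transformer is the maximum over its layers of $\max_m\max(\|Q_m\|,\|K_m\|)+\sum_m\|V_m\|+\|W_1\|+\|W_2\|$ (operator norms). Tokens are $h_i(u,w,v)=[x_i,\,y_i,\,t_i,\,s_i,\,1,\,u,\,w,\,v,\,0_4]$, where $y_i:=0$ for $i>n$, $t_i=1$ if $i\le n$ and $0$ otherwise, $s_i=1$ if $i\le N$ and $0$ otherwise. **Theorem.** For every $\rho$ there is a constant $C_0$, depending only on $r,d,K,\lambda,\rho,B_x,B_y,B_u,B_w,B_v$,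 and for every $\eta>0$ there are constants $C_1,p$, depending only on these data and $\eta$, such that the following holds for all $n,n',c$ with $(N+1)/n,\ (N+1)/n',\ (N+1)c\le\rho$, all $\mathcal W$, $D_{\mathrm{MLP}}$, $C_{\mathrm{MLP}}$ as above, all $\varepsilon>0$ and all integers $L\ge1$. There is a transformer with $2L$ layers, each with $$M\le C_1\varepsilon^{-2}\log^p(2+1/\varepsilon),\qquad D'\le C_1\varepsilon^{-2}\log^p(2+1/\varepsilon)+D_{\mathrm{MLP}},\qquad\text{and with}\qquad \|\theta\|_{\mathrm{TF}}\le C_0(1+\eta)+C_{\mathrm{MLP}},$$ such that for every input, every $l\in\{1,\dots,L\}$ and every $(u,w,v)\in\mathcal W$, layers $2l-1$ and $2l$ together map the tokens $h_i(u,w,v)$, $1\le i\le N+1$, to $h_i(u',w',v')$, where $$(u',w',v')=\Pi_{\mathcal W}\bigl(u-\eta\nabla_u\{L(u,w)-\lambda\Omega(u,v)\}+\epsilon_u,\ \ w-\eta\nabla_wL(u,w)+\epsilon_w,\ \ v-\eta\lambda\nabla_v\Omega(u,v)+\epsilon_v\bigr)$$ for some vectors with $\|\epsilon_u\|,\|\epsilon_w\|,\|\epsilon_v\|\le\varepsilon$.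 -/

import Mathlib

open scoped Matrix

noncomputable section

namespace DANN

/-! ### Transformers -/

/-- The ReLU function. -/
def relu (t : ℝ) : ℝ := max t 0

/-- The operator norm of a (possibly rectangular) matrix, for Euclidean norms on both sides. -/
def opNorm {m n : Type} [Fintype m] [Fintype n] [DecidableEq n] (A : Matrix m n ℝ) : ℝ :=
  ‖LinearMap.toContinuousLinearMap (Matrix.toEuclideanLin A)‖

/-- The parameters of one transformer layer on tokens with coordinates indexed by `T`:
`heads` attention heads with square matrices `Q`, `K`, `V`, and a feed-forward block with
`hidden` hidden units. -/
structure Layer (T : Type) where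
  heads : ℕ
  hidden : ℕ
  Q : Fin heads → Matrix T T ℝ
  K : Fin heads → Matrix T T ℝ
  V : Fin heads → Matrix T T ℝ
  W₁ : Matrix (Fin hidden) T ℝ
  W₂ : Matrix T (Fin hidden) ℝ

section Layers

variable {T Col : Type} [Fintype T] [Fintype Col]

/-- The self-attention block; the columns of `X` are the tokens, and the sum is normalised by
the number of tokens. -/
def Layer.attn (θ : Layer T) (X : Matrix T Col ℝ) : Matrix T Col ℝ :=
  X + (1 / (Fintype.card Col : ℝ)) •
    ∑ m, θ.V m * X * ((θ.Q m * X)ᵀ * (θ.K m * X)).map relu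

/-- The feed-forward block. -/
def Layer.mlp (θ : Layer T) (X : Matrix T Col ℝ) : Matrix T Col ℝ :=
  X + θ.W₂ * (θ.W₁ * X).map relu

/-- A transformer layer: attention followed by the feed-forward block. -/
def Layer.apply (θ : Layer T) (X : Matrix T Col ℝ) : Matrix T Col ℝ :=
  θ.mlp (θ.attn X)

/-- The contribution of one layer to the norm of a transformer. -/
def Layer.norm [DecidableEq T] (θ : Layer T) : ℝ :=
  (⨆ m, max (opNorm (θ.Q m)) (opNorm (θ.K m))) + ∑ m, opNorm (θ.V m)
    + opNorm θ.W₁ + opNorm θ.W₂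

/-- The norm of a transformer with `J` layers. -/
def tfNorm [DecidableEq T] {J : ℕ} (TF : Fin J → Layer T) : ℝ := ⨆ l, (TF l).norm

end Layers

/-! ### The two-layer networks and their losses -/

/-- The cross entropy of a predicted probability `p` and a label `q`. -/
def crossEntropy (p q : ℝ) : ℝ := -q * Real.log p - (1 - q) * Real.log (1 - p)

/-- The sigmoid cross entropy of a real-valued network output `a` and a label `q`. -/
def loss (a q : ℝ) : ℝ := crossEntropy (Real.sigmoid a) q

/-- `∑ k, a k * r ⟨u k, x⟩`: the label network for `a = w`, the domain network for `a = v`. -/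
def net {d K : ℕ} (r : ℝ → ℝ) (u : EuclideanSpace ℝ (Fin K × Fin d))
    (a : EuclideanSpace ℝ (Fin K)) (x : EuclideanSpace ℝ (Fin d)) : ℝ :=
  ∑ k, a k * r (∑ i, u (k, i) * x i)

/-- An input: `n` labelled source points, `n'` unlabelled target points and a query point. -/
structure Data (d n n' : ℕ) where
  xS : Fin n → EuclideanSpace ℝ (Fin d)
  y : Fin n → ℝ
  xT : Fin n' → EuclideanSpace ℝ (Fin d)
  query : EuclideanSpace ℝ (Fin d)

/-- All points have norm at most `Bx` and all labels have absolute value at most `By`. -/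
def Data.Bounded {d n n' : ℕ} (S : Data d n n') (Bx By : ℝ) : Prop :=
  (∀ i, ‖S.xS i‖ ≤ Bx) ∧ (∀ i, |S.y i| ≤ By) ∧ (∀ i, ‖S.xT i‖ ≤ Bx) ∧ ‖S.query‖ ≤ Bx

/-- The label classification loss `c * ∑ (x, y) ∈ D_S, loss (Λ x) y`; `c = 1` gives the sum over
the source data, `c = 1 / n` the mean. -/
def labelLoss {d K n n' : ℕ} (r : ℝ → ℝ) (c : ℝ) (S : Data d n n')
    (u : EuclideanSpace ℝ (Fin K × Fin d)) (w : EuclideanSpace ℝ (Fin K)) : ℝ :=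
  c * ∑ i, loss (net r u w (S.xS i)) (S.y i)

/-- The domain classification loss; source points have domain label `0`, target points `1`. -/
def domainLoss {d K n n' : ℕ} (r : ℝ → ℝ) (S : Data d n n')
    (u : EuclideanSpace ℝ (Fin K × Fin d)) (v : EuclideanSpace ℝ (Fin K)) : ℝ :=
  (1 / (n : ℝ)) * ∑ i, loss (net r u v (S.xS i)) 0 +
    (1 / (n' : ℝ)) * ∑ i, loss (net r u v (S.xT i)) 1

/-! ### Parameter vectors and the constraint set -/

/-- Index set of the parameters `(u, w, v)`, where `u = vec U`. -/
abbrev ParamIdx (d K : ℕ) : Type := (Fin K × Fin d) ⊕ (Fin K ⊕ Fin K)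

/-- The Euclidean space of parameters `(u, w, v)`. -/
abbrev Param (d K : ℕ) : Type := EuclideanSpace ℝ (ParamIdx d K)

/-- The tuple `(u, w, v)` as one vector. -/
def Param.mk {d K : ℕ} (u : EuclideanSpace ℝ (Fin K × Fin d))
    (w v : EuclideanSpace ℝ (Fin K)) : Param d K :=
  WithLp.toLp 2 (Sum.elim u (Sum.elim w v))

/-- The set of all `(u, w, v)` with `‖w‖ ≤ Bw`, `‖v‖ ≤ Bv` and `max_k ‖u_k‖ ≤ Bu`. -/
def constraintBall (d K : ℕ) (Bu Bw Bv : ℝ) : Set (Param d K) :=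
  {θ | ∃ (u : EuclideanSpace ℝ (Fin K × Fin d)) (w v : EuclideanSpace ℝ (Fin K)),
    θ = Param.mk u w v ∧ ‖w‖ ≤ Bw ∧ ‖v‖ ≤ Bv ∧
    ∀ k, ‖(WithLp.toLp 2 (fun i => u (k, i)) : EuclideanSpace ℝ (Fin d))‖ ≤ Bu}

/-- `P` is the projection onto `W`: `P z` is a nearest point of `W` to `z`. -/
def IsProjection {d K : ℕ} (W : Set (Param d K)) (P : Param d K → Param d K) : Prop :=
  ∀ z, P z ∈ W ∧ ∀ z' ∈ W, ‖z - P z‖ ≤ ‖z - z'‖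

/-- `P` is computed by a feed-forward block with a skip connection, `D` hidden ReLU units and
matrices whose operator norms add up to at most `C`, which reads `θ` and the constant
coordinate `1` of a token. -/
def IsMLPBlock {d K : ℕ} (P : Param d K → Param d K) (D : ℕ) (C : ℝ) : Prop :=
  ∃ (A₁ : Matrix (Fin D) (Unit ⊕ ParamIdx d K) ℝ) (A₂ : Matrix (ParamIdx d K) (Fin D) ℝ),
    opNorm A₁ + opNorm A₂ ≤ C ∧
    ∀ θ i, P θ i = θ i + (A₂ *ᵥ fun h => relu ((A₁ *ᵥ Sum.elim (fun _ => 1) θ) h)) i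

/-! ### Tokens -/

/-- Coordinates of a token: `x`, then `(y, t, s, 1)`, then `(u, w, v)`, then four coordinates of
working memory. -/
abbrev TokIdx (d K : ℕ) : Type := Fin d ⊕ (Fin 4 ⊕ (ParamIdx d K ⊕ Fin 4))

/-- Indices of the tokens: source points, target points and the query. -/
abbrev ColIdx (n n' : ℕ) : Type := Fin n ⊕ (Fin n' ⊕ Unit)

/-- The input matrix whose columns are `[x_i, y_i, t_i, s_i, 1, u, w, v, 0]`, where `t` marks the
source points, `s` marks the source and target points, and `y = 0` off the source points. -/
def tokens {d K n n' : ℕ} (S : Data d n n') (θ : Param d K) :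
    Matrix (TokIdx d K) (ColIdx n n') ℝ :=
  Matrix.of fun a j =>
    match j with
    | .inl i => Sum.elim (S.xS i) (Sum.elim ![S.y i, 1, 1, 1] (Sum.elim θ 0)) a
    | .inr (.inl i) => Sum.elim (S.xT i) (Sum.elim ![0, 0, 1, 1] (Sum.elim θ 0)) a
    | .inr (.inr _) => Sum.elim S.query (Sum.elim ![0, 0, 0, 1] (Sum.elim θ 0)) a

/-! ### The gradient descent/ascent step -/

/-- The parameters before projection after one DANN step from `(u, w, v)` with learning rate `η`,
perturbed by `(eu, ew, ev)`. -/
def step {d K n n' : ℕ} (r : ℝ → ℝ) (c lam η : ℝ) (S : Data d n n')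
    (u : EuclideanSpace ℝ (Fin K × Fin d)) (w v : EuclideanSpace ℝ (Fin K))
    (eu : EuclideanSpace ℝ (Fin K × Fin d)) (ew ev : EuclideanSpace ℝ (Fin K)) : Param d K :=
  Param.mk
    (u - η • gradient (fun u' => labelLoss r c S u' w - lam * domainLoss r S u' v) u + eu)
    (w - η • gradient (fun w' => labelLoss r c S u w') w + ew)
    (v - (η * lam) • gradient (fun v' => domainLoss r S u v') v + ev)

end DANN

end

noncomputable section

namespace DANN

/-! ### Fourier expansion of `C³` functions on bounded intervals -/

/-! Every partial derivative of the losses is a mean over the tokens of a quantity built from the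
residuals `g` and `δ` (the derivatives of the label loss and the domain loss at the network
outputs), the point `x`, and `r` or its derivative at `u_k · x`. With `p = w_k g - λ v_k δ`, the
summand is `x * (p * r'(u_k · x))` for `u_k`, `g * r(u_k · x)` for `w_k` and `δ * r(u_k · x)` for
`v_k`. An attention head averages a value times the ReLU of a bilinear score, so it can average one
ReLU of an affine function of `(p, u_k · x)`. It remains to write the nonlinearities as combinations
of such ReLUs.

This is `exists_reluApprox_mul`: a product `g p * f t` of `C³` functions is approximated on a square
up to `C / N` by `C * N ^ 2` ReLUs whose coefficients have total mass at most `C`. Both factors have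
Fourier series whose coefficients are summable against a quadratic weight, so the product is a
superposition of plane waves. Truncation at frequency of order `√N` costs `O(1 / N)` and leaves
`O(N)` waves. Each wave is a ridge function, and `N` equidistant knots approximate it with mass and
error proportional to the square of its frequency, which is exactly what the weight pays for. With
`N` of order `1 / ε` this gives `O(ε⁻²)` heads and no logarithm. The bounded mass makes the norm
bound independent of `ε`.

Two layers perform one step. Attention in the first layer writes both network outputs into each
token (`evalLayer_attn`). Its feed-forward block turns them into residuals, using the flags as masks
(`mlp_residual`). Attention in the second layer averages the gradient summands and updates the
parameters (`stepLayer_attn`). Its feed-forward block applies the projection and erases the memory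
(`mlp_project_clear`). Since the projection is computed exactly after the update, all errors stay
inside its argument. They are propagated through the two layers by `meansClose_of_le` and
`exists_reluSums`, and `exists_step_eq` reads them as the vectors that perturb the step. -/

open MeasureTheory in
/-- Integration by parts for Fourier coefficients of functions vanishing at the endpoints. -/
lemma norm_fourierCoeffOn_mul_abs {a b : ℝ} (hab : a < b) {g g' : ℝ → ℝ}
    (hg : ∀ x, HasDerivAt g (g' x) x) (hg' : Continuous g') (ha : g a = 0) (hb : g b = 0) (n : ℤ) :
    ‖fourierCoeffOn hab (fun x => (g x : ℂ)) n‖ * |(n : ℝ)| ≤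
      (b - a) / (2 * Real.pi) * ‖fourierCoeffOn hab (fun x => (g' x : ℂ)) n‖ := by
  have hpi := Real.pi_pos
  rcases eq_or_ne n 0 with rfl | hn
  · have : 0 < b - a := sub_pos.2 hab
    simp only [Int.cast_zero, abs_zero, mul_zero]
    positivity
  have hn' : 0 < |(n : ℝ)| := abs_pos.2 (Int.cast_ne_zero.2 hn)
  rw [fourierCoeffOn_of_hasDerivAt hab hn (f' := fun x => (g' x : ℂ))
    (fun x _ => (hg x).ofReal_comp)
    ((Complex.continuous_ofReal.comp hg').intervalIntegrable _ _)]
  have h1 : ‖(b : ℂ) - a‖ = b - a := by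
    rw [← Complex.ofReal_sub, Complex.norm_real, Real.norm_of_nonneg (sub_pos.2 hab).le]
  simp only [ha, hb, Complex.ofReal_zero, sub_self, mul_zero, zero_sub, norm_mul, norm_neg, norm_div,
    h1, Complex.norm_intCast, Complex.norm_I, Complex.norm_real, norm_one, Complex.norm_ofNat,
    Real.norm_of_nonneg hpi.le]
  apply le_of_eq
  field_simp

/-- A smooth compactly supported function has quadratically weighted summable Fourier
coefficients. -/
lemma summable_fourierCoeffOn_of_contDiff {a b : ℝ} (hab : a < b) {g : ℝ → ℝ} (hg : ContDiff ℝ 3 g)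
    (hs : tsupport g ⊆ Set.Ioo a b) {κ : ℝ} (hκ : 0 < κ) :
    Summable fun n : ℤ => (1 + κ * |(n : ℝ)|) ^ 2 *
      ‖fourierCoeffOn hab (fun x => (g x : ℂ)) n‖ := by
  have hzero : ∀ x ∉ Set.Ioo a b, ∀ f : ℝ → ℝ, tsupport f ⊆ Set.Ioo a b → f x = 0 :=
    fun x hx f hf => image_eq_zero_of_notMem_tsupport fun h => hx (hf h)
  have ha : a ∉ Set.Ioo a b := by simp
  have hb : b ∉ Set.Ioo a b := by simp
  have c1 : ContDiff ℝ 2 (deriv g) := ((contDiff_succ_iff_deriv (n := 2)).1 hg).2.2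
  have c2 : ContDiff ℝ 1 (deriv (deriv g)) := ((contDiff_succ_iff_deriv (n := 1)).1 c1).2.2
  have c3 : Continuous (deriv (deriv (deriv g))) := c2.continuous_deriv le_rfl
  have s1 : tsupport (deriv g) ⊆ Set.Ioo a b := tsupport_deriv_subset.trans hs
  have s2 : tsupport (deriv (deriv g)) ⊆ Set.Ioo a b := tsupport_deriv_subset.trans s1
  set c : ℝ := (b - a) / (2 * Real.pi) with hc
  have hc0 : 0 < c := div_pos (sub_pos.2 hab) (by positivity)
  set q : ℤ → ℝ := fun n => ‖fourierCoeffOn hab (fun x => (g x : ℂ)) n‖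
  set q3 : ℤ → ℝ := fun n => ‖fourierCoeffOn hab (fun x => ((deriv (deriv (deriv g)) x : ℝ) : ℂ)) n‖
  -- Three integrations by parts trade `|n| ^ 3` for the coefficients `q3` of the third derivative,
  -- which are square summable by Parseval. After the weight of order `n ^ 2` there remains a
  -- multiple of `q3 n / |n|`, a product of two square summable sequences.
  have key : ∀ n : ℤ, q n * |(n : ℝ)| ^ 3 ≤ c ^ 3 * q3 n := by
    intro n
    have e1 := norm_fourierCoeffOn_mul_abs hab
      (fun x => (hg.differentiable (by norm_num) x).hasDerivAt) c1.continuous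
      (hzero a ha _ hs) (hzero b hb _ hs) n
    have e2 := norm_fourierCoeffOn_mul_abs hab
      (fun x => (c1.differentiable (by norm_num) x).hasDerivAt) c2.continuous
      (hzero a ha _ s1) (hzero b hb _ s1) n
    have e3 := norm_fourierCoeffOn_mul_abs hab
      (fun x => (c2.differentiable (by norm_num) x).hasDerivAt) c3
      (hzero a ha _ s2) (hzero b hb _ s2) n
    rw [← hc] at e1 e2 e3
    calc _ = q n * |(n : ℝ)| * |(n : ℝ)| * |(n : ℝ)| := by ring
      _ ≤ (c * (c * (c * q3 n))) := by
        refine (mul_le_mul_of_nonneg_right (mul_le_mul_of_nonneg_right e1 (abs_nonneg _))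
          (abs_nonneg _)).trans ?_
        rw [mul_assoc c, mul_assoc c]
        refine mul_le_mul_of_nonneg_left ?_ hc0.le
        refine (mul_le_mul_of_nonneg_right e2 (abs_nonneg _)).trans ?_
        rw [mul_assoc c]
        exact mul_le_mul_of_nonneg_left e3 hc0.le
      _ = _ := by ring
  have hq3 : Summable fun n => q3 n ^ 2 := by
    refine (hasSum_sq_fourierCoeffOn hab ?_).summable
    have hcont : Continuous fun x => ((deriv (deriv (deriv g)) x : ℝ) : ℂ) :=
      Complex.continuous_ofReal.comp c3
    obtain ⟨B, hB⟩ := (isCompact_Icc (a := a) (b := b)).exists_bound_of_continuousOn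
      hcont.continuousOn
    refine MeasureTheory.MemLp.of_bound hcont.aestronglyMeasurable B ?_
    refine (MeasureTheory.ae_restrict_iff' measurableSet_Ioc).2 (Filter.Eventually.of_forall ?_)
    exact fun x hx => hB x ⟨hx.1.le, hx.2⟩
  have hsum : Summable fun n : ℤ => (1 + κ) ^ 2 * c ^ 3 * (q3 n ^ 2 + 1 / (n : ℝ) ^ 2) :=
    (hq3.add (Real.summable_one_div_int_pow.2 one_lt_two)).mul_left _
  refine Summable.of_norm_bounded_eventually hsum ?_
  filter_upwards [(Set.finite_singleton (0 : ℤ)).compl_mem_cofinite] with n hn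
  have hn0 : n ≠ 0 := hn
  have hn1 : (1 : ℝ) ≤ |(n : ℝ)| := by
    rw [← Int.cast_abs]; exact_mod_cast Int.one_le_abs hn0
  set m := |(n : ℝ)| with hm
  have hq : 0 ≤ q n := norm_nonneg _
  have hq3' : 0 ≤ q3 n := norm_nonneg _
  rw [Real.norm_of_nonneg (by positivity), ← sq_abs (n : ℝ), ← hm]
  have h1 : (1 + κ * m) ^ 2 ≤ (1 + κ) ^ 2 * m ^ 2 := by
    rw [← mul_pow]; gcongr; nlinarith
  have hk := key n
  rw [← hm] at hk
  have h2 : m ^ 2 * q n ≤ c ^ 3 * q3 n * (1 / m) := by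
    rw [mul_one_div, le_div_iff₀ (by linarith)]; linarith
  have h3 : q3 n * (1 / m) ≤ q3 n ^ 2 + 1 / m ^ 2 := by
    have := sq_nonneg (q3 n - 1 / m)
    have e : 1 / m ^ 2 = (1 / m) ^ 2 := by rw [one_div_pow]
    rw [e]; nlinarith [sq_nonneg (q3 n), sq_nonneg (1 / m)]
  calc (1 + κ * m) ^ 2 * q n ≤ (1 + κ) ^ 2 * m ^ 2 * q n := by gcongr
    _ = (1 + κ) ^ 2 * (m ^ 2 * q n) := by ring
    _ ≤ (1 + κ) ^ 2 * (c ^ 3 * q3 n * (1 / m)) := by gcongr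
    _ = (1 + κ) ^ 2 * c ^ 3 * (q3 n * (1 / m)) := by ring
    _ ≤ _ := by gcongr

/-- A `C³` function agrees on a bounded interval with a Fourier series whose coefficients are
summable against a quadratic weight. -/
lemma exists_fourier_expansion {f : ℝ → ℝ} (hf : ContDiff ℝ 3 f) {R : ℝ} (hR : 0 < R) :
    ∃ (κ : ℝ) (b : ℤ → ℂ), 0 < κ ∧ (Summable fun n : ℤ => (1 + κ * |(n : ℝ)|) ^ 2 * ‖b n‖) ∧
      ∀ t, |t| ≤ R →
        HasSum (fun n : ℤ => b n * Complex.exp (((κ * n * t : ℝ) : ℂ) * Complex.I)) (f t : ℂ) := by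
  -- The cutoff equals 1 on `[-R, R]` and is supported in `[-2R, 2R]`, strictly inside the period
  -- interval from `-3R` to `3R`. The boundary terms in the integrations by parts therefore vanish
  -- and the periodic extension is continuous.
  let φ : ContDiffBump (0 : ℝ) := ⟨R, 2 * R, hR, by linarith⟩
  set T : ℝ := 6 * R with hTdef
  have hT : Fact (0 < T) := ⟨by positivity⟩
  set a : ℝ := -3 * R with ha
  have hab : a < a + T := lt_add_of_pos_right a hT.out
  set g : ℝ → ℝ := fun x => φ x * f x with hgdef
  have hg : ContDiff ℝ 3 g := (φ.contDiff).mul hf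
  have hs : tsupport g ⊆ Set.Ioo a (a + T) := by
    refine (tsupport_mul_subset_left).trans ?_
    rw [φ.tsupport_eq, Real.closedBall_eq_Icc]
    intro x hx
    simp only [φ] at hx
    constructor <;> [have := hx.1; have := hx.2] <;> simp only [ha, hTdef] at * <;> linarith
  have hz : ∀ x ∉ Set.Ioo a (a + T), g x = 0 :=
    fun x hx => image_eq_zero_of_notMem_tsupport fun h => hx (hs h)
  set κ : ℝ := 2 * Real.pi / T with hκ
  have hκ0 : 0 < κ := div_pos (by positivity) hT.out
  have hsum := summable_fourierCoeffOn_of_contDiff hab hg hs hκ0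
  refine ⟨κ, fun n => fourierCoeffOn hab (fun x => (g x : ℂ)) n, hκ0, hsum, fun t ht => ?_⟩
  have hends : ((g a : ℝ) : ℂ) = ((g (a + T) : ℝ) : ℂ) := by
    rw [hz a (by simp), hz (a + T) (by simp)]
  let F : C(AddCircle T, ℂ) := ⟨AddCircle.liftIco T a (fun x => (g x : ℂ)),
    AddCircle.liftIco_continuous hends (Complex.continuous_ofReal.comp hg.continuous).continuousOn⟩
  have hco : ∀ n, fourierCoeff F n = fourierCoeffOn hab (fun x => (g x : ℂ)) n :=
    fun n => fourierCoeff_liftIco_eq _ n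
  have hsF : Summable (fourierCoeff F) := by
    refine Summable.of_norm (hsum.of_nonneg_of_le (fun _ => norm_nonneg _) fun n => ?_)
    rw [hco]
    refine le_mul_of_one_le_left (norm_nonneg _) (one_le_pow₀ ?_)
    have := abs_nonneg (n : ℝ); nlinarith
  have hp := has_pointwise_sum_fourier_series_of_summable hsF (t : AddCircle T)
  have ht' := abs_le.1 ht
  have hFt : F (t : AddCircle T) = (f t : ℂ) := by
    change AddCircle.liftIco T a (fun x => (g x : ℂ)) (t : AddCircle T) = _
    rw [AddCircle.liftIco_coe_apply ⟨by linarith, by linarith⟩]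
    have : φ t = 1 := φ.one_of_mem_closedBall (by simpa [φ] using ht)
    simp [hgdef, this]
  rw [hFt] at hp
  convert! hp using 2 with n
  rw [hco, smul_eq_mul, fourier_coe_apply]
  congr 2
  push_cast [hκ]
  ring

/-! ### Approximation by sums of ReLUs with bounded coefficients -/

lemma relu_of_nonneg {t : ℝ} (h : 0 ≤ t) : relu t = t := max_eq_left h

lemma relu_of_nonpos {t : ℝ} (h : t ≤ 0) : relu t = 0 := max_eq_right h

lemma continuous_relu : Continuous relu := continuous_id.max continuous_const

lemma abs_relu_sub_relu_le (s t : ℝ) : |relu s - relu t| ≤ |s - t| := abs_max_sub_max_le_abs s t 0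

/-- Taylor's formula of order two with the remainder written as an integral of ReLUs. -/
lemma integral_mul_relu {h h' h'' : ℝ → ℝ} {R t : ℝ} (d1 : ∀ x, HasDerivAt h (h' x) x)
    (d2 : ∀ x, HasDerivAt h' (h'' x) x) (hc : Continuous h'') (ht : |t| ≤ R) :
    ∫ τ in (-R)..R, h'' τ * relu (t - τ) = h t - h (-R) - h' (-R) * (t + R) := by
  obtain ⟨ht1, ht2⟩ := abs_le.1 ht
  have hcont : Continuous fun τ => h'' τ * relu (t - τ) :=
    hc.mul (continuous_relu.comp (continuous_const.sub continuous_id))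
  rw [← intervalIntegral.integral_add_adjacent_intervals (hcont.intervalIntegrable (-R) t)
    (hcont.intervalIntegrable t R)]
  have h2 : ∫ τ in t..R, h'' τ * relu (t - τ) = 0 := by
    rw [intervalIntegral.integral_congr (g := fun _ => 0)]
    · simp
    · intro τ hτ
      rw [Set.uIcc_of_le ht2] at hτ
      simp [relu_of_nonpos (sub_nonpos.2 hτ.1)]
  have h1 : ∫ τ in (-R)..t, h'' τ * relu (t - τ) = ∫ τ in (-R)..t, h'' τ * (t - τ) := by
    refine intervalIntegral.integral_congr fun τ hτ => ?_
    rw [Set.uIcc_of_le ht1] at hτ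
    simp [relu_of_nonneg (sub_nonneg.2 hτ.2)]
  have h3 : ∀ τ, HasDerivAt (fun τ => h' τ * (t - τ) + h τ) (h'' τ * (t - τ)) τ := by
    intro τ
    have := ((d2 τ).mul ((hasDerivAt_id τ).const_sub t)).add (d1 τ)
    convert! this using 1
    simp
  rw [h2, h1, intervalIntegral.integral_eq_sub_of_hasDerivAt (fun τ _ => h3 τ)
    ((hc.mul (continuous_const.sub continuous_id)).intervalIntegrable _ _)]
  ring

/-- A function with second derivative at most `A` is approximated by an affine function and `N`
ReLUs with equidistant knots. -/
lemma exists_relu_knots {h h' h'' : ℝ → ℝ} {R A : ℝ} (hR : 0 < R)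
    (d1 : ∀ x, HasDerivAt h (h' x) x) (d2 : ∀ x, HasDerivAt h' (h'' x) x) (hc : Continuous h'')
    (hA : ∀ x, |h'' x| ≤ A) {N : ℕ} (hN : 0 < N) :
    ∃ c τ : Fin N → ℝ, (∑ i, |c i| ≤ 2 * R * A) ∧ (∀ i, |τ i| ≤ R) ∧
      ∀ t, |t| ≤ R → |h t - (h (-R) + h' (-R) * (t + R) + ∑ i, c i * relu (t - τ i))| ≤
        4 * R ^ 2 * A / N := by
  have hN' : (0 : ℝ) < N := Nat.cast_pos.2 hN
  set δ : ℝ := 2 * R / N with hδ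
  have hδ0 : 0 < δ := by positivity
  have hNδ : N * δ = 2 * R := by rw [hδ]; field_simp
  set s : ℕ → ℝ := fun i => -R + i * δ with hs
  have hstep : ∀ i, s (i + 1) = s i + δ := fun i => by simp only [hs]; push_cast; ring
  have hs0 : s 0 = -R := by simp [hs]
  have hsN : s N = R := by simp only [hs, hNδ]; ring
  have hint : ∀ i, |∫ τ in s i..s (i + 1), h'' τ| ≤ A * δ := by
    intro i
    refine (intervalIntegral.norm_integral_le_of_norm_le_const (f := h'') (C := A)
      fun x _ => hA x).trans ?_
    rw [hstep, add_sub_cancel_left, abs_of_pos hδ0]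
  -- In Taylor's formula the knot `τ` is moved to the left end of its cell. As ReLU is 1-Lipschitz,
  -- this costs at most `A * δ * δ` per cell, hence `4 * R ^ 2 * A / N` in all. The coefficients are
  -- integrals of `h''` over the cells, so their mass does not grow with `N`.
  refine ⟨fun i => ∫ τ in s i..s (i + 1), h'' τ, fun i => s i, ?_, ?_, ?_⟩
  · refine (Finset.sum_le_sum fun (i : Fin N) _ => hint i).trans ?_
    simp only [Finset.sum_const, Finset.card_univ, Fintype.card_fin, nsmul_eq_mul]
    apply le_of_eq
    linear_combination A * hNδ
  · intro i
    have h1 : (0 : ℝ) ≤ i * δ := by positivity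
    have h2 : (i : ℝ) * δ ≤ N * δ := by gcongr; exact i.2.le
    simp only [hs]
    rw [abs_le]; constructor <;> linarith
  · intro t ht
    have hcont : Continuous fun τ => h'' τ * relu (t - τ) :=
      hc.mul (continuous_relu.comp (continuous_const.sub continuous_id))
    have e1 := integral_mul_relu d1 d2 hc ht
    have e2 := intervalIntegral.sum_integral_adjacent_intervals (a := s) (n := N)
      (f := fun τ => h'' τ * relu (t - τ)) (μ := MeasureTheory.volume)
      (fun k _ => hcont.intervalIntegrable _ _)
    rw [hs0, hsN, e1] at e2
    have e3 : h t - (h (-R) + h' (-R) * (t + R) +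
        ∑ i : Fin N, (∫ τ in s i..s (i + 1), h'' τ) * relu (t - s i)) =
        ∑ i ∈ Finset.range N, ((∫ τ in s i..s (i + 1), h'' τ * relu (t - τ)) -
          (∫ τ in s i..s (i + 1), h'' τ) * relu (t - s i)) := by
      rw [Finset.sum_sub_distrib, e2,
        Fin.sum_univ_eq_sum_range (fun i => (∫ τ in s i..s (i + 1), h'' τ) * relu (t - s i))]
      ring
    rw [e3]
    have hterm : ∀ i, |(∫ τ in s i..s (i + 1), h'' τ * relu (t - τ)) -
          (∫ τ in s i..s (i + 1), h'' τ) * relu (t - s i)| ≤ A * δ * δ := by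
      intro i
      rw [← intervalIntegral.integral_mul_const, ← intervalIntegral.integral_sub
        (hcont.intervalIntegrable _ _) ((show Continuous fun τ => h'' τ * relu (t - s i) from
          hc.mul continuous_const).intervalIntegrable _ _)]
      have : ∀ x ∈ Set.uIoc (s i) (s (i + 1)),
          ‖h'' x * relu (t - x) - h'' x * relu (t - s i)‖ ≤ A * δ := by
        intro x hx
        rw [hstep, Set.uIoc_of_le (by linarith)] at hx
        rw [← mul_sub, norm_mul]
        refine mul_le_mul (hA x) ((abs_relu_sub_relu_le _ _).trans ?_) (norm_nonneg _)
          ((abs_nonneg _).trans (hA x))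
        rw [abs_le]; constructor <;> linarith [hx.1, hx.2]
      refine (intervalIntegral.norm_integral_le_of_norm_le_const this).trans ?_
      rw [hstep, add_sub_cancel_left, abs_of_pos hδ0]
    refine (Finset.abs_sum_le_sum_abs _ _).trans ((Finset.sum_le_sum fun i _ => hterm i).trans ?_)
    simp only [Finset.sum_const, Finset.card_range, nsmul_eq_mul]
    apply le_of_eq
    rw [eq_div_iff hN'.ne']
    linear_combination A * (N * δ + 2 * R) * hNδ

/-- A finite linear combination of ReLUs of affine functions of two variables. -/
structure ReluSum where
  ι : Type
  [fintype : Fintype ι]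
  c : ι → ℝ
  a₁ : ι → ℝ
  a₂ : ι → ℝ
  b : ι → ℝ

attribute [instance] ReluSum.fintype

/-- The function of two variables given by a combination of ReLUs. -/
def ReluSum.eval (s : ReluSum) (p t : ℝ) : ℝ :=
  ∑ m, s.c m * relu (s.a₁ m * p + s.a₂ m * t + s.b m)

/-- `F` is approximated on `[-R, R]²` up to `C / N` by the sum `s` of at most `C * N ^ 2` ReLUs of
affine functions with bounded coefficients. -/
structure ReluSum.Approximates (s : ReluSum) (F : ℝ → ℝ → ℝ) (R C : ℝ) (N : ℕ) : Prop where
  card_le : (Fintype.card s.ι : ℝ) ≤ C * N ^ 2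
  mass_le : ∑ m, |s.c m| ≤ C
  abs_a₁_le : ∀ m, |s.a₁ m| ≤ 1
  abs_a₂_le : ∀ m, |s.a₂ m| ≤ 1
  abs_b_le : ∀ m, |s.b m| ≤ C
  abs_sub_le : ∀ p t, |p| ≤ R → |t| ≤ R → |F p t - s.eval p t| ≤ C / N

/-- Plane waves are approximated by ridge functions; `W` bounds the frequency. -/
lemma exists_relu_planeWave {α β W φ R : ℝ} (hR : 0 < R) (hW : 1 + |α| + |β| = W) {N : ℕ}
    (hN : 0 < N) :
    ∃ c a₁ a₂ b : Fin N ⊕ Fin 2 → ℝ, (∑ m, |c m| ≤ (2 * R + 2) * W ^ 2) ∧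
      (∀ m, |a₁ m| ≤ 1 ∧ |a₂ m| ≤ 1 ∧ |b m| ≤ R + 1) ∧
      ∀ p t, |p| ≤ R → |t| ≤ R →
        |Real.cos (α * p + β * t + φ) - ∑ m, c m * relu (a₁ m * p + a₂ m * t + b m)| ≤
          4 * R ^ 2 * W ^ 2 / N := by
  have hα := abs_nonneg α
  have hβ := abs_nonneg β
  have hW1 : 1 ≤ W := by linarith
  have hW0 : 0 < W := by linarith
  have dlin : ∀ x, HasDerivAt (fun z => W * z + φ) W x := fun x => by
    simpa using ((hasDerivAt_id x).const_mul W).add_const φ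
  have d1 : ∀ x, HasDerivAt (fun z => Real.cos (W * z + φ)) (-W * Real.sin (W * x + φ)) x := by
    intro x
    convert! (dlin x).cos using 1
    ring
  have d2 : ∀ x, HasDerivAt (fun z => -W * Real.sin (W * z + φ))
      (-W ^ 2 * Real.cos (W * x + φ)) x := by
    intro x
    convert! (dlin x).sin.const_mul (-W) using 1
    ring
  obtain ⟨c, τ, hc, hτ, happ⟩ := exists_relu_knots (A := W ^ 2) hR d1 d2 (by fun_prop) (fun x => by
    rw [abs_mul, abs_neg, abs_of_nonneg (sq_nonneg W)]
    exact mul_le_of_le_one_right (sq_nonneg W) (Real.abs_cos_le_one _)) hN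
  -- Dividing the direction by `W` makes the input weights at most 1 and keeps the ridge variable
  -- `z` in `[-R, R]`, where `relu (z + R)` is `z + R`. The two extra units, this one and `relu 1`,
  -- thus represent the affine part of Taylor's formula exactly.
  refine ⟨Sum.elim c ![-W * Real.sin (W * -R + φ), Real.cos (W * -R + φ)],
    Sum.elim (fun _ => α / W) ![α / W, 0], Sum.elim (fun _ => β / W) ![β / W, 0],
    Sum.elim (fun i => - τ i) ![R, 1], ?_, ?_, ?_⟩
  · simp only [Fintype.sum_sum_type, Sum.elim_inl, Sum.elim_inr, Fin.sum_univ_two,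
      Matrix.cons_val_zero, Matrix.cons_val_one]
    have h1 : |-W * Real.sin (W * -R + φ)| ≤ W := by
      rw [abs_mul, abs_neg, abs_of_pos hW0]
      exact mul_le_of_le_one_right hW0.le (Real.abs_sin_le_one _)
    have h2 := Real.abs_cos_le_one (W * -R + φ)
    nlinarith
  · have h1 : |α / W| ≤ 1 := by rw [abs_div, abs_of_pos hW0, div_le_one hW0]; linarith
    have h2 : |β / W| ≤ 1 := by rw [abs_div, abs_of_pos hW0, div_le_one hW0]; linarith
    have h3 : |R| ≤ R + 1 := by rw [abs_of_pos hR]; linarith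
    rintro (i | i)
    · exact ⟨h1, h2, by simpa using (hτ i).trans (by linarith)⟩
    · fin_cases i
      · exact ⟨h1, h2, h3⟩
      · exact ⟨by simp, by simp, by simp [hR.le]⟩
  · intro p t hp ht
    set z := α / W * p + β / W * t with hz
    have hWz : W * z = α * p + β * t := by rw [hz]; field_simp
    have hzR : |z| ≤ R := by
      have h1 : |W * z| ≤ |α| * R + |β| * R := by
        rw [hWz]
        refine (abs_add_le _ _).trans (add_le_add ?_ ?_) <;> rw [abs_mul] <;> gcongr
      rw [abs_mul, abs_of_pos hW0] at h1
      have : W * |z| ≤ W * R := h1.trans (by nlinarith)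
      exact le_of_mul_le_mul_left this hW0
    have h0 : 0 ≤ z + R := by linarith [(abs_le.1 hzR).1]
    have hfin := happ z hzR
    rw [hWz] at hfin
    refine le_trans (le_of_eq ?_) hfin
    simp only [Fintype.sum_sum_type, Sum.elim_inl, Sum.elim_inr, Fin.sum_univ_two,
      Matrix.cons_val_zero, Matrix.cons_val_one, zero_mul, zero_add, ← sub_eq_add_neg, ← hz,
      relu_of_nonneg h0, relu_of_nonneg zero_le_one]
    congr 1
    ring

/-- Truncation error of a series with summable quadratic weights. -/
lemma norm_sub_sum_Icc_le {κ : ℝ} {b e : ℤ → ℂ} {x : ℂ} (hκ : 0 < κ)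
    (hb : Summable fun n : ℤ => (1 + κ * |(n : ℝ)|) ^ 2 * ‖b n‖) (he : ∀ n, ‖e n‖ = 1)
    (hx : HasSum (fun n => b n * e n) x) {B : ℕ} (hB : 0 < B) :
    ‖x - ∑ n ∈ Finset.Icc (-B : ℤ) B, b n * e n‖ ≤
      (∑' n : ℤ, (1 + κ * |(n : ℝ)|) ^ 2 * ‖b n‖) / (κ ^ 2 * B ^ 2) := by
  have hB' : (0 : ℝ) < B := Nat.cast_pos.2 hB
  set s := Finset.Icc (-B : ℤ) B
  have h1 : HasSum (fun n => if n ∈ s then b n * e n else 0) (∑ n ∈ s, b n * e n) := by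
    have := hasSum_sum_of_ne_finset_zero (L := .unconditional ℤ) (s := s) (f := fun n => if n ∈ s then b n * e n else 0)
      (fun n hn => by simp [hn])
    rwa [Finset.sum_congr rfl (g := fun n => b n * e n) (fun n hn => by simp [hn])] at this
  have h2 := hx.sub h1
  rw [← h2.tsum_eq]
  refine tsum_of_norm_bounded (hb.hasSum.div_const _) fun n => ?_
  have hκB : 0 < κ ^ 2 * (B : ℝ) ^ 2 := by positivity
  by_cases hn : n ∈ s
  · simp only [hn, if_true, sub_self, norm_zero]; positivity
  · simp only [hn, if_false, sub_zero, norm_mul, he, mul_one]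
    rw [le_div_iff₀ hκB, mul_comm]
    refine mul_le_mul_of_nonneg_right ?_ (norm_nonneg _)
    rw [← mul_pow]
    have : (B : ℝ) ≤ |(n : ℝ)| := by
      simp only [s, Finset.mem_Icc, not_and_or, not_le] at hn
      rcases hn with hn | hn
      · have : (n : ℝ) < -B := by exact_mod_cast hn
        exact le_trans (by linarith) (neg_le_abs _)
      · have : (B : ℝ) < n := by exact_mod_cast hn
        exact le_trans this.le (le_abs_self _)
    gcongr
    nlinarith

/-- Polar form: the arguments of the two coefficients become a phase. This turns a product of
Fourier modes in separate variables into a real plane wave with nonnegative amplitude. -/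
lemma re_mul_exp_mul_exp (z w : ℂ) (x y : ℝ) :
    (z * Complex.exp ((x : ℂ) * Complex.I) * (w * Complex.exp ((y : ℂ) * Complex.I))).re =
      ‖z‖ * ‖w‖ * Real.cos (x + y + (z.arg + w.arg)) := by
  conv_lhs => rw [← Complex.norm_mul_exp_arg_mul_I z, ← Complex.norm_mul_exp_arg_mul_I w]
  have : (‖z‖ : ℂ) * Complex.exp (z.arg * Complex.I) * Complex.exp ((x : ℂ) * Complex.I) *
      ((‖w‖ : ℂ) * Complex.exp (w.arg * Complex.I) * Complex.exp ((y : ℂ) * Complex.I)) =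
      ((‖z‖ * ‖w‖ : ℝ) : ℂ) *
        Complex.exp (((x + y + (z.arg + w.arg) : ℝ) : ℂ) * Complex.I) := by
    push_cast
    rw [add_mul, add_mul, add_mul, Complex.exp_add, Complex.exp_add, Complex.exp_add]
    ring
  rw [this, Complex.re_ofReal_mul, Complex.exp_ofReal_mul_I_re]

/-- Products of `C³` functions of separate variables are approximated by sums of ReLUs. -/
theorem exists_reluApprox_mul {f g : ℝ → ℝ} (hf : ContDiff ℝ 3 f) (hg : ContDiff ℝ 3 g) {R : ℝ}
    (hR : 0 < R) :
    ∃ C > 0, ∀ N : ℕ, 0 < N → ∃ s : ReluSum, s.Approximates (fun p t => g p * f t) R C N := by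
  obtain ⟨κ, a, hκ, ha, hga⟩ := exists_fourier_expansion hg hR
  obtain ⟨μ, b, hμ, hb, hfb⟩ := exists_fourier_expansion hf hR
  set A : ℤ → ℝ := fun n => (1 + κ * |(n : ℝ)|) ^ 2 * ‖a n‖
  set B : ℤ → ℝ := fun n => (1 + μ * |(n : ℝ)|) ^ 2 * ‖b n‖
  have hA0 : ∀ n, 0 ≤ A n := fun n => by positivity
  have hB0 : ∀ n, 0 ≤ B n := fun n => by positivity
  set SA := ∑' n, A n
  set SB := ∑' n, B n
  have hSA : 0 ≤ SA := tsum_nonneg hA0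
  have hSB : 0 ≤ SB := tsum_nonneg hB0
  have haA : ∀ n, ‖a n‖ ≤ A n := fun n =>
    le_mul_of_one_le_left (norm_nonneg _) (one_le_pow₀ (by
      have := mul_nonneg hκ.le (abs_nonneg (n : ℝ)); linarith))
  have hbB : ∀ n, ‖b n‖ ≤ B n := fun n =>
    le_mul_of_one_le_left (norm_nonneg _) (one_le_pow₀ (by
      have := mul_nonneg hμ.le (abs_nonneg (n : ℝ)); linarith))
  set C := 108 + (R + 1) + (2 * R + 2) * (SA * SB) + 4 * R ^ 2 * (SA * SB) +
    SA * SB / κ ^ 2 + SA * SB / μ ^ 2 with hC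
  have hSS : 0 ≤ SA * SB := mul_nonneg hSA hSB
  have p1 : 0 ≤ (2 * R + 2) * (SA * SB) := by positivity
  have p2 : 0 ≤ 4 * R ^ 2 * (SA * SB) := by positivity
  have p3 : 0 ≤ SA * SB / κ ^ 2 := by positivity
  have p4 : 0 ≤ SA * SB / μ ^ 2 := by positivity
  refine ⟨C, by linarith, fun N hN => ?_⟩
  have hN' : (0 : ℝ) < N := Nat.cast_pos.2 hN
  -- Quadratic weights give a truncation error of order `D⁻²`, so `D` of order `√N` suffices. The
  -- number of pairs of modes is then at most `36 * N`, and with `N + 2` units for each pair the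
  -- total is quadratic in `N`.
  set D : ℕ := Nat.sqrt N + 1 with hD
  have hD0 : 0 < D := Nat.succ_pos _
  have hND : N ≤ D ^ 2 := (Nat.lt_succ_sqrt' N).le
  have hDN : D ^ 2 ≤ 4 * N := by
    have h1 : Nat.sqrt N ^ 2 ≤ N := Nat.sqrt_le' N
    have h2 : 1 ≤ Nat.sqrt N := Nat.le_sqrt'.2 (by rw [one_pow]; exact hN)
    rw [hD]; nlinarith
  set s := Finset.Icc (-D : ℤ) D with hsdef
  have hmode := fun mn : s × s => exists_relu_planeWave (α := κ * (mn.1.1 : ℝ))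
    (β := μ * (mn.2.1 : ℝ)) (φ := (a mn.1).arg + (b mn.2).arg) hR rfl hN
  choose c a₁ a₂ d hcW hbd happ using hmode
  -- Mass and error of a plane wave grow like the square of its frequency. The frequency weight is
  -- at most the product of the weights in the two variables, so summing over all pairs of modes is
  -- bounded by `SA * SB`.
  have hWle : ∀ m n : ℤ, (1 + |κ * (m : ℝ)| + |μ * (n : ℝ)|) ^ 2 * (‖a m‖ * ‖b n‖) ≤
      A m * B n := by
    intro m n
    have : A m * B n = ((1 + κ * |(m : ℝ)|) * (1 + μ * |(n : ℝ)|)) ^ 2 * (‖a m‖ * ‖b n‖) := by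
      simp only [A, B]; ring
    rw [this, abs_mul, abs_mul, abs_of_pos hκ, abs_of_pos hμ]
    gcongr
    have := mul_nonneg (mul_nonneg hκ.le (abs_nonneg (m : ℝ)))
      (mul_nonneg hμ.le (abs_nonneg (n : ℝ)))
    nlinarith
  have hsumAB : ∑ mn : s × s, A mn.1 * B mn.2 ≤ SA * SB := by
    rw [Fintype.sum_prod_type]
    simp only [← Finset.mul_sum, ← Finset.sum_mul]
    rw [Finset.sum_coe_sort s A, Finset.sum_coe_sort s B]
    exact mul_le_mul (ha.sum_le_tsum s fun n _ => hA0 n) (hb.sum_le_tsum s fun n _ => hB0 n)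
      (Finset.sum_nonneg fun n _ => hB0 n) hSA
  have hcard : (Fintype.card ((s × s) × (Fin N ⊕ Fin 2)) : ℝ) ≤ 108 * N ^ 2 := by
    have h1 : Fintype.card s = 2 * D + 1 := by
      rw [Fintype.card_coe, hsdef, Int.card_Icc]; omega
    have h2 : Fintype.card ((s × s) × (Fin N ⊕ Fin 2)) ≤ 108 * N ^ 2 := by
      simp only [Fintype.card_prod, h1, Fintype.card_sum, Fintype.card_fin]
      have h3 : (2 * D + 1) * (2 * D + 1) ≤ 36 * N := by nlinarith
      calc _ ≤ 36 * N * (3 * N) := Nat.mul_le_mul h3 (by omega)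
        _ = _ := by ring
    exact_mod_cast h2
  refine ⟨⟨(s × s) × (Fin N ⊕ Fin 2), fun x => ‖a x.1.1‖ * ‖b x.1.2‖ * c x.1 x.2,
    fun x => a₁ x.1 x.2, fun x => a₂ x.1 x.2, fun x => d x.1 x.2⟩, ?_, ?_,
    fun x => (hbd x.1 x.2).1, fun x => (hbd x.1 x.2).2.1,
    fun x => (hbd x.1 x.2).2.2.trans (by linarith), ?_⟩
  · exact hcard.trans (mul_le_mul_of_nonneg_right (by linarith) (by positivity))
  · rw [Fintype.sum_prod_type]
    have hle : ∀ mn : s × s, ∑ i, |‖a mn.1‖ * ‖b mn.2‖ * c mn i| ≤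
        (2 * R + 2) * (A mn.1 * B mn.2) := by
      intro mn
      simp only [abs_mul, abs_norm, ← Finset.mul_sum]
      calc _ ≤ ‖a mn.1‖ * ‖b mn.2‖ *
            ((2 * R + 2) * (1 + |κ * (mn.1.1 : ℝ)| + |μ * (mn.2.1 : ℝ)|) ^ 2) :=
            mul_le_mul_of_nonneg_left (hcW mn) (by positivity)
        _ = (2 * R + 2) * ((1 + |κ * (mn.1.1 : ℝ)| + |μ * (mn.2.1 : ℝ)|) ^ 2 *
            (‖a mn.1‖ * ‖b mn.2‖)) := by ring
        _ ≤ _ := mul_le_mul_of_nonneg_left (hWle _ _) (by linarith)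
    refine (Finset.sum_le_sum fun mn _ => hle mn).trans ?_
    rw [← Finset.mul_sum]
    have := mul_le_mul_of_nonneg_left hsumAB (show 0 ≤ 2 * R + 2 by linarith)
    linarith
  · intro p t hp ht
    set ea : ℤ → ℂ := fun n => Complex.exp (((κ * n * p : ℝ) : ℂ) * Complex.I)
    set eb : ℤ → ℂ := fun n => Complex.exp (((μ * n * t : ℝ) : ℂ) * Complex.I)
    have hea : ∀ n, ‖ea n‖ = 1 := fun n => Complex.norm_exp_ofReal_mul_I _
    have heb : ∀ n, ‖eb n‖ = 1 := fun n => Complex.norm_exp_ofReal_mul_I _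
    set Ta := ∑ n ∈ s, a n * ea n with hTa
    set Tb := ∑ n ∈ s, b n * eb n with hTb
    have hDD : (N : ℝ) ≤ D ^ 2 := by exact_mod_cast hND
    have ta : ‖(g p : ℂ) - Ta‖ ≤ SA / (κ ^ 2 * N) :=
      (norm_sub_sum_Icc_le hκ ha hea (hga p hp) hD0).trans (by gcongr)
    have tb : ‖(f t : ℂ) - Tb‖ ≤ SB / (μ ^ 2 * N) :=
      (norm_sub_sum_Icc_le hμ hb heb (hfb t ht) hD0).trans (by gcongr)
    have na : ‖Ta‖ ≤ SA := by
      refine (norm_sum_le _ _).trans ((Finset.sum_le_sum fun n _ => ?_).trans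
        (ha.sum_le_tsum s fun n _ => hA0 n))
      rw [norm_mul, hea, mul_one]; exact haA n
    have nb : ‖(f t : ℂ)‖ ≤ SB := by
      rw [← (hfb t ht).tsum_eq]
      refine tsum_of_norm_bounded hb.hasSum fun n => ?_
      rw [norm_mul, Complex.norm_exp_ofReal_mul_I, mul_one]; exact hbB n
    have htrunc : |g p * f t - (Ta * Tb).re| ≤ (SA * SB / κ ^ 2 + SA * SB / μ ^ 2) / N := by
      have e1 : g p * f t - (Ta * Tb).re = (((g p : ℂ) - Ta) * f t + Ta * ((f t : ℂ) - Tb)).re := by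
        have : ((g p : ℂ) - Ta) * f t + Ta * ((f t : ℂ) - Tb) =
          ((g p * f t : ℝ) : ℂ) - Ta * Tb := by push_cast; ring
        rw [this, Complex.sub_re, Complex.ofReal_re]
      rw [e1]
      refine (Complex.abs_re_le_norm _).trans ((norm_add_le _ _).trans ?_)
      rw [norm_mul, norm_mul]
      calc _ ≤ SA / (κ ^ 2 * N) * SB + SA * (SB / (μ ^ 2 * N)) :=
            add_le_add (mul_le_mul ta nb (norm_nonneg _) (by positivity))
              (mul_le_mul na tb (norm_nonneg _) hSA)
        _ = _ := by field_simp
    have hre : (Ta * Tb).re = ∑ mn : s × s, ‖a mn.1‖ * ‖b mn.2‖ *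
        Real.cos (κ * (mn.1.1 : ℝ) * p + μ * (mn.2.1 : ℝ) * t + ((a mn.1).arg + (b mn.2).arg)) := by
      rw [hTa, hTb, ← Finset.sum_coe_sort s, ← Finset.sum_coe_sort s, Fintype.sum_mul_sum,
        ← Fintype.sum_prod_type', Complex.re_sum]
      exact Finset.sum_congr rfl fun mn _ => re_mul_exp_mul_exp _ _ _ _
    have hrelu : |(Ta * Tb).re - ∑ x : (s × s) × (Fin N ⊕ Fin 2),
        ‖a x.1.1‖ * ‖b x.1.2‖ * c x.1 x.2 * relu (a₁ x.1 x.2 * p + a₂ x.1 x.2 * t + d x.1 x.2)| ≤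
        4 * R ^ 2 * (SA * SB) / N := by
      rw [hre, Fintype.sum_prod_type (γ := ℝ) (α₁ := s × s), ← Finset.sum_sub_distrib]
      have hle : ∀ mn : s × s, |‖a mn.1‖ * ‖b mn.2‖ *
          Real.cos (κ * (mn.1.1 : ℝ) * p + μ * (mn.2.1 : ℝ) * t +
            ((a mn.1).arg + (b mn.2).arg)) - ∑ i, ‖a mn.1‖ * ‖b mn.2‖ * c mn i *
            relu (a₁ mn i * p + a₂ mn i * t + d mn i)| ≤ 4 * R ^ 2 / N * (A mn.1 * B mn.2) := by
        intro mn
        simp only [mul_assoc (‖a mn.1‖ * ‖b mn.2‖), ← Finset.mul_sum]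
        rw [← mul_sub, abs_mul, abs_of_nonneg (by positivity)]
        calc _ ≤ ‖a mn.1‖ * ‖b mn.2‖ *
              (4 * R ^ 2 * (1 + |κ * (mn.1.1 : ℝ)| + |μ * (mn.2.1 : ℝ)|) ^ 2 / N) :=
              mul_le_mul_of_nonneg_left (happ mn p t hp ht) (by positivity)
          _ = 4 * R ^ 2 / N * ((1 + |κ * (mn.1.1 : ℝ)| + |μ * (mn.2.1 : ℝ)|) ^ 2 *
            (‖a mn.1‖ * ‖b mn.2‖)) := by ring
          _ ≤ _ := mul_le_mul_of_nonneg_left (hWle _ _) (by positivity)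
      refine (Finset.abs_sum_le_sum_abs _ _).trans ((Finset.sum_le_sum fun mn _ => hle mn).trans ?_)
      rw [← Finset.mul_sum]
      calc _ ≤ 4 * R ^ 2 / N * (SA * SB) := mul_le_mul_of_nonneg_left hsumAB (by positivity)
        _ = _ := by ring
    refine (abs_sub_le _ ((Ta * Tb).re) _).trans ((add_le_add htrunc hrelu).trans ?_)
    rw [← add_div]
    exact div_le_div_of_nonneg_right (by linarith) hN'.le

/-! ### Gradients of the networks and their losses -/

section Gradient

variable {F : Type*} [NormedAddCommGroup F] [InnerProductSpace ℝ F] [CompleteSpace F]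

lemma hasGradientAt_comp {φ : ℝ → ℝ} {φ' : ℝ} {f : F → ℝ} {G x : F}
    (hφ : HasDerivAt φ φ' (f x)) (hf : HasGradientAt f G x) :
    HasGradientAt (fun z => φ (f z)) (φ' • G) x := by
  rw [hasGradientAt_iff_hasFDerivAt] at hf ⊢
  simpa [Function.comp_def] using hφ.comp_hasFDerivAt x hf

lemma hasGradientAt_add {f g : F → ℝ} {G H x : F} (hf : HasGradientAt f G x)
    (hg : HasGradientAt g H x) : HasGradientAt (fun z => f z + g z) (G + H) x := by
  rw [hasGradientAt_iff_hasFDerivAt] at *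
  rw [map_add]
  exact hf.add hg

lemma hasGradientAt_const_mul {f : F → ℝ} {G x : F} (c : ℝ) (hf : HasGradientAt f G x) :
    HasGradientAt (fun z => c * f z) (c • G) x :=
  hasGradientAt_comp (φ := fun t => c * t) (by simpa using (hasDerivAt_id (f x)).const_mul c) hf

lemma hasGradientAt_sum {ι : Type*} (s : Finset ι) {f : ι → F → ℝ} {G : ι → F} {x : F}
    (hf : ∀ i ∈ s, HasGradientAt (f i) (G i) x) :
    HasGradientAt (fun z => ∑ i ∈ s, f i z) (∑ i ∈ s, G i) x := by
  simp only [hasGradientAt_iff_hasFDerivAt] at *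
  rw [map_sum]
  exact HasFDerivAt.fun_sum hf

end Gradient

/-- The derivative `ς (1 - ς)` of the sigmoid cancels both denominators that come from the
logarithms. The residual is therefore affine in the sigmoid, which is the only function of the
network output that needs approximation. -/
lemma hasDerivAt_loss (a q : ℝ) : HasDerivAt (fun a => loss a q) (Real.sigmoid a - q) a := by
  have h0 := Real.sigmoid_pos a
  have h1 : 0 < 1 - Real.sigmoid a := sub_pos.2 (Real.sigmoid_lt_one a)
  have hs := Real.hasDerivAt_sigmoid a
  have := ((hs.log h0.ne').const_mul (-q)).sub (((hs.const_sub 1).log h1.ne').const_mul (1 - q))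
  convert! this using 1
  field_simp
  ring

section Net

variable {d K : ℕ} (r : ℝ → ℝ)

/-- The inner product of the `k`-th inner weight vector with `x`. -/
def preact (u : EuclideanSpace ℝ (Fin K × Fin d)) (k : Fin K) (x : EuclideanSpace ℝ (Fin d)) : ℝ :=
  ∑ i, u (k, i) * x i

/-- The gradient of a network with respect to its inner weights. -/
def netGradU (u : EuclideanSpace ℝ (Fin K × Fin d)) (a : EuclideanSpace ℝ (Fin K))
    (x : EuclideanSpace ℝ (Fin d)) : EuclideanSpace ℝ (Fin K × Fin d) :=
  WithLp.toLp 2 fun ki => a ki.1 * deriv r (preact u ki.1 x) * x ki.2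

/-- The gradient of a network with respect to its outer weights. -/
def netGradA (u : EuclideanSpace ℝ (Fin K × Fin d)) (x : EuclideanSpace ℝ (Fin d)) :
    EuclideanSpace ℝ (Fin K) :=
  WithLp.toLp 2 fun k => r (preact u k x)

variable {r}

lemma hasGradientAt_preact (u : EuclideanSpace ℝ (Fin K × Fin d)) (k : Fin K)
    (x : EuclideanSpace ℝ (Fin d)) :
    HasGradientAt (fun u => preact u k x)
      (WithLp.toLp 2 fun ki => if ki.1 = k then x ki.2 else 0) u := by
  rw [hasGradientAt_iff_hasFDerivAt]
  have : (fun u => preact u k x) = InnerProductSpace.toDual ℝ (EuclideanSpace ℝ (Fin K × Fin d))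
      (WithLp.toLp 2 fun ki => if ki.1 = k then x ki.2 else 0) := by
    ext u
    simp [preact, PiLp.inner_apply, Fintype.sum_prod_type, Finset.sum_ite_irrel]
  rw [this]
  exact ContinuousLinearMap.hasFDerivAt _

lemma hasGradientAt_net_inner (hr : Differentiable ℝ r) (u : EuclideanSpace ℝ (Fin K × Fin d))
    (a : EuclideanSpace ℝ (Fin K)) (x : EuclideanSpace ℝ (Fin d)) :
    HasGradientAt (fun u => net r u a x) (netGradU r u a x) u := by
  have := hasGradientAt_sum Finset.univ fun k _ => hasGradientAt_const_mul (a k)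
    (hasGradientAt_comp (f := fun u => preact u k x) (hr (preact u k x)).hasDerivAt
      (hasGradientAt_preact u k x))
  convert! this using 1
  ext ki
  simp [netGradU, mul_assoc]

lemma hasGradientAt_net_outer (u : EuclideanSpace ℝ (Fin K × Fin d))
    (a : EuclideanSpace ℝ (Fin K)) (x : EuclideanSpace ℝ (Fin d)) :
    HasGradientAt (fun a => net r u a x) (netGradA r u x) a := by
  rw [hasGradientAt_iff_hasFDerivAt]
  have : (fun a => net r u a x) = InnerProductSpace.toDual ℝ (EuclideanSpace ℝ (Fin K))
      (netGradA r u x) := by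
    ext a
    simp [net, netGradA, preact, PiLp.inner_apply]
  rw [this]
  exact ContinuousLinearMap.hasFDerivAt _

variable {n n' : ℕ}

lemma gradient_labelLoss_outer (c : ℝ) (S : Data d n n') (u : EuclideanSpace ℝ (Fin K × Fin d))
    (w : EuclideanSpace ℝ (Fin K)) :
    gradient (fun w' => labelLoss r c S u w') w =
      c • ∑ i, (Real.sigmoid (net r u w (S.xS i)) - S.y i) • netGradA r u (S.xS i) :=
  (hasGradientAt_const_mul c (hasGradientAt_sum Finset.univ fun i _ =>
    hasGradientAt_comp (hasDerivAt_loss _ (S.y i)) (hasGradientAt_net_outer u w (S.xS i)))).gradient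

lemma gradient_domainLoss_outer (S : Data d n n') (u : EuclideanSpace ℝ (Fin K × Fin d))
    (v : EuclideanSpace ℝ (Fin K)) :
    gradient (fun v' => domainLoss r S u v') v =
      (1 / (n : ℝ)) • ∑ i, (Real.sigmoid (net r u v (S.xS i)) - 0) • netGradA r u (S.xS i) +
      (1 / (n' : ℝ)) • ∑ i, (Real.sigmoid (net r u v (S.xT i)) - 1) • netGradA r u (S.xT i) :=
  (hasGradientAt_add
    (hasGradientAt_const_mul _ (hasGradientAt_sum Finset.univ fun i _ =>
      hasGradientAt_comp (hasDerivAt_loss _ 0) (hasGradientAt_net_outer u v (S.xS i))))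
    (hasGradientAt_const_mul _ (hasGradientAt_sum Finset.univ fun i _ =>
      hasGradientAt_comp (hasDerivAt_loss _ 1) (hasGradientAt_net_outer u v (S.xT i))))).gradient

lemma gradient_loss_inner (hr : Differentiable ℝ r) (c lam : ℝ) (S : Data d n n')
    (u : EuclideanSpace ℝ (Fin K × Fin d)) (w v : EuclideanSpace ℝ (Fin K)) :
    gradient (fun u' => labelLoss r c S u' w - lam * domainLoss r S u' v) u =
      c • ∑ i, (Real.sigmoid (net r u w (S.xS i)) - S.y i) • netGradU r u w (S.xS i) +
      (-lam) •
        ((1 / (n : ℝ)) • ∑ i, (Real.sigmoid (net r u v (S.xS i)) - 0) • netGradU r u v (S.xS i) +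
        (1 / (n' : ℝ)) • ∑ i, (Real.sigmoid (net r u v (S.xT i)) - 1) • netGradU r u v (S.xT i)) := by
  have := hasGradientAt_add
    (hasGradientAt_const_mul c (hasGradientAt_sum Finset.univ fun i _ =>
      hasGradientAt_comp (hasDerivAt_loss _ (S.y i)) (hasGradientAt_net_inner hr u w (S.xS i))))
    (hasGradientAt_const_mul (-lam) (hasGradientAt_add
      (hasGradientAt_const_mul (1 / (n : ℝ)) (hasGradientAt_sum Finset.univ fun i _ =>
        hasGradientAt_comp (hasDerivAt_loss _ 0) (hasGradientAt_net_inner hr u v (S.xS i))))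
      (hasGradientAt_const_mul (1 / (n' : ℝ)) (hasGradientAt_sum Finset.univ fun i _ =>
        hasGradientAt_comp (hasDerivAt_loss _ 1) (hasGradientAt_net_inner hr u v (S.xT i))))))
  simp only [neg_mul, ← sub_eq_add_neg] at this
  exact this.gradient

end Net

/-! ### Operator norms -/

section OpNorm

variable {m n : Type} [Fintype m] [Fintype n] [DecidableEq n]

lemma opNorm_nonneg (A : Matrix m n ℝ) : 0 ≤ opNorm A := norm_nonneg _

lemma opNorm_le {A : Matrix m n ℝ} {C : ℝ} (hC : 0 ≤ C)
    (h : ∀ x : EuclideanSpace ℝ n, ‖(WithLp.toLp 2 (A *ᵥ x) : EuclideanSpace ℝ m)‖ ≤ C * ‖x‖) :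
    opNorm A ≤ C :=
  ContinuousLinearMap.opNorm_le_bound _ hC h

lemma norm_mulVec_le_opNorm (A : Matrix m n ℝ) (x : EuclideanSpace ℝ n) :
    ‖(WithLp.toLp 2 (A *ᵥ x) : EuclideanSpace ℝ m)‖ ≤ opNorm A * ‖x‖ :=
  ContinuousLinearMap.le_opNorm (LinearMap.toContinuousLinearMap (Matrix.toEuclideanLin A)) x

/-- The operator norm is at most the Frobenius norm. -/
lemma opNorm_le_of_sum_sq_le {A : Matrix m n ℝ} {C : ℝ} (hC : 0 ≤ C)
    (h : ∑ i, ∑ j, A i j ^ 2 ≤ C ^ 2) : opNorm A ≤ C := by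
  refine opNorm_le hC fun x => ?_
  refine le_of_sq_le_sq ?_ (by positivity)
  rw [mul_pow, EuclideanSpace.real_norm_sq_eq, EuclideanSpace.real_norm_sq_eq]
  calc ∑ i, (A *ᵥ x) i ^ 2 ≤ ∑ i, (∑ j, A i j ^ 2) * ∑ j, x j ^ 2 :=
        Finset.sum_le_sum fun i _ => Finset.sum_mul_sq_le_sq_mul_sq _ _ _
    _ = (∑ i, ∑ j, A i j ^ 2) * ∑ j, x j ^ 2 := by rw [Finset.sum_mul]
    _ ≤ _ := by gcongr

lemma opNorm_le_of_abs_le {A : Matrix m m ℝ} [DecidableEq m] {B : ℝ} (hB : 0 ≤ B)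
    (h : ∀ i j, |A i j| ≤ B) : opNorm A ≤ Fintype.card m * B := by
  refine opNorm_le_of_sum_sq_le (by positivity) ?_
  calc ∑ i, ∑ j, A i j ^ 2 ≤ ∑ _i : m, ∑ _j : m, B ^ 2 :=
        Finset.sum_le_sum fun i _ => Finset.sum_le_sum fun j _ => by
          rw [← sq_abs]; gcongr; exact h i j
    _ = _ := by simp; ring

end OpNorm

/-! ### Layers indexed by arbitrary finite types -/

section LayerOf

variable {T ι κ : Type} [Fintype T] [Fintype ι] [Fintype κ]

/-- The layer whose heads and hidden units are indexed by the finite types `ι` and `κ`. -/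
def Layer.of (Q K V : ι → Matrix T T ℝ) (W₁ : Matrix κ T ℝ) (W₂ : Matrix T κ ℝ) : Layer T where
  heads := Fintype.card ι
  hidden := Fintype.card κ
  Q := Q ∘ (Fintype.equivFin ι).symm
  K := K ∘ (Fintype.equivFin ι).symm
  V := V ∘ (Fintype.equivFin ι).symm
  W₁ := W₁.submatrix (Fintype.equivFin κ).symm id
  W₂ := W₂.submatrix id (Fintype.equivFin κ).symm

variable {Col : Type} (Q K V : ι → Matrix T T ℝ) (W₁ : Matrix κ T ℝ)
  (W₂ : Matrix T κ ℝ) (X : Matrix T Col ℝ)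

lemma Layer.attn_of [Fintype Col] (a : T) (i : Col) :
    (Layer.of Q K V W₁ W₂).attn X a i = X a i + (1 / (Fintype.card Col : ℝ)) *
      ∑ m, ∑ j, (∑ b, V m a b * X b j) *
        relu (∑ b, (∑ c, Q m b c * X c j) * ∑ c, K m b c * X c i) := by
  simp only [Layer.attn, Layer.of, Matrix.add_apply, Matrix.smul_apply, smul_eq_mul,
    Matrix.sum_apply]
  congr 2
  rw [← (Fintype.equivFin ι).symm.sum_comp]
  simp only [Matrix.mul_apply, Matrix.map_apply, Matrix.transpose_apply, Function.comp]
  rfl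

lemma Layer.mlp_of (a : T) (i : Col) :
    (Layer.of Q K V W₁ W₂).mlp X a i = X a i + ∑ h, W₂ a h * relu (∑ b, W₁ h b * X b i) := by
  simp only [Layer.mlp, Layer.of, Matrix.add_apply]
  congr 1
  exact (Fintype.equivFin κ).symm.sum_comp fun h => W₂ a h * relu (∑ b, W₁ h b * X b i)

lemma norm_submatrix_equiv {m m' : Type} [Fintype m] [Fintype m'] (e : m' ≃ m) (x : m → ℝ) :
    ‖(WithLp.toLp 2 (x ∘ e) : EuclideanSpace ℝ m')‖ = ‖(WithLp.toLp 2 x : EuclideanSpace ℝ m)‖ := by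
  rw [EuclideanSpace.norm_eq, EuclideanSpace.norm_eq]
  congr 1
  exact e.sum_comp fun i => ‖x i‖ ^ 2

lemma Layer.norm_of_le [DecidableEq T] [DecidableEq κ] {B₁ B₂ B₃ B₄ : ℝ} (hB : 0 ≤ B₁)
    (hQ : ∀ m, opNorm (Q m) ≤ B₁) (hK : ∀ m, opNorm (K m) ≤ B₁) (hV : ∑ m, opNorm (V m) ≤ B₂)
    (h₁ : opNorm W₁ ≤ B₃) (h₂ : opNorm W₂ ≤ B₄) :
    (Layer.of Q K V W₁ W₂).norm ≤ B₁ + B₂ + B₃ + B₄ := by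
  refine add_le_add (add_le_add (add_le_add ?_ ?_) ?_) ?_
  · exact Real.iSup_le (fun m => max_le (hQ _) (hK _)) hB
  · refine le_trans (le_of_eq ?_) hV
    exact (Fintype.equivFin ι).symm.sum_comp fun m => opNorm (V m)
  · refine le_trans (opNorm_le (opNorm_nonneg W₁) fun x => ?_) h₁
    refine le_trans (le_of_eq ?_) (norm_mulVec_le_opNorm W₁ x)
    exact norm_submatrix_equiv (Fintype.equivFin κ).symm (W₁ *ᵥ x)
  · refine le_trans (opNorm_le (opNorm_nonneg W₂) fun x => ?_) h₂
    have e : (Layer.of Q K V W₁ W₂).W₂ *ᵥ x = W₂ *ᵥ (x ∘ Fintype.equivFin κ) :=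
      Matrix.submatrix_mulVec_equiv W₂ x id (Fintype.equivFin κ).symm
    rw [e]
    refine (norm_mulVec_le_opNorm W₂ (WithLp.toLp 2 (x ∘ Fintype.equivFin κ))).trans (le_of_eq ?_)
    congr 1
    exact norm_submatrix_equiv (Fintype.equivFin κ) x

end LayerOf

/-! ### Feed-forward matrices with balanced weights -/

section Balanced

variable {T κ : Type} [Fintype T] [Fintype κ]

/-- Input weights `√|c h| * row h`. -/
def balancedIn (c : κ → ℝ) (row : κ → T → ℝ) : Matrix κ T ℝ :=
  Matrix.of fun h b => √|c h| * row h b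

/-- Output weights `± √|c h| * out h`. -/
def balancedOut (c : κ → ℝ) (out : κ → T → ℝ) : Matrix T κ ℝ :=
  Matrix.of fun a h => SignType.sign (c h) * √|c h| * out h a

lemma relu_mul_of_nonneg {s : ℝ} (hs : 0 ≤ s) (t : ℝ) : relu (s * t) = s * relu t := by
  simp [relu, mul_max_of_nonneg _ _ hs]

/-- ReLU is positively homogeneous, so the coefficient `c h` may be split into a factor `√|c h|`
before it and a factor `± √|c h|` after it. -/
lemma balanced_apply (c : κ → ℝ) (row out : κ → T → ℝ) (x : T → ℝ) (a : T) :
    ∑ h, balancedOut c out a h * relu (∑ b, balancedIn c row h b * x b) =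
      ∑ h, c h * out h a * relu (∑ b, row h b * x b) := by
  refine Finset.sum_congr rfl fun h _ => ?_
  have e : ∑ b, balancedIn c row h b * x b = √|c h| * ∑ b, row h b * x b := by
    rw [Finset.mul_sum]
    exact Finset.sum_congr rfl fun b _ => by simp [balancedIn, mul_assoc]
  rw [e, relu_mul_of_nonneg (Real.sqrt_nonneg _)]
  have h1 : √|c h| * √|c h| = |c h| := Real.mul_self_sqrt (abs_nonneg _)
  have h2 : (SignType.sign (c h) : ℝ) * |c h| = c h := sign_mul_abs (c h)
  simp only [balancedOut, Matrix.of_apply]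
  linear_combination (SignType.sign (c h) : ℝ) * out h a * relu (∑ b, row h b * x b) * h1 +
    out h a * relu (∑ b, row h b * x b) * h2

/-- After balancing, the squared entries of row `h` are at most `|c h| * B ^ 2`, so the Frobenius
norm is controlled by the mass of `c` and not by the number of hidden units. The additional `1 +`
and `+ 1` only avoid square roots. -/
lemma opNorm_balancedIn_le [DecidableEq T] {c : κ → ℝ} {row : κ → T → ℝ} {A B : ℝ} (hB : 0 ≤ B)
    (hA : ∑ h, |c h| ≤ A) (hrow : ∀ h b, |row h b| ≤ B) :
    opNorm (balancedIn c row) ≤ (1 + A) * ((Fintype.card T + 1) * B) := by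
  have hA0 : 0 ≤ A := le_trans (Finset.sum_nonneg fun _ _ => abs_nonneg _) hA
  refine opNorm_le_of_sum_sq_le (by positivity) ?_
  calc ∑ h, ∑ b, balancedIn c row h b ^ 2 ≤ ∑ h, ∑ _b : T, |c h| * B ^ 2 :=
        Finset.sum_le_sum fun h _ => Finset.sum_le_sum fun b _ => by
          simp only [balancedIn, Matrix.of_apply, mul_pow, Real.sq_sqrt (abs_nonneg _)]
          rw [← sq_abs (row h b)]
          gcongr
          exact hrow h b
    _ = (∑ h, |c h|) * (Fintype.card T * B ^ 2) := by
        simp only [Finset.sum_const, Finset.card_univ, nsmul_eq_mul, Finset.sum_mul]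
        exact Finset.sum_congr rfl fun _ _ => by ring
    _ ≤ (1 + A) ^ 2 * ((Fintype.card T + 1) ^ 2 * B ^ 2) := by
        have h0 : (0 : ℝ) ≤ Fintype.card T := by positivity
        gcongr <;> nlinarith
    _ = _ := by ring

lemma opNorm_balancedOut_le [DecidableEq κ] {c : κ → ℝ} {out : κ → T → ℝ} {A B : ℝ} (hB : 0 ≤ B)
    (hA : ∑ h, |c h| ≤ A) (hout : ∀ h b, |out h b| ≤ B) :
    opNorm (balancedOut c out) ≤ (1 + A) * ((Fintype.card T + 1) * B) := by
  have hA0 : 0 ≤ A := le_trans (Finset.sum_nonneg fun _ _ => abs_nonneg _) hA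
  refine opNorm_le_of_sum_sq_le (by positivity) ?_
  have hs : ∀ x : ℝ, (SignType.sign x : ℝ) ^ 2 ≤ 1 := fun x => by
    rcases lt_trichotomy x 0 with h | h | h
    · simp [sign_neg h]
    · simp [h]
    · simp [sign_pos h]
  rw [Finset.sum_comm]
  calc ∑ h, ∑ b, balancedOut c out b h ^ 2 ≤ ∑ h, ∑ _b : T, |c h| * B ^ 2 :=
        Finset.sum_le_sum fun h _ => Finset.sum_le_sum fun b _ => by
          simp only [balancedOut, Matrix.of_apply, mul_pow, Real.sq_sqrt (abs_nonneg _)]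
          rw [← sq_abs (out h b)]
          have h1 := hs (c h)
          have h2 := hout h b
          have h3 : (SignType.sign (c h) : ℝ) ^ 2 * |c h| ≤ |c h| :=
            mul_le_of_le_one_left (abs_nonneg _) h1
          gcongr
    _ = (∑ h, |c h|) * (Fintype.card T * B ^ 2) := by
        simp only [Finset.sum_const, Finset.card_univ, nsmul_eq_mul, Finset.sum_mul]
        exact Finset.sum_congr rfl fun _ _ => by ring
    _ ≤ (1 + A) ^ 2 * ((Fintype.card T + 1) ^ 2 * B ^ 2) := by
        have h0 : (0 : ℝ) ≤ Fintype.card T := by positivity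
        gcongr <;> nlinarith
    _ = _ := by ring

end Balanced

/-! ### Tokens with working memory -/

section Tokens

variable {d K n n' : ℕ}

/-- The points carried by the tokens. -/
def Data.point (S : Data d n n') : ColIdx n n' → EuclideanSpace ℝ (Fin d) :=
  Sum.elim S.xS (Sum.elim S.xT fun _ => S.query)

/-- The coordinates `(y, t, s, 1)` of the tokens. -/
def Data.flags (S : Data d n n') : ColIdx n n' → Fin 4 → ℝ :=
  Sum.elim (fun i => ![S.y i, 1, 1, 1]) (Sum.elim (fun _ => ![0, 0, 1, 1]) fun _ => ![0, 0, 0, 1])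

/-- The tokens with parameters `θ` and working memory `mem`. -/
def memTokens (S : Data d n n') (θ : Param d K) (mem : ColIdx n n' → Fin 4 → ℝ) :
    Matrix (TokIdx d K) (ColIdx n n') ℝ :=
  Matrix.of fun a j => Sum.elim (S.point j) (Sum.elim (S.flags j) (Sum.elim θ (mem j))) a

lemma tokens_eq_memTokens (S : Data d n n') (θ : Param d K) : tokens S θ = memTokens S θ 0 := by
  ext a j
  rcases j with i | i | i <;> rfl

lemma flags_three (S : Data d n n') (j : ColIdx n n') : S.flags j 3 = 1 := by
  rcases j with i | i | i <;> rfl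

/-- Coordinate of a component of the point in a token. -/
abbrev idxX (i : Fin d) : TokIdx d K := .inl i
/-- Coordinate of one of `y, t, s, 1` in a token. -/
abbrev idxFlag (q : Fin 4) : TokIdx d K := .inr (.inl q)
/-- Coordinate of an entry of `u` in a token. -/
abbrev idxU (k : Fin K) (i : Fin d) : TokIdx d K := .inr (.inr (.inl (.inl (k, i))))
/-- Coordinate of an entry of `w` in a token. -/
abbrev idxW (k : Fin K) : TokIdx d K := .inr (.inr (.inl (.inr (.inl k))))
/-- Coordinate of an entry of `v` in a token. -/
abbrev idxV (k : Fin K) : TokIdx d K := .inr (.inr (.inl (.inr (.inr k))))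
/-- Coordinate of a cell of the working memory in a token. -/
abbrev idxMem (q : Fin 4) : TokIdx d K := .inr (.inr (.inr q))

/-! ### Attention heads -/

/-- The matrix which puts coordinate `s a` into row `a`. -/
def selMat {T : Type} [DecidableEq T] (s : T → Option T) : Matrix T T ℝ :=
  Matrix.of fun a b => if s a = some b then 1 else 0

lemma sum_selMat_mul {T : Type} [Fintype T] [DecidableEq T] (s : T → Option T) (a : T)
    (x : T → ℝ) : ∑ b, selMat s a b * x b = (s a).elim 0 x := by
  cases h : s a <;> simp [selMat, h]

lemma abs_selMat_le {T : Type} [DecidableEq T] (s : T → Option T) (a b : T) :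
    |selMat s a b| ≤ 1 := by
  simp only [selMat, Matrix.of_apply]
  split_ifs <;> simp

/-- Reads `(u_k, 1, w_k, v_k)` off a token. -/
def keySel (k : Fin K) : TokIdx d K → Option (TokIdx d K)
  | .inl i => some (idxU k i)
  | .inr (.inl q) => if q = 3 then some (idxFlag 3) else none
  | .inr (.inr (.inl _)) => none
  | .inr (.inr (.inr q)) => if q = 2 then some (idxW k) else if q = 3 then some (idxV k) else none

/-- The weights of the coordinates `x`, `1` and of two memory cells in an attention score. -/
def featDiag (lam a₁ a₂ b : ℝ) : TokIdx d K → ℝ :=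
  Sum.elim (fun _ => a₂) (Sum.elim ![0, 0, 0, b] (Sum.elim 0 ![0, 0, a₁, -lam * a₁]))

/-- The diagonal matrix of the weights `featDiag`. -/
def featMat (lam a₁ a₂ b : ℝ) : Matrix (TokIdx d K) (TokIdx d K) ℝ :=
  Matrix.diagonal (featDiag lam a₁ a₂ b)

lemma sum_featMat_mul (lam a₁ a₂ b : ℝ) (a : TokIdx d K) (x : TokIdx d K → ℝ) :
    ∑ c, featMat lam a₁ a₂ b a c * x c = featDiag lam a₁ a₂ b a * x a := by
  simp [featMat, Matrix.diagonal_apply]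

lemma abs_featMat_le {lam a₁ a₂ b C : ℝ} (hlam : 0 ≤ lam) (h₁ : |a₁| ≤ 1) (h₂ : |a₂| ≤ 1)
    (hb : |b| ≤ C) (x y : TokIdx d K) : |featMat lam a₁ a₂ b x y| ≤ 1 + C + lam := by
  have hC : 0 ≤ C := (abs_nonneg _).trans hb
  have h3 : |-lam * a₁| ≤ lam := by
    rw [abs_mul, abs_neg, abs_of_nonneg hlam]; exact mul_le_of_le_one_right hlam h₁
  have h0 : |(0 : ℝ)| ≤ 1 + C + lam := by rw [abs_zero]; positivity
  by_cases hxy : x = y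
  · subst hxy
    rw [featMat, Matrix.diagonal_apply_eq]
    rcases x with i | q | q | q
    · exact h₂.trans (by linarith)
    · fin_cases q <;> [exact h0; exact h0; exact h0; exact hb.trans (by linarith)]
    · exact h0
    · fin_cases q <;> [exact h0; exact h0; exact h₁.trans (by linarith); exact h3.trans (by linarith)]
  · rw [featMat, Matrix.diagonal_apply_ne _ hxy]
    exact h0

/-- The number `w_k g - λ v_k δ`, where `g` and `δ` are the last two memory cells. -/
def memMix (lam : ℝ) (w v : EuclideanSpace ℝ (Fin K)) (mem : Fin 4 → ℝ) (k : Fin K) : ℝ :=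
  w k * mem 2 - lam * (v k * mem 3)

/-- The attention score of `keySel` and `featMat`. -/
lemma score_eq (lam a₁ a₂ b : ℝ) (S : Data d n n') (u : EuclideanSpace ℝ (Fin K × Fin d))
    (w v : EuclideanSpace ℝ (Fin K)) (mem : ColIdx n n' → Fin 4 → ℝ) (k : Fin K)
    (i j : ColIdx n n') :
    ∑ a, (∑ c, selMat (keySel k) a c * memTokens S (Param.mk u w v) mem c i) *
        ∑ c, featMat lam a₁ a₂ b a c * memTokens S (Param.mk u w v) mem c j =
      a₁ * memMix lam w v (mem j) k + a₂ * preact u k (S.point j) + b := by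
  -- The selection matrix moves `u_k`, `1`, `w_k`, `v_k` of token `i` opposite to `x`, `1` and the
  -- last two memory cells of token `j`. All tokens carry the same parameters, so the score depends
  -- on the data of `j` alone.
  simp only [sum_featMat_mul]
  simp only [fun a => sum_selMat_mul (keySel k) a
    fun c : TokIdx d K => memTokens S (Param.mk u w v) mem c i]
  simp only [Fintype.sum_sum_type, Fin.sum_univ_four, keySel, featDiag, memTokens, Param.mk,
    Matrix.of_apply, Sum.elim_inl, Sum.elim_inr, Option.elim, preact, memMix, Finset.mul_sum]
  simp [flags_three]
  rw [Finset.sum_congr rfl fun x _ => show u (k, x) * (a₂ * S.point j x) =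
    a₂ * (u (k, x) * S.point j x) by ring]
  ring

end Tokens

section Attention

variable {d K n n' : ℕ}

lemma card_colIdx_ne_zero : (Fintype.card (ColIdx n n') : ℝ) ≠ 0 :=
  Nat.cast_ne_zero.2 Fintype.card_ne_zero

lemma sum_smul_selMat_mul {T : Type} [Fintype T] [DecidableEq T] (c : ℝ) (s : T → Option T) (a : T)
    (x : T → ℝ) : ∑ b, (c • selMat s) a b * x b = c * (s a).elim 0 x := by
  rw [← sum_selMat_mul, Finset.mul_sum]
  exact Finset.sum_congr rfl fun b _ => by simp [mul_assoc]

lemma opNorm_smul_selMat_le {T : Type} [Fintype T] [DecidableEq T] (c : ℝ) (s : T → Option T) :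
    opNorm (c • selMat s) ≤ Fintype.card T * |c| := by
  refine opNorm_le_of_abs_le (abs_nonneg c) fun i j => ?_
  rw [Matrix.smul_apply, smul_eq_mul, abs_mul]
  exact mul_le_of_le_one_right (abs_nonneg c) (abs_selMat_le s i j)

/-- Attention with values which move multiples of coordinates. -/
lemma attn_of_selMat {T ι κ Col : Type} [Fintype T] [DecidableEq T] [Fintype ι] [Fintype κ]
    [Fintype Col] {Q K : ι → Matrix T T ℝ} (c : ι → ℝ) (s : ι → T → Option T) (W₁ : Matrix κ T ℝ)
    (W₂ : Matrix T κ ℝ) {X : Matrix T Col ℝ} {score : ι → Col → Col → ℝ}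
    (h : ∀ m j i, ∑ b, (∑ a, Q m b a * X a j) * ∑ a, K m b a * X a i = score m j i)
    (a : T) (i : Col) :
    (Layer.of Q K (fun m => c m • selMat (s m)) W₁ W₂).attn X a i =
      X a i + (Fintype.card Col : ℝ)⁻¹ *
        ∑ m, ∑ j, c m * (s m a).elim 0 (fun b => X b j) * relu (score m j i) := by
  rw [Layer.attn_of, one_div]
  congr 2
  refine Finset.sum_congr rfl fun m _ => Finset.sum_congr rfl fun j _ => ?_
  rw [h, sum_smul_selMat_mul (c m) (s m) a fun b => X b j]

/-! ### The first attention block evaluates both networks -/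

/-- Source coordinates of the values which write `w_k` (`e = 0`) or `v_k` (`e = 1`) to the working
memory. -/
def evalSel (e : Fin 2) (k : Fin K) : TokIdx d K → Option (TokIdx d K)
  | .inr (.inr (.inr q)) =>
    if q = 0 ∧ e = 0 then some (idxW k) else if q = 1 ∧ e = 1 then some (idxV k) else none
  | _ => none

/-- The first layer, with an arbitrary feed-forward block. -/
def evalLayer (d K : ℕ) (s : ReluSum) {κ : Type} [Fintype κ] (W₁ : Matrix κ (TokIdx d K) ℝ)
    (W₂ : Matrix (TokIdx d K) κ ℝ) : Layer (TokIdx d K) :=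
  Layer.of (ι := Fin 2 × Fin K × s.ι) (fun m => selMat (keySel m.2.1))
    (fun m => featMat 0 0 (s.a₂ m.2.2) (s.b m.2.2))
    (fun m => s.c m.2.2 • selMat (evalSel m.1 m.2.1)) W₁ W₂

/-- A network whose activation function is replaced by a combination of ReLUs. -/
def reluNet (s : ReluSum) (u : EuclideanSpace ℝ (Fin K × Fin d)) (a : EuclideanSpace ℝ (Fin K))
    (x : EuclideanSpace ℝ (Fin d)) : ℝ :=
  ∑ k, a k * s.eval 0 (preact u k x)

/-- The queries carry parameters and the keys carry the data of the receiving token. Score and value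
are then the same for every sending token, so the sum over the senders cancels the normalisation and
a pointwise evaluation is left. The weight of the memory in the score is zero, which is why the ReLU
sum is evaluated at first argument 0. -/
lemma evalLayer_attn (s : ReluSum) {κ : Type} [Fintype κ] (W₁ : Matrix κ (TokIdx d K) ℝ)
    (W₂ : Matrix (TokIdx d K) κ ℝ) (S : Data d n n') (u : EuclideanSpace ℝ (Fin K × Fin d))
    (w v : EuclideanSpace ℝ (Fin K)) :
    (evalLayer d K s W₁ W₂).attn (memTokens S (Param.mk u w v) 0) =
      memTokens S (Param.mk u w v) fun i =>
        ![reluNet s u w (S.point i), reluNet s u v (S.point i), 0, 0] := by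
  have hc := card_colIdx_ne_zero (n := n) (n' := n')
  ext a i
  have h := attn_of_selMat (fun m : Fin 2 × Fin K × s.ι => s.c m.2.2)
    (fun m => evalSel m.1 m.2.1) W₁ W₂ (X := memTokens S (Param.mk u w v) 0)
    (fun m j i => score_eq 0 0 (s.a₂ m.2.2) (s.b m.2.2) S u w v 0 m.2.1 j i) a i
  refine h.trans ?_
  have key : ∀ a : EuclideanSpace ℝ (Fin K), (Fintype.card (ColIdx n n') : ℝ)⁻¹ *
      ∑ k, ∑ m, ∑ _j : ColIdx n n',
        s.c m * a k * relu (0 * memMix 0 w v (0 : Fin 4 → ℝ) k +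
          s.a₂ m * preact u k (S.point i) + s.b m) = reluNet s u a (S.point i) := by
    intro a
    simp only [Finset.sum_const, Finset.card_univ, nsmul_eq_mul, ← Finset.mul_sum]
    rw [inv_mul_cancel_left₀ hc]
    simp only [reluNet, ReluSum.eval, Finset.mul_sum, mul_zero, zero_mul]
    exact Finset.sum_congr rfl fun k _ => Finset.sum_congr rfl fun m _ => by ring
  simp only [Fintype.sum_prod_type, Fin.sum_univ_two]
  rcases a with a | a | a | a
  · simp [evalSel, memTokens]
  · simp [evalSel, memTokens]
  · simp [evalSel, memTokens]
  · fin_cases a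
    · simpa [evalSel, memTokens, Param.mk] using key w
    · simpa [evalSel, memTokens, Param.mk] using key v
    · simp [evalSel, memTokens]
    · simp [evalSel, memTokens]

/-! ### The second attention block performs the gradient step -/

/-- Source coordinates of the values which update `w_k` (`e = 0`) or `v_k` (`e = 1`). -/
def outerSel (e : Fin 2) (k : Fin K) : TokIdx d K → Option (TokIdx d K)
  | .inr (.inr (.inl (.inr (.inl k')))) => if e = 0 ∧ k' = k then some (idxMem 2) else none
  | .inr (.inr (.inl (.inr (.inr k')))) => if e = 1 ∧ k' = k then some (idxMem 3) else none
  | _ => none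

/-- Source coordinates of the values which update `u_k`. -/
def innerSel (k : Fin K) : TokIdx d K → Option (TokIdx d K)
  | .inr (.inr (.inl (.inl ki))) => if ki.1 = k then some (idxX ki.2) else none
  | _ => none

/-- The second layer, with an arbitrary feed-forward block. -/
def stepLayer (d K : ℕ) (lam η : ℝ) (s s' : ReluSum) {κ : Type} [Fintype κ]
    (W₁ : Matrix κ (TokIdx d K) ℝ) (W₂ : Matrix (TokIdx d K) κ ℝ) : Layer (TokIdx d K) :=
  Layer.of (ι := (Fin 2 × Fin K × s.ι) ⊕ (Fin K × s'.ι))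
    (Sum.elim (fun m => featMat lam (s.a₁ m.2.2) (s.a₂ m.2.2) (s.b m.2.2))
      fun m => featMat lam (s'.a₁ m.2) (s'.a₂ m.2) (s'.b m.2))
    (Sum.elim (fun m => selMat (keySel m.2.1)) fun m => selMat (keySel m.1))
    (Sum.elim (fun m => (-(η * ![1, lam] m.1 * s.c m.2.2)) • selMat (outerSel m.1 m.2.1))
      fun m => (-(η * s'.c m.2)) • selMat (innerSel m.1)) W₁ W₂

/-- The mean over all tokens of `g_j * φ(p_j, u_k · x_j)`, where `p_j = w_k g_j - λ v_k δ_j`. -/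
def tokenMean (φ : ℝ → ℝ → ℝ) (lam : ℝ) (S : Data d n n') (u : EuclideanSpace ℝ (Fin K × Fin d))
    (w v : EuclideanSpace ℝ (Fin K)) (mem : ColIdx n n' → Fin 4 → ℝ) (g : ColIdx n n' → ℝ)
    (k : Fin K) : ℝ :=
  1 / (Fintype.card (ColIdx n n') : ℝ) *
    ∑ j, g j * φ (memMix lam w v (mem j) k) (preact u k (S.point j))

/-- Compared with the first layer, queries and keys change roles: the score now sees the data of the
sending token and the parameters of the receiving one. Since the parameters are shared, every token
receives the same mean over the senders, and the updated parameters are again shared. The values are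
the points for `u` and the residuals for `w` and `v`; the factors `-η` and `-η λ` sit in the value
matrices. -/
lemma stepLayer_attn (lam η : ℝ) (s s' : ReluSum) {κ : Type} [Fintype κ]
    (W₁ : Matrix κ (TokIdx d K) ℝ) (W₂ : Matrix (TokIdx d K) κ ℝ) (S : Data d n n')
    (u : EuclideanSpace ℝ (Fin K × Fin d)) (w v : EuclideanSpace ℝ (Fin K))
    (mem : ColIdx n n' → Fin 4 → ℝ) :
    (stepLayer d K lam η s s' W₁ W₂).attn (memTokens S (Param.mk u w v) mem) =
      memTokens S (Param.mk
        (WithLp.toLp 2 fun ki =>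
          u ki - η * tokenMean s'.eval lam S u w v mem (fun j => S.point j ki.2) ki.1)
        (WithLp.toLp 2 fun k => w k - η * tokenMean s.eval lam S u w v mem (fun j => mem j 2) k)
        (WithLp.toLp 2 fun k =>
          v k - η * lam * tokenMean s.eval lam S u w v mem (fun j => mem j 3) k)) mem := by
  ext a i
  have hV : (Sum.elim (fun m : Fin 2 × Fin K × s.ι =>
        (-(η * ![1, lam] m.1 * s.c m.2.2)) • selMat (outerSel (d := d) m.1 m.2.1))
      fun m : Fin K × s'.ι => (-(η * s'.c m.2)) • selMat (innerSel m.1)) = fun m =>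
      Sum.elim (fun m : Fin 2 × Fin K × s.ι => -(η * ![1, lam] m.1 * s.c m.2.2))
        (fun m : Fin K × s'.ι => -(η * s'.c m.2)) m •
      selMat (Sum.elim (fun m : Fin 2 × Fin K × s.ι => outerSel m.1 m.2.1)
        (fun m : Fin K × s'.ι => innerSel m.1) m) := by
    ext m; rcases m with m | m <;> rfl
  rw [stepLayer, hV, attn_of_selMat
    (score := fun m j i => Sum.elim
      (fun m : Fin 2 × Fin K × s.ι => s.a₁ m.2.2 * memMix lam w v (mem j) m.2.1 +
        s.a₂ m.2.2 * preact u m.2.1 (S.point j) + s.b m.2.2)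
      (fun m : Fin K × s'.ι => s'.a₁ m.2 * memMix lam w v (mem j) m.1 +
        s'.a₂ m.2 * preact u m.1 (S.point j) + s'.b m.2) m)]
  swap
  · rintro (m | m) j i
    · refine Eq.trans (Finset.sum_congr rfl fun b _ => mul_comm _ _)
        (score_eq lam (s.a₁ m.2.2) (s.a₂ m.2.2) (s.b m.2.2) S u w v mem m.2.1 i j)
    · refine Eq.trans (Finset.sum_congr rfl fun b _ => mul_comm _ _)
        (score_eq lam (s'.a₁ m.2) (s'.a₂ m.2) (s'.b m.2) S u w v mem m.1 i j)
  have key : ∀ (σ : ReluSum) (e : ℝ) (g : ColIdx n n' → ℝ) (k : Fin K),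
      (Fintype.card (ColIdx n n') : ℝ)⁻¹ * ∑ m, ∑ j, -(e * σ.c m) * g j *
        relu (σ.a₁ m * memMix lam w v (mem j) k + σ.a₂ m * preact u k (S.point j) + σ.b m) =
      -(e * tokenMean σ.eval lam S u w v mem g k) := by
    intro σ e g k
    rw [Finset.sum_comm]
    simp only [tokenMean, ReluSum.eval, Finset.mul_sum, ← Finset.sum_neg_distrib, one_div]
    exact Finset.sum_congr rfl fun k _ => Finset.sum_congr rfl fun m _ => by ring
  simp only [Fintype.sum_sum_type (α₁ := Fin 2 × Fin K × s.ι), Fintype.sum_prod_type, Fin.sum_univ_two, Sum.elim_inl,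
    Sum.elim_inr]
  have hel : ∀ (P : Prop) [Decidable P] (t : TokIdx d K) (x : TokIdx d K → ℝ),
      (if P then some t else none).elim 0 x = if P then x t else 0 := by
    intro P _ t x; split_ifs <;> rfl
  rcases a with a | a | (⟨k, i⟩ | k | k) | a
  · simp [outerSel, innerSel, memTokens]
  · simp [outerSel, innerSel, memTokens]
  · have := key s' η (fun j => S.point j i) k
    simp only [memTokens, Param.mk, Matrix.of_apply, Sum.elim_inl, Sum.elim_inr, sub_eq_add_neg,
      ← this]
    simp [outerSel, innerSel, hel, Finset.sum_ite_irrel, -Fintype.sum_sum_type]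
  · have := key s η (fun j => mem j 2) k
    simp only [memTokens, Param.mk, Matrix.of_apply, Sum.elim_inl, Sum.elim_inr, sub_eq_add_neg,
      ← this]
    simp [outerSel, innerSel, hel, Finset.sum_ite_irrel, -Fintype.sum_sum_type]
  · have := key s (η * lam) (fun j => mem j 3) k
    simp only [memTokens, Param.mk, Matrix.of_apply, Sum.elim_inl, Sum.elim_inr, sub_eq_add_neg,
      ← this]
    simp [outerSel, innerSel, hel, Finset.sum_ite_irrel, -Fintype.sum_sum_type]
  · simp [outerSel, innerSel, memTokens]

end Attention

section FeedForward

variable {d K n n' : ℕ}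

/-! ### The first feed-forward block computes the residuals -/

/-- The derivatives of the label losses, scaled by `κ₁`, for network outputs `z`; `φ` stands for
the sigmoid. -/
def Data.labelResidual (S : Data d n n') (φ : ℝ → ℝ) (κ₁ : ℝ) (z : ColIdx n n' → ℝ) :
    ColIdx n n' → ℝ :=
  Sum.elim (fun i => κ₁ * (φ (z (.inl i)) - S.y i)) 0

/-- The derivatives of the domain losses, scaled by `κ₂` and `κ₃`, for network outputs `z`; `φ`
stands for the sigmoid. -/
def domainResidual (φ : ℝ → ℝ) (κ₂ κ₃ : ℝ) (z : ColIdx n n' → ℝ) : ColIdx n n' → ℝ :=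
  Sum.elim (fun i => κ₂ * φ (z (.inl i)))
    (Sum.elim (fun i => κ₃ * (φ (z (.inr (.inl i))) - 1)) 0)

/-- A vector of token coordinates supported on the flags and the working memory. -/
def flagMem (f m : Fin 4 → ℝ) : TokIdx d K → ℝ := Sum.elim 0 (Sum.elim f (Sum.elim 0 m))

lemma sum_flagMem_mul (f m : Fin 4 → ℝ) (S : Data d n n') (θ : Param d K)
    (mem : ColIdx n n' → Fin 4 → ℝ) (i : ColIdx n n') :
    ∑ b, flagMem f m b * memTokens S θ mem b i =
      ∑ q, f q * S.flags i q + ∑ q, m q * mem i q := by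
  simp only [flagMem, memTokens, Matrix.of_apply, Fintype.sum_sum_type (α₁ := Fin d),
    Fintype.sum_sum_type (α₁ := Fin 4), Fintype.sum_sum_type (α₁ := ParamIdx d K), Sum.elim_inl,
    Sum.elim_inr, Pi.zero_apply, zero_mul, Finset.sum_const_zero, zero_add]

lemma abs_flagMem_le {f m : Fin 4 → ℝ} {B : ℝ} (hB : 0 ≤ B) (hf : ∀ q, |f q| ≤ B)
    (hm : ∀ q, |m q| ≤ B) (a : TokIdx d K) : |flagMem f m a| ≤ B := by
  rcases a with a | a | a | a <;> simp [flagMem, hB, hf, hm]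

/-- Output weights of the hidden units which compute the residuals. -/
def residCoef (κ₁ κ₂ κ₃ : ℝ) (q : ReluSum) : (Fin 3 × q.ι) ⊕ Fin 3 → ℝ :=
  Sum.elim (fun m => ![κ₁, κ₂, κ₃] m.1 * q.c m.2) ![-κ₁, κ₁, -κ₃]

/-- Input weights of the hidden units which compute the residuals; `B` is the size of the
masks. -/
def residRow (B : ℝ) (q : ReluSum) : (Fin 3 × q.ι) ⊕ Fin 3 → TokIdx d K → ℝ :=
  Sum.elim
    (fun m => flagMem
      (![![0, B, 0, q.b m.2 - B], ![0, B, 0, q.b m.2 - B], ![0, -B, B, q.b m.2 - B]] m.1)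
      (![![q.a₂ m.2, 0, 0, 0], ![0, q.a₂ m.2, 0, 0], ![0, q.a₂ m.2, 0, 0]] m.1))
    (fun e => flagMem (![![1, 0, 0, 0], ![-1, 0, 0, 0], ![0, -1, 1, 0]] e) 0)

/-- Memory cells written by the hidden units which compute the residuals. -/
def residOut (q : ReluSum) : (Fin 3 × q.ι) ⊕ Fin 3 → TokIdx d K → ℝ :=
  Sum.elim (fun m => flagMem 0 (![![0, 0, 1, 0], ![0, 0, 0, 1], ![0, 0, 0, 1]] m.1))
    (fun e => flagMem 0 (![![0, 0, 1, 0], ![0, 0, 1, 0], ![0, 0, 0, 1]] e))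

lemma relu_sub_relu_neg (t : ℝ) : relu t - relu (-t) = t := by
  rcases le_total 0 t with h | h
  · rw [relu_of_nonneg h, relu_of_nonpos (by linarith)]; ring
  · rw [relu_of_nonpos h, relu_of_nonneg (by linarith)]; ring

variable {ι κ : Type} [Fintype ι] [Fintype κ]

/-- Masking: `B` dominates every ReLU argument, so adding `B * (t - 1)` leaves it unchanged on
source tokens and makes it nonpositive elsewhere; adding `B * (s - t - 1)` does the same for target
tokens. The three remaining units supply what is not a sigmoid: `y` as the difference of `relu y`
and `relu (-y)`, which vanishes off the source points, and the label 1 of target points as `relu (s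
- t)`. -/
lemma mlp_residual (Q Km V : ι → Matrix (TokIdx d K) (TokIdx d K) ℝ) {κ₁ κ₂ κ₃ B : ℝ} (q : ReluSum)
    (S : Data d n n') (θ : Param d K) (z₀ z₁ : ColIdx n n' → ℝ)
    (h₀ : ∀ m i, |q.a₂ m * z₀ i + q.b m| ≤ B) (h₁ : ∀ m i, |q.a₂ m * z₁ i + q.b m| ≤ B) :
    (Layer.of Q Km V (balancedIn (residCoef κ₁ κ₂ κ₃ q) (residRow B q))
      (balancedOut (residCoef κ₁ κ₂ κ₃ q) (residOut q))).mlp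
        (memTokens S θ fun i => ![z₀ i, z₁ i, 0, 0]) =
      memTokens S θ fun i => ![z₀ i, z₁ i, S.labelResidual (q.eval 0) κ₁ z₀ i,
        domainResidual (q.eval 0) κ₂ κ₃ z₁ i] := by
  have e1 : ∀ m i, relu (q.b m + q.a₂ m * z₀ i) = relu (q.a₂ m * z₀ i + q.b m) :=
    fun m i => by rw [add_comm]
  have e2 : ∀ m i, relu (q.b m + q.a₂ m * z₁ i) = relu (q.a₂ m * z₁ i + q.b m) :=
    fun m i => by rw [add_comm]
  have e3 : ∀ m i, relu (q.b m - B + q.a₂ m * z₀ i) = 0 :=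
    fun m i => relu_of_nonpos (by linarith [(abs_le.1 (h₀ m i)).2])
  have e4 : ∀ m i, relu (q.b m - B + q.a₂ m * z₁ i) = 0 :=
    fun m i => relu_of_nonpos (by linarith [(abs_le.1 (h₁ m i)).2])
  have r0 : relu 0 = 0 := relu_of_nonneg le_rfl
  have r1 : relu 1 = 1 := relu_of_nonneg zero_le_one
  ext a i
  rw [Layer.mlp_of, balanced_apply _ _ _ fun b => memTokens S θ _ b i]
  simp only [Fintype.sum_sum_type (α₁ := Fin 3 × q.ι), Fintype.sum_prod_type, Fin.sum_univ_three,
    residCoef, residRow, residOut, Sum.elim_inl, Sum.elim_inr, sum_flagMem_mul, Fin.sum_univ_four]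
  rcases a with a | a | a | a
  · simp [flagMem, memTokens]
  · simp [flagMem, memTokens]
  · simp [flagMem, memTokens]
  · fin_cases a
    · simp [flagMem, memTokens]
    · simp [flagMem, memTokens]
    · rcases i with i | i | i
      · have := relu_sub_relu_neg (S.y i)
        simp [flagMem, memTokens, Data.flags, Data.labelResidual, e1, ReluSum.eval, mul_assoc,
          ← Finset.mul_sum]
        linear_combination -κ₁ * this
      · simp [flagMem, memTokens, Data.flags, Data.labelResidual, e3, r0]
      · simp [flagMem, memTokens, Data.flags, Data.labelResidual, e3, r0]
    · rcases i with i | i | i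
      · simp [flagMem, memTokens, Data.flags, domainResidual, e2, e4, r0, ReluSum.eval, mul_assoc,
          ← Finset.mul_sum]
      · simp [flagMem, memTokens, Data.flags, domainResidual, e2, e4, r1, ReluSum.eval, mul_assoc,
          ← Finset.mul_sum]
        ring
      · simp [flagMem, memTokens, Data.flags, domainResidual, e4, r0]

/-! ### The second feed-forward block projects and clears the memory -/

/-- Input weights which read the parameters and the constant coordinate of a token. -/
def paramRead {D : ℕ} (A : Matrix (Fin D) (Unit ⊕ ParamIdx d K) ℝ) :
    Matrix (Fin D) (TokIdx d K) ℝ :=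
  Matrix.of fun h => Sum.elim 0 (Sum.elim ![0, 0, 0, A h (.inl ())]
    (Sum.elim (fun q => A h (.inr q)) 0))

/-- Output weights which write the parameters of a token. -/
def paramWrite {D : ℕ} (A : Matrix (ParamIdx d K) (Fin D) ℝ) : Matrix (TokIdx d K) (Fin D) ℝ :=
  Matrix.of fun a h => Sum.elim 0 (Sum.elim 0 (Sum.elim (fun q => A q h) 0)) a

/-- Input weights `± 1` on each memory cell. -/
def clearRead : Matrix (Fin 4 × Fin 2) (TokIdx d K) ℝ :=
  Matrix.of fun h => flagMem 0 (Pi.single h.1 (![1, -1] h.2))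

/-- Output weights `∓ 1` on each memory cell. -/
def clearWrite : Matrix (TokIdx d K) (Fin 4 × Fin 2) ℝ :=
  Matrix.of fun a h => flagMem 0 (Pi.single h.1 (![-1, 1] h.2)) a

lemma sum_paramRead_mul {D : ℕ} (A : Matrix (Fin D) (Unit ⊕ ParamIdx d K) ℝ) (S : Data d n n')
    (θ : Param d K) (mem : ColIdx n n' → Fin 4 → ℝ) (h : Fin D) (i : ColIdx n n') :
    ∑ b, paramRead A h b * memTokens S θ mem b i = (A *ᵥ Sum.elim (fun _ => 1) θ) h := by
  simp only [paramRead, memTokens, Matrix.of_apply, Fintype.sum_sum_type (α₁ := Fin d),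
    Fintype.sum_sum_type (α₁ := Fin 4), Fintype.sum_sum_type (α₁ := ParamIdx d K), Sum.elim_inl,
    Sum.elim_inr, Pi.zero_apply, zero_mul, Finset.sum_const_zero, zero_add, Fin.sum_univ_four,
    Matrix.mulVec, dotProduct, Fintype.sum_sum_type (α₁ := Unit)]
  simp [flags_three]

lemma mlp_project (Q Km V : ι → Matrix (TokIdx d K) (TokIdx d K) ℝ) {P : Param d K → Param d K}
    {D : ℕ} {A₁ : Matrix (Fin D) (Unit ⊕ ParamIdx d K) ℝ} {A₂ : Matrix (ParamIdx d K) (Fin D) ℝ}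
    (hP : ∀ θ i, P θ i = θ i + (A₂ *ᵥ fun h => relu ((A₁ *ᵥ Sum.elim (fun _ => 1) θ) h)) i)
    (S : Data d n n') (θ : Param d K) (mem : ColIdx n n' → Fin 4 → ℝ) :
    (Layer.of Q Km V (paramRead A₁) (paramWrite A₂)).mlp (memTokens S θ mem) =
      memTokens S (P θ) mem := by
  ext a i
  rw [Layer.mlp_of]
  simp only [sum_paramRead_mul]
  rcases a with a | a | a | a
  · simp [paramWrite, memTokens]
  · simp [paramWrite, memTokens]
  · simp [paramWrite, memTokens, hP, Matrix.mulVec, dotProduct]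
  · simp [paramWrite, memTokens]

/-- The two families of hidden units act on disjoint sets of coordinates. Each memory cell is
subtracted from itself through `relu t - relu (-t) = t`, so the tokens regain their original form
and the pair of layers can be repeated. -/
lemma mlp_project_clear (Q Km V : ι → Matrix (TokIdx d K) (TokIdx d K) ℝ)
    {P : Param d K → Param d K}
    {D : ℕ} {A₁ : Matrix (Fin D) (Unit ⊕ ParamIdx d K) ℝ} {A₂ : Matrix (ParamIdx d K) (Fin D) ℝ}
    (hP : ∀ θ i, P θ i = θ i + (A₂ *ᵥ fun h => relu ((A₁ *ᵥ Sum.elim (fun _ => 1) θ) h)) i)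
    (S : Data d n n') (θ : Param d K) (mem : ColIdx n n' → Fin 4 → ℝ) :
    (Layer.of Q Km V (Matrix.fromRows (paramRead A₁) clearRead)
      (Matrix.fromCols (paramWrite A₂) clearWrite)).mlp (memTokens S θ mem) =
      memTokens S (P θ) 0 := by
  have h1 := mlp_project Q Km V hP S θ mem
  ext a i
  have h2 := congrFun (congrFun h1 a) i
  rw [Layer.mlp_of] at h2 ⊢
  rw [Fintype.sum_sum_type, ← add_assoc]
  simp only [Matrix.fromRows_apply_inl, Matrix.fromRows_apply_inr, Matrix.fromCols_apply_inl,
    Matrix.fromCols_apply_inr]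
  rw [h2]
  simp only [clearRead, clearWrite, Matrix.of_apply, sum_flagMem_mul]
  rcases a with a | a | a | a
  · simp [flagMem, memTokens]
  · simp [flagMem, memTokens]
  · simp [flagMem, memTokens]
  · have := relu_sub_relu_neg (mem i a)
    simp only [Fintype.sum_prod_type, Fin.sum_univ_two, flagMem, memTokens, Matrix.of_apply,
      Sum.elim_inr, Pi.zero_apply, zero_mul, Finset.sum_const_zero, zero_add, Pi.single_apply]
    simp
    simp [Finset.sum_add_distrib]
    linarith

/-! ### Norms of the feed-forward matrices -/

lemma opNorm_fromRows_le {m₁ m₂ k : Type} [Fintype m₁] [Fintype m₂] [Fintype k] [DecidableEq k]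
    (A : Matrix m₁ k ℝ) (B : Matrix m₂ k ℝ) :
    opNorm (Matrix.fromRows A B) ≤ opNorm A + opNorm B := by
  have hA := opNorm_nonneg A
  have hB := opNorm_nonneg B
  refine opNorm_le (add_nonneg hA hB) fun x => ?_
  refine le_of_sq_le_sq ?_ (by positivity)
  have h1 := pow_le_pow_left₀ (norm_nonneg _) (norm_mulVec_le_opNorm A x) 2
  have h2 := pow_le_pow_left₀ (norm_nonneg _) (norm_mulVec_le_opNorm B x) 2
  rw [EuclideanSpace.real_norm_sq_eq] at h1 h2 ⊢
  rw [Fintype.sum_sum_type]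
  simp only [Matrix.fromRows_mulVec, Sum.elim_inl, Sum.elim_inr]
  nlinarith [mul_nonneg (mul_nonneg hA hB) (sq_nonneg ‖x‖)]

lemma opNorm_fromCols_le {m k₁ k₂ : Type} [Fintype m] [Fintype k₁] [Fintype k₂] [DecidableEq k₁]
    [DecidableEq k₂] (A : Matrix m k₁ ℝ) (B : Matrix m k₂ ℝ) :
    opNorm (Matrix.fromCols A B) ≤ opNorm A + opNorm B := by
  have hA := opNorm_nonneg A
  have hB := opNorm_nonneg B
  refine opNorm_le (add_nonneg hA hB) fun x => ?_
  set x₁ : EuclideanSpace ℝ k₁ := WithLp.toLp 2 (x ∘ Sum.inl)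
  set x₂ : EuclideanSpace ℝ k₂ := WithLp.toLp 2 (x ∘ Sum.inr)
  have hx : ‖x‖ ^ 2 = ‖x₁‖ ^ 2 + ‖x₂‖ ^ 2 := by
    simp only [EuclideanSpace.real_norm_sq_eq, Fintype.sum_sum_type]
    rfl
  have h1 : ‖x₁‖ ≤ ‖x‖ := le_of_sq_le_sq (by nlinarith [sq_nonneg ‖x₂‖]) (norm_nonneg _)
  have h2 : ‖x₂‖ ≤ ‖x‖ := le_of_sq_le_sq (by nlinarith [sq_nonneg ‖x₁‖]) (norm_nonneg _)
  have e : (WithLp.toLp 2 (Matrix.fromCols A B *ᵥ x) : EuclideanSpace ℝ m) =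
      WithLp.toLp 2 (A *ᵥ x₁) + WithLp.toLp 2 (B *ᵥ x₂) := by
    rw [Matrix.fromCols_mulVec]; rfl
  rw [e, add_mul]
  refine (norm_add_le _ _).trans (add_le_add ?_ ?_)
  · exact (norm_mulVec_le_opNorm A x₁).trans (by gcongr)
  · exact (norm_mulVec_le_opNorm B x₂).trans (by gcongr)

lemma opNorm_paramRead_le {D : ℕ} (A : Matrix (Fin D) (Unit ⊕ ParamIdx d K) ℝ) :
    opNorm (paramRead A) ≤ opNorm A := by
  refine opNorm_le (opNorm_nonneg A) fun x => ?_
  set y : EuclideanSpace ℝ (Unit ⊕ ParamIdx d K) :=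
    WithLp.toLp 2 (Sum.elim (fun _ => x (idxFlag 3)) fun q => x (.inr (.inr (.inl q))))
  have e : paramRead A *ᵥ x = A *ᵥ y := by
    ext h
    simp only [paramRead, Matrix.mulVec, dotProduct, Matrix.of_apply,
      Fintype.sum_sum_type (α₁ := Fin d),
      Fintype.sum_sum_type (α₁ := Fin 4), Fintype.sum_sum_type (α₁ := ParamIdx d K), Sum.elim_inl,
      Sum.elim_inr, Pi.zero_apply, zero_mul, Finset.sum_const_zero, zero_add, Fin.sum_univ_four,
      Fintype.sum_sum_type (α₁ := Unit), y]
    simp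
  rw [e]
  refine (norm_mulVec_le_opNorm A y).trans (mul_le_mul_of_nonneg_left ?_ (opNorm_nonneg A))
  refine le_of_sq_le_sq ?_ (norm_nonneg _)
  simp only [EuclideanSpace.real_norm_sq_eq, y, Fintype.sum_sum_type (α₁ := Unit),
    Fintype.sum_sum_type (α₁ := Fin d), Fintype.sum_sum_type (α₁ := Fin 4),
    Fintype.sum_sum_type (α₁ := ParamIdx d K), Sum.elim_inl, Sum.elim_inr, Fin.sum_univ_four,
    Finset.univ_unique, Finset.sum_singleton]
  have h1 : 0 ≤ ∑ i : Fin d, x (.inl i) ^ 2 := Finset.sum_nonneg fun _ _ => sq_nonneg _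
  nlinarith [sq_nonneg (x (idxFlag 0)), sq_nonneg (x (idxFlag 1)), sq_nonneg (x (idxFlag 2)),
    sq_nonneg (x (idxMem 0)), sq_nonneg (x (idxMem 1)), sq_nonneg (x (idxMem 2)),
    sq_nonneg (x (idxMem 3))]

lemma opNorm_paramWrite_le {D : ℕ} (A : Matrix (ParamIdx d K) (Fin D) ℝ) :
    opNorm (paramWrite A) ≤ opNorm A := by
  refine opNorm_le (opNorm_nonneg A) fun x => ?_
  refine le_trans (le_of_sq_le_sq ?_ (norm_nonneg _)) (norm_mulVec_le_opNorm A x)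
  simp only [EuclideanSpace.real_norm_sq_eq, paramWrite, Matrix.mulVec, dotProduct,
    Matrix.of_apply, Fintype.sum_sum_type (α₁ := Fin d), Fintype.sum_sum_type (α₁ := Fin 4),
    Fintype.sum_sum_type (α₁ := ParamIdx d K), Sum.elim_inl, Sum.elim_inr, Pi.zero_apply, zero_mul,
    Finset.sum_const_zero]
  simp

lemma opNorm_clearRead_le : opNorm (clearRead (d := d) (K := K)) ≤ 3 := by
  refine opNorm_le_of_sum_sq_le (by norm_num) ?_
  simp [clearRead, flagMem, Fintype.sum_prod_type, Pi.single_apply]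
  norm_num

lemma opNorm_clearWrite_le : opNorm (clearWrite (d := d) (K := K)) ≤ 3 := by
  refine opNorm_le_of_sum_sq_le (by norm_num) ?_
  simp [clearWrite, flagMem, Fintype.sum_prod_type, Fin.sum_univ_four, Pi.single_apply]
  norm_num

end FeedForward

section Error

variable {d K n n' : ℕ}

/-! ### Gradients as means over the tokens -/

/-- Network outputs and residuals of all tokens. -/
def exactMem (r : ℝ → ℝ) (κ₁ κ₂ κ₃ : ℝ) (S : Data d n n') (u : EuclideanSpace ℝ (Fin K × Fin d))
    (w v : EuclideanSpace ℝ (Fin K)) : ColIdx n n' → Fin 4 → ℝ := fun i =>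
  ![net r u w (S.point i), net r u v (S.point i),
    S.labelResidual Real.sigmoid κ₁ (fun i => net r u w (S.point i)) i,
    domainResidual Real.sigmoid κ₂ κ₃ (fun i => net r u v (S.point i)) i]

/-- Approximate network outputs and residuals of all tokens. -/
def approxMem (s q : ReluSum) (κ₁ κ₂ κ₃ : ℝ) (S : Data d n n')
    (u : EuclideanSpace ℝ (Fin K × Fin d)) (w v : EuclideanSpace ℝ (Fin K)) :
    ColIdx n n' → Fin 4 → ℝ := fun i =>
  ![reluNet s u w (S.point i), reluNet s u v (S.point i),
    S.labelResidual (q.eval 0) κ₁ (fun i => reluNet s u w (S.point i)) i,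
    domainResidual (q.eval 0) κ₂ κ₃ (fun i => reluNet s u v (S.point i)) i]

variable {r : ℝ → ℝ} (c lam : ℝ) (S : Data d n n') (u : EuclideanSpace ℝ (Fin K × Fin d))
  (w v : EuclideanSpace ℝ (Fin K))

/-- Attention divides by the number of all tokens, so the residuals are scaled by that number times
the normalisation of the loss. Tokens which do not enter the loss have residual 0, so a mean over
all tokens becomes the required sum over the source points. -/
lemma gradient_labelLoss_outer_apply (κ₂ κ₃ : ℝ) (k : Fin K) :
    gradient (fun w' => labelLoss r c S u w') w k =
      tokenMean (fun _ t => r t) lam S u w v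
        (exactMem r (Fintype.card (ColIdx n n') * c) κ₂ κ₃ S u w v)
        (fun j => exactMem r (Fintype.card (ColIdx n n') * c) κ₂ κ₃ S u w v j 2) k := by
  have hc := card_colIdx_ne_zero (n := n) (n' := n')
  rw [gradient_labelLoss_outer]
  simp only [tokenMean, exactMem, Fintype.sum_sum_type (α₁ := Fin n),
    Fintype.sum_sum_type (α₁ := Fin n'), Data.labelResidual, Sum.elim_inl, Sum.elim_inr,
    Matrix.cons_val, Pi.zero_apply, zero_mul, Finset.sum_const_zero, add_zero]
  simp only [PiLp.smul_apply, WithLp.ofLp_sum, Finset.sum_apply, smul_eq_mul, Finset.mul_sum,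
    netGradA, Data.point, Sum.elim_inl]
  refine Finset.sum_congr rfl fun i _ => ?_
  field_simp

lemma gradient_domainLoss_outer_apply (κ₁ : ℝ) (k : Fin K) :
    gradient (fun v' => domainLoss r S u v') v k =
      tokenMean (fun _ t => r t) lam S u w v
        (exactMem r κ₁ (Fintype.card (ColIdx n n') / n) (Fintype.card (ColIdx n n') / n') S u w v)
        (fun j => exactMem r κ₁ (Fintype.card (ColIdx n n') / n)
          (Fintype.card (ColIdx n n') / n') S u w v j 3) k := by
  have hc := card_colIdx_ne_zero (n := n) (n' := n')
  rw [gradient_domainLoss_outer]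
  simp only [tokenMean, exactMem, Fintype.sum_sum_type (α₁ := Fin n),
    Fintype.sum_sum_type (α₁ := Fin n'), domainResidual, Sum.elim_inl, Sum.elim_inr,
    Matrix.cons_val, Pi.zero_apply, zero_mul, Finset.sum_const_zero, add_zero]
  simp only [PiLp.add_apply, PiLp.smul_apply, WithLp.ofLp_sum, Finset.sum_apply, smul_eq_mul,
    Finset.mul_sum, netGradA, Data.point, Sum.elim_inl, Sum.elim_inr, mul_add]
  refine congrArg₂ (· + ·) (Finset.sum_congr rfl fun i _ => ?_)
    (Finset.sum_congr rfl fun i _ => ?_) <;> field_simp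
  ring

/-- Both losses contribute multiples of `x_j * r'(u_k · x_j)`, with factors `w_k g_j` and `-λ v_k
δ_j`. Their sum is the single number `memMix`, so one group of heads serves both losses and only `p
* r'(t)` has to be approximated. -/
lemma gradient_loss_inner_apply (hr : Differentiable ℝ r) (ki : Fin K × Fin d) :
    gradient (fun u' => labelLoss r c S u' w - lam * domainLoss r S u' v) u ki =
      tokenMean (fun p t => p * deriv r t) lam S u w v
        (exactMem r (Fintype.card (ColIdx n n') * c) (Fintype.card (ColIdx n n') / n)
          (Fintype.card (ColIdx n n') / n') S u w v) (fun j => S.point j ki.2) ki.1 := by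
  have hc := card_colIdx_ne_zero (n := n) (n' := n')
  rw [gradient_loss_inner hr]
  simp only [tokenMean, memMix, exactMem, Fintype.sum_sum_type (α₁ := Fin n),
    Fintype.sum_sum_type (α₁ := Fin n'), Data.labelResidual, domainResidual, Sum.elim_inl,
    Sum.elim_inr, Matrix.cons_val, Pi.zero_apply, zero_mul, mul_zero, sub_self,
    Finset.sum_const_zero, add_zero]
  simp only [PiLp.add_apply, PiLp.smul_apply, WithLp.ofLp_sum, Finset.sum_apply, smul_eq_mul,
    Finset.mul_sum, netGradU, Data.point, Sum.elim_inl, Sum.elim_inr, mul_add]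
  rw [← add_assoc, ← Finset.sum_add_distrib]
  refine congrArg₂ (· + ·) (Finset.sum_congr rfl fun i _ => ?_)
    (Finset.sum_congr rfl fun i _ => ?_) <;> field_simp <;> ring

/-! ### Error bounds -/

variable {lam S u w v}

lemma abs_tokenMean_sub_le {φ ψ : ℝ → ℝ → ℝ} {mem mem' : ColIdx n n' → Fin 4 → ℝ}
    {g g' : ColIdx n n' → ℝ} {k : Fin K} {E : ℝ}
    (h : ∀ j, |g j * φ (memMix lam w v (mem j) k) (preact u k (S.point j)) -
      g' j * ψ (memMix lam w v (mem' j) k) (preact u k (S.point j))| ≤ E) :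
    |tokenMean φ lam S u w v mem g k - tokenMean ψ lam S u w v mem' g' k| ≤ E := by
  have hc := card_colIdx_ne_zero (n := n) (n' := n')
  have hc' : (0 : ℝ) < Fintype.card (ColIdx n n') := lt_of_le_of_ne (Nat.cast_nonneg _) hc.symm
  rw [tokenMean, tokenMean, ← mul_sub, ← Finset.sum_sub_distrib, abs_mul, one_div,
    abs_of_pos (inv_pos.2 hc'), inv_mul_le_iff₀ hc']
  refine (Finset.abs_sum_le_sum_abs _ _).trans ((Finset.sum_le_sum fun j _ => h j).trans ?_)
  simp

lemma abs_sigmoid_sub_le (a b : ℝ) : |Real.sigmoid a - Real.sigmoid b| ≤ |a - b| := by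
  have := Convex.norm_image_sub_le_of_norm_hasDerivWithin_le (s := Set.univ) (C := 1)
    (f := Real.sigmoid) (f' := fun x => Real.sigmoid x * (1 - Real.sigmoid x)) (x := b) (y := a)
    (fun x _ => (Real.hasDerivAt_sigmoid x).hasDerivWithinAt) (fun x _ => by
      have h0 := Real.sigmoid_pos x
      have h1 := Real.sigmoid_lt_one x
      rw [Real.norm_of_nonneg (mul_nonneg h0.le (by linarith))]
      nlinarith) convex_univ (Set.mem_univ _) (Set.mem_univ _)
  simpa using this

lemma abs_apply_le_norm {ι : Type} [Fintype ι] (x : EuclideanSpace ℝ ι) (i : ι) : |x i| ≤ ‖x‖ :=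
  PiLp.norm_apply_le x i

lemma norm_le_card_mul {ι : Type} [Fintype ι] {x : EuclideanSpace ℝ ι} {B : ℝ} (hB : 0 ≤ B)
    (h : ∀ i, |x i| ≤ B) : ‖x‖ ≤ Fintype.card ι * B := by
  refine le_of_sq_le_sq ?_ (by positivity)
  rw [EuclideanSpace.real_norm_sq_eq]
  calc ∑ i, x i ^ 2 ≤ ∑ _i : ι, B ^ 2 := Finset.sum_le_sum fun i _ => by
        rw [← sq_abs]; gcongr; exact h i
    _ = Fintype.card ι * B ^ 2 := by simp
    _ ≤ (Fintype.card ι : ℝ) ^ 2 * B ^ 2 := by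
        gcongr
        exact_mod_cast Nat.le_self_pow two_ne_zero _
    _ = _ := by ring

lemma abs_preact_le {Bu Bx : ℝ} (hBu : 0 ≤ Bu) {k : Fin K} {x : EuclideanSpace ℝ (Fin d)}
    (hu : ‖(WithLp.toLp 2 (fun i => u (k, i)) : EuclideanSpace ℝ (Fin d))‖ ≤ Bu) (hx : ‖x‖ ≤ Bx) :
    |preact u k x| ≤ Bu * Bx := by
  have e : preact u k x =
      inner ℝ (WithLp.toLp 2 (fun i => u (k, i)) : EuclideanSpace ℝ (Fin d)) x := by
    simp [preact, PiLp.inner_apply, mul_comm]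
  rw [e]
  exact (abs_real_inner_le_norm _ _).trans (mul_le_mul hu hx (norm_nonneg _) hBu)

lemma abs_sum_mul_le {a : EuclideanSpace ℝ (Fin K)} {f : Fin K → ℝ} {B E : ℝ} (ha : ‖a‖ ≤ B)
    (hf : ∀ k, |f k| ≤ E) : |∑ k, a k * f k| ≤ K * (B * E) := by
  refine (Finset.abs_sum_le_sum_abs _ _).trans ?_
  calc ∑ k, |a k * f k| ≤ ∑ _k : Fin K, B * E := Finset.sum_le_sum fun k _ => by
        rw [abs_mul]
        exact mul_le_mul ((abs_apply_le_norm a k).trans ha) (hf k) (abs_nonneg _)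
          ((norm_nonneg a).trans ha)
    _ = _ := by simp

lemma abs_memMix_le {B G : ℝ} (hlam : 0 ≤ lam) (hw : ‖w‖ ≤ B) (hv : ‖v‖ ≤ B) {mem : Fin 4 → ℝ}
    (h2 : |mem 2| ≤ G) (h3 : |mem 3| ≤ G) (k : Fin K) :
    |memMix lam w v mem k| ≤ (1 + lam) * (B * G) := by
  have hB : 0 ≤ B := (norm_nonneg w).trans hw
  have e1 : |w k * mem 2| ≤ B * G := by
    rw [abs_mul]; exact mul_le_mul ((abs_apply_le_norm w k).trans hw) h2 (abs_nonneg _) hB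
  have e2 : |v k * mem 3| ≤ B * G := by
    rw [abs_mul]; exact mul_le_mul ((abs_apply_le_norm v k).trans hv) h3 (abs_nonneg _) hB
  calc _ ≤ |w k * mem 2| + |lam * (v k * mem 3)| := abs_sub _ _
    _ ≤ B * G + lam * (B * G) := by
        rw [abs_mul lam, abs_of_nonneg hlam]
        gcongr
    _ = _ := by ring

lemma memMix_sub (mem mem' : Fin 4 → ℝ) (k : Fin K) :
    memMix lam w v mem k - memMix lam w v mem' k = memMix lam w v (mem - mem') k := by
  simp only [memMix, Pi.sub_apply]; ring

lemma abs_labelResidual_sub_le {φ ψ : ℝ → ℝ} {κ ρ E : ℝ} {z z' : ColIdx n n' → ℝ} (hκ : 0 ≤ κ)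
    (hρ : κ ≤ ρ) (hE : 0 ≤ E) (h : ∀ i, |φ (z i) - ψ (z' i)| ≤ E) (i : ColIdx n n') :
    |S.labelResidual φ κ z i - S.labelResidual ψ κ z' i| ≤ ρ * E := by
  have hρE : 0 ≤ ρ * E := mul_nonneg (hκ.trans hρ) hE
  rcases i with i | i
  · simp only [Data.labelResidual, Sum.elim_inl, ← mul_sub, sub_sub_sub_cancel_right]
    rw [abs_mul, abs_of_nonneg hκ]
    exact mul_le_mul hρ (h _) (abs_nonneg _) (hκ.trans hρ)
  · simpa [Data.labelResidual] using hρE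

lemma abs_domainResidual_sub_le {φ ψ : ℝ → ℝ} {κ₂ κ₃ ρ E : ℝ} {z z' : ColIdx n n' → ℝ}
    (h₂ : 0 ≤ κ₂) (h₃ : 0 ≤ κ₃) (hρ₂ : κ₂ ≤ ρ) (hρ₃ : κ₃ ≤ ρ) (hE : 0 ≤ E)
    (h : ∀ i, |φ (z i) - ψ (z' i)| ≤ E) (i : ColIdx n n') :
    |domainResidual φ κ₂ κ₃ z i - domainResidual ψ κ₂ κ₃ z' i| ≤ ρ * E := by
  have hρE : 0 ≤ ρ * E := mul_nonneg (h₂.trans hρ₂) hE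
  rcases i with i | i | i
  · simp only [domainResidual, Sum.elim_inl, ← mul_sub]
    rw [abs_mul, abs_of_nonneg h₂]
    exact mul_le_mul hρ₂ (h _) (abs_nonneg _) (h₂.trans hρ₂)
  · simp only [domainResidual, Sum.elim_inl, Sum.elim_inr, ← mul_sub, sub_sub_sub_cancel_right]
    rw [abs_mul, abs_of_nonneg h₃]
    exact mul_le_mul hρ₃ (h _) (abs_nonneg _) (h₃.trans hρ₃)
  · simpa [domainResidual] using hρE

lemma abs_labelResidual_le {κ ρ By : ℝ} {z : ColIdx n n' → ℝ} (hκ : 0 ≤ κ) (hρ : κ ≤ ρ)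
    (hBy : 0 ≤ By) (hy : ∀ i, |S.y i| ≤ By) (i : ColIdx n n') :
    |S.labelResidual Real.sigmoid κ z i| ≤ ρ * (1 + By) := by
  have hρ0 := hκ.trans hρ
  rcases i with i | i
  · simp only [Data.labelResidual, Sum.elim_inl]
    rw [abs_mul, abs_of_nonneg hκ]
    refine mul_le_mul hρ ((abs_sub _ _).trans (add_le_add ?_ (hy i))) (abs_nonneg _) hρ0
    rw [abs_of_pos (Real.sigmoid_pos _)]
    exact Real.sigmoid_le_one _
  · simp only [Data.labelResidual, Sum.elim_inr, Pi.zero_apply, abs_zero]; positivity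

lemma abs_domainResidual_le {κ₂ κ₃ ρ By : ℝ} {z : ColIdx n n' → ℝ} (h₂ : 0 ≤ κ₂) (h₃ : 0 ≤ κ₃)
    (hρ₂ : κ₂ ≤ ρ) (hρ₃ : κ₃ ≤ ρ) (hBy : 0 ≤ By) (i : ColIdx n n') :
    |domainResidual Real.sigmoid κ₂ κ₃ z i| ≤ ρ * (1 + By) := by
  have hρ0 := h₂.trans hρ₂
  have h1 : ρ ≤ ρ * (1 + By) := le_mul_of_one_le_right hρ0 (by linarith)
  rcases i with i | i | i
  · simp only [domainResidual, Sum.elim_inl]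
    rw [abs_mul, abs_of_nonneg h₂, abs_of_pos (Real.sigmoid_pos _)]
    exact (mul_le_of_le_one_right h₂ (Real.sigmoid_le_one _)).trans (hρ₂.trans h1)
  · simp only [domainResidual, Sum.elim_inl, Sum.elim_inr]
    have : |Real.sigmoid (z (.inr (.inl i))) - 1| ≤ 1 := by
      rw [abs_le]
      constructor <;> linarith [Real.sigmoid_pos (z (.inr (.inl i))),
        Real.sigmoid_lt_one (z (.inr (.inl i)))]
    rw [abs_mul, abs_of_nonneg h₃]
    exact (mul_le_of_le_one_right h₃ this).trans (hρ₃.trans h1)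
  · simp only [domainResidual, Sum.elim_inr, Pi.zero_apply, abs_zero]; positivity

end Error

/-! ### One gradient step up to `C / N` with `C * N ^ 2` ReLUs -/

/-- `s` consists of at most `C * N ^ 2` ReLUs of affine functions with bounded coefficients. -/
structure ReluSum.HasSize (s : ReluSum) (C : ℝ) (N : ℕ) : Prop where
  card_le : (Fintype.card s.ι : ℝ) ≤ C * N ^ 2
  mass_le : ∑ m, |s.c m| ≤ C
  abs_a₁_le : ∀ m, |s.a₁ m| ≤ 1
  abs_a₂_le : ∀ m, |s.a₂ m| ≤ 1
  abs_b_le : ∀ m, |s.b m| ≤ C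

lemma ReluSum.Approximates.hasSize {s : ReluSum} {F : ℝ → ℝ → ℝ} {R C C' : ℝ} {N : ℕ}
    (h : s.Approximates F R C N) (hC : C ≤ C') : s.HasSize C' N where
  card_le := h.card_le.trans (by gcongr)
  mass_le := h.mass_le.trans hC
  abs_a₁_le := h.abs_a₁_le
  abs_a₂_le := h.abs_a₂_le
  abs_b_le m := (h.abs_b_le m).trans hC

variable {d K n n' : ℕ}

lemma Data.Bounded.point_le {S : Data d n n'} {Bx By : ℝ} (h : S.Bounded Bx By)
    (j : ColIdx n n') : ‖S.point j‖ ≤ Bx := by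
  rcases j with i | i | i
  · exact h.1 i
  · exact h.2.2.1 i
  · exact h.2.2.2

/-- The gradient directions computed from the memory `mem` by the activation functions `φ` (for
the outer weights) and `ψ` (for the inner weights) are within `E` of those computed from `mem'` by
`φ'` and `ψ'`. -/
def MeansClose (lam : ℝ) (S : Data d n n') (u : EuclideanSpace ℝ (Fin K × Fin d))
    (w v : EuclideanSpace ℝ (Fin K)) (φ ψ φ' ψ' : ℝ → ℝ → ℝ) (mem mem' : ColIdx n n' → Fin 4 → ℝ)
    (E : ℝ) : Prop :=
  (∀ (i : Fin d) (k : Fin K), |tokenMean ψ lam S u w v mem (fun j => S.point j i) k -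
      tokenMean ψ' lam S u w v mem' (fun j => S.point j i) k| ≤ E) ∧
  (∀ k : Fin K, |tokenMean φ lam S u w v mem (fun j => mem j 2) k -
      tokenMean φ' lam S u w v mem' (fun j => mem' j 2) k| ≤ E) ∧
  ∀ k : Fin K, |tokenMean φ lam S u w v mem (fun j => mem j 3) k -
      tokenMean φ' lam S u w v mem' (fun j => mem' j 3) k| ≤ E

lemma MeansClose.mono {lam : ℝ} {S : Data d n n'} {u : EuclideanSpace ℝ (Fin K × Fin d)}
    {w v : EuclideanSpace ℝ (Fin K)} {φ ψ φ' ψ' : ℝ → ℝ → ℝ} {mem mem' : ColIdx n n' → Fin 4 → ℝ}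
    {E E' : ℝ} (h : MeansClose lam S u w v φ ψ φ' ψ' mem mem' E) (hE : E ≤ E') :
    MeansClose lam S u w v φ ψ φ' ψ' mem mem' E' :=
  ⟨fun i k => (h.1 i k).trans hE, fun k => (h.2.1 k).trans hE, fun k => (h.2.2 k).trans hE⟩

/-- Perturbation bound for the gradient directions. -/
lemma meansClose_of_le {lam Bx Bu B G M E F F' : ℝ} (hlam : 0 ≤ lam) (hBu : 0 ≤ Bu)
    {S : Data d n n'} (hS : ∀ j, ‖S.point j‖ ≤ Bx) {u : EuclideanSpace ℝ (Fin K × Fin d)}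
    {w v : EuclideanSpace ℝ (Fin K)} (hw : ‖w‖ ≤ B) (hv : ‖v‖ ≤ B)
    (hu : ∀ k, ‖(WithLp.toLp 2 (fun i => u (k, i)) : EuclideanSpace ℝ (Fin d))‖ ≤ Bu)
    {f g : ℝ → ℝ} (hf : ∀ t, |t| ≤ Bu * Bx → |f t| ≤ M) (hg : ∀ t, |t| ≤ Bu * Bx → |g t| ≤ M)
    {φ ψ : ℝ → ℝ → ℝ}
    (hφ : ∀ p t, |p| ≤ (1 + lam) * (B * G) → |t| ≤ Bu * Bx → |φ p t - f t| ≤ F)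
    (hψ : ∀ p t, |p| ≤ (1 + lam) * (B * G) → |t| ≤ Bu * Bx → |ψ p t - p * g t| ≤ F')
    {mem mem' : ColIdx n n' → Fin 4 → ℝ} (m2 : ∀ j, |mem j 2| ≤ G) (m3 : ∀ j, |mem j 3| ≤ G)
    (e2 : ∀ j, |mem j 2 - mem' j 2| ≤ E) (e3 : ∀ j, |mem j 3 - mem' j 3| ≤ E) :
    MeansClose lam S u w v φ ψ (fun _ t => f t) (fun p t => p * g t) mem mem'
      (G * F + E * M + Bx * (F' + (1 + lam) * (B * E) * M)) := by
  have hB : 0 ≤ B := (norm_nonneg w).trans hw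
  have hpre : ∀ k j, |preact u k (S.point j)| ≤ Bu * Bx := fun k j => abs_preact_le hBu (hu k) (hS j)
  have hp : ∀ k j, |memMix lam w v (mem j) k| ≤ (1 + lam) * (B * G) :=
    fun k j => abs_memMix_le hlam hw hv (m2 j) (m3 j) k
  have hpe : ∀ k j, |memMix lam w v (mem j) k - memMix lam w v (mem' j) k| ≤
      (1 + lam) * (B * E) := fun k j => by
    rw [memMix_sub]; exact abs_memMix_le hlam hw hv (e2 j) (e3 j) k
  have hin : ∀ k j, |ψ (memMix lam w v (mem j) k) (preact u k (S.point j)) -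
      memMix lam w v (mem' j) k * g (preact u k (S.point j))| ≤
      F' + (1 + lam) * (B * E) * M := fun k j => by
    refine (abs_sub_le _ (memMix lam w v (mem j) k * g (preact u k (S.point j))) _).trans
      (add_le_add (hψ _ _ (hp k j) (hpre k j)) ?_)
    rw [← sub_mul, abs_mul]
    exact mul_le_mul (hpe k j) (hg _ (hpre k j)) (abs_nonneg _) ((abs_nonneg _).trans (hpe k j))
  have hout : ∀ (y y' : ColIdx n n' → ℝ), (∀ j, |y j| ≤ G) → (∀ j, |y j - y' j| ≤ E) → ∀ k j,
      |y j * φ (memMix lam w v (mem j) k) (preact u k (S.point j)) -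
      y' j * f (preact u k (S.point j))| ≤ G * F + E * M := fun y y' hy hyy k j => by
    refine (abs_sub_le _ (y j * f (preact u k (S.point j))) _).trans (add_le_add ?_ ?_)
    · rw [← mul_sub, abs_mul]
      exact mul_le_mul (hy j) (hφ _ _ (hp k j) (hpre k j)) (abs_nonneg _)
        ((abs_nonneg _).trans (hy j))
    · rw [← sub_mul, abs_mul]
      exact mul_le_mul (hyy j) (hf _ (hpre k j)) (abs_nonneg _) ((abs_nonneg _).trans (hyy j))
  -- Nonnegativity of the two parts of the error bound is read off from an instance of the
  -- estimates, which needs an index `k`. Without one all three claims are vacuous.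
  rcases isEmpty_or_nonempty (Fin K) with hK | ⟨⟨k₀⟩⟩
  · exact ⟨fun _ k => isEmptyElim k, fun k => isEmptyElim k, fun k => isEmptyElim k⟩
  have j₀ : ColIdx n n' := .inr (.inr ())
  have n1 : 0 ≤ G * F + E * M :=
    (abs_nonneg _).trans (hout _ (fun j => mem' j 2) m2 e2 k₀ j₀)
  have n2 : 0 ≤ Bx * (F' + (1 + lam) * (B * E) * M) :=
    mul_nonneg ((norm_nonneg _).trans (hS j₀)) ((abs_nonneg _).trans (hin k₀ j₀))
  refine ⟨fun i k => abs_tokenMean_sub_le fun j => ?_, fun k => abs_tokenMean_sub_le fun j => ?_,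
    fun k => abs_tokenMean_sub_le fun j => ?_⟩
  · rw [← mul_sub, abs_mul]
    refine (mul_le_mul ((abs_apply_le_norm _ i).trans (hS j)) (hin k j) (abs_nonneg _)
      ((norm_nonneg _).trans (hS j))).trans (by linarith)
  · exact (hout _ (fun j => mem' j 2) m2 e2 k j).trans (by linarith)
  · exact (hout _ (fun j => mem' j 3) m3 e3 k j).trans (by linarith)

lemma exists_abs_le_of_continuous {f : ℝ → ℝ} (hf : Continuous f) (R : ℝ) :
    ∃ M, 0 ≤ M ∧ ∀ t, |t| ≤ R → |f t| ≤ M := by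
  obtain ⟨M, hM⟩ := (isCompact_Icc (a := -R) (b := R)).exists_bound_of_continuousOn hf.continuousOn
  exact ⟨max M 0, le_max_right _ _, fun t ht => (hM t (abs_le.1 ht)).trans (le_max_left _ _)⟩

/-- Combinations of ReLUs with which the two layers approximate a gradient step. -/
theorem exists_reluSums {r : ℝ → ℝ} (hr : ContDiff ℝ 4 r) (d K : ℕ) {lam Bx By Bu B ρ : ℝ}
    (hlam : 0 < lam) (hBx : 0 < Bx) (hBy : 0 < By) (hBu : 0 < Bu) (hB : 0 < B) (hρ : 0 ≤ ρ) :
    ∃ C > 0, ∀ N : ℕ, 0 < N → ∃ s q s₂ s₃ : ReluSum,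
      (s.HasSize C N ∧ q.HasSize C N ∧ s₂.HasSize C N ∧ s₃.HasSize C N) ∧
      ∀ (n n' : ℕ) (κ₁ κ₂ κ₃ : ℝ), 0 ≤ κ₁ → 0 ≤ κ₂ → 0 ≤ κ₃ → κ₁ ≤ ρ → κ₂ ≤ ρ → κ₃ ≤ ρ →
      ∀ S : Data d n n', S.Bounded Bx By →
      ∀ (u : EuclideanSpace ℝ (Fin K × Fin d)) (w v : EuclideanSpace ℝ (Fin K)),
        ‖w‖ ≤ B → ‖v‖ ≤ B →
        (∀ k, ‖(WithLp.toLp 2 (fun i => u (k, i)) : EuclideanSpace ℝ (Fin d))‖ ≤ Bu) →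
        (∀ m j, |q.a₂ m * reluNet s u w (S.point j) + q.b m| ≤ C) ∧
        (∀ m j, |q.a₂ m * reluNet s u v (S.point j) + q.b m| ≤ C) ∧
        MeansClose lam S u w v s₂.eval s₃.eval (fun _ t => r t) (fun p t => p * deriv r t)
          (approxMem s q κ₁ κ₂ κ₃ S u w v) (exactMem r κ₁ κ₂ κ₃ S u w v) (C / N) ∧
        MeansClose lam S u w v (fun _ _ => 0) (fun _ _ => 0) (fun _ t => r t)
          (fun p t => p * deriv r t)
          (exactMem r κ₁ κ₂ κ₃ S u w v) (exactMem r κ₁ κ₂ κ₃ S u w v) C := by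
  have hr3 : ContDiff ℝ 3 r := hr.of_le (by norm_num)
  -- Here the fourth derivative of `r` is needed: the inner gradient contains `r'`, and the Fourier
  -- argument requires `r'` to be `C³`.
  have hr' : ContDiff ℝ 3 (deriv r) := ((contDiff_succ_iff_deriv (n := 3)).1 hr).2.2
  have hRt : 0 < Bu * Bx := mul_pos hBu hBx
  obtain ⟨M₁, hM₁, hf₁⟩ := exists_abs_le_of_continuous hr3.continuous (Bu * Bx)
  obtain ⟨M₂, hM₂, hf₂⟩ := exists_abs_le_of_continuous hr'.continuous (Bu * Bx)
  obtain ⟨M, hMdef⟩ : ∃ x, x = M₁ + M₂ := ⟨_, rfl⟩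
  have hM : 0 ≤ M := by rw [hMdef]; exact add_nonneg hM₁ hM₂
  have hf : ∀ t, |t| ≤ Bu * Bx → |r t| ≤ M := fun t ht => (hf₁ t ht).trans (by linarith)
  have hg : ∀ t, |t| ≤ Bu * Bx → |deriv r t| ≤ M := fun t ht => (hf₂ t ht).trans (by linarith)
  -- Each approximation must hold on an interval containing the approximate output of the previous
  -- stage. These intervals are fixed with the errors at `N = 1`, the largest ones, so that all
  -- constants are independent of `N`: `Rz` bounds the approximate network outputs, `G` the
  -- approximate residuals, and `R₂` both arguments `p` and `t` in the gradient step.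
  obtain ⟨C₁, hC₁, H₁⟩ := exists_reluApprox_mul (g := fun _ => 1) hr3 contDiff_const hRt
  obtain ⟨E₁, hE₁⟩ : ∃ x, x = K * (B * C₁) := ⟨_, rfl⟩
  have hE₁0 : 0 ≤ E₁ := by rw [hE₁]; positivity
  obtain ⟨Rz, hRz⟩ : ∃ x, x = K * (B * M) + E₁ + 1 := ⟨_, rfl⟩
  have hRz0 : 0 < Rz := by rw [hRz]; positivity
  obtain ⟨Cq, hCq, Hq⟩ := exists_reluApprox_mul (g := fun _ => 1)
    (contDiff_sigmoid.of_le le_top) contDiff_const hRz0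
  obtain ⟨Es, hEs⟩ : ∃ x, x = Cq + E₁ := ⟨_, rfl⟩
  have hEs0 : 0 ≤ Es := by rw [hEs]; positivity
  obtain ⟨G, hG⟩ : ∃ x, x = ρ * (1 + By) + ρ * Es := ⟨_, rfl⟩
  have hG0 : 0 ≤ G := by rw [hG]; positivity
  obtain ⟨R₂, hR₂⟩ : ∃ x, x = Bu * Bx + (1 + lam) * (B * G) := ⟨_, rfl⟩
  have hp0 : 0 ≤ (1 + lam) * (B * G) := by positivity
  have hR₂0 : 0 < R₂ := by linarith
  obtain ⟨C₂, hC₂, H₂⟩ := exists_reluApprox_mul (g := fun _ => 1) hr3 contDiff_const hR₂0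
  obtain ⟨C₃, hC₃, H₃⟩ := exists_reluApprox_mul (g := fun p => p) hr' contDiff_id hR₂0
  obtain ⟨D₁, hD₁⟩ : ∃ x, x = G * C₂ + ρ * Es * M + Bx * (C₃ + (1 + lam) * (B * (ρ * Es)) * M) := ⟨_, rfl⟩
  -- `D₁ / N` is the error of the approximate directions. `D₂` comes from comparison with zero
  -- activation functions, so it bounds the gradient directions themselves; this is what the case of
  -- large `ε` uses.
  obtain ⟨D₂, hD₂⟩ : ∃ x, x = G * M + 0 * M + Bx * ((1 + lam) * (B * G) * M + (1 + lam) * (B * 0) * M) := ⟨_, rfl⟩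
  have hD₁0 : 0 ≤ D₁ := by rw [hD₁]; positivity
  have hD₂0 : 0 ≤ D₂ := by rw [hD₂]; positivity
  refine ⟨C₁ + Cq + C₂ + C₃ + Rz + D₁ + D₂, by positivity, fun N hN => ?_⟩
  have hN' : (0 : ℝ) < N := Nat.cast_pos.2 hN
  have hN1 : (1 : ℝ) ≤ N := by exact_mod_cast hN
  obtain ⟨s, hs⟩ := H₁ N hN
  obtain ⟨q, hq⟩ := Hq N hN
  obtain ⟨s₂, hs₂⟩ := H₂ N hN
  obtain ⟨s₃, hs₃⟩ := H₃ N hN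
  refine ⟨s, q, s₂, s₃, ⟨hs.hasSize (by linarith), hq.hasSize (by linarith),
    hs₂.hasSize (by linarith), hs₃.hasSize (by linarith)⟩, ?_⟩
  intro n n' κ₁ κ₂ κ₃ k₁ k₂ k₃ l₁ l₂ l₃ S hS u w v hw hv hu
  have hpt := hS.point_le
  have hpre : ∀ k j, |preact u k (S.point j)| ≤ Bu * Bx :=
    fun k j => abs_preact_le hBu.le (hu k) (hpt j)
  have hnet : ∀ a : EuclideanSpace ℝ (Fin K), ‖a‖ ≤ B → ∀ j, |net r u a (S.point j)| ≤
      K * (B * M) := fun a ha j => abs_sum_mul_le ha fun k => hf _ (hpre k j)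
  have hdiff : ∀ a : EuclideanSpace ℝ (Fin K), ‖a‖ ≤ B → ∀ j,
      |reluNet s u a (S.point j) - net r u a (S.point j)| ≤ E₁ / N := fun a ha j => by
    have e : reluNet s u a (S.point j) - net r u a (S.point j) =
        ∑ k, a k * (s.eval 0 (preact u k (S.point j)) - r (preact u k (S.point j))) := by
      simp only [reluNet, net, preact, mul_sub, Finset.sum_sub_distrib]
    rw [e]
    refine (abs_sum_mul_le ha fun k => ?_).trans (le_of_eq (by
      show (K : ℝ) * (B * (C₁ / N)) = _; rw [hE₁]; ring))
    rw [abs_sub_comm]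
    simpa using hs.abs_sub_le 0 _ (by simpa using hRt.le) (hpre k j)
  have hz : ∀ a : EuclideanSpace ℝ (Fin K), ‖a‖ ≤ B → ∀ j, |reluNet s u a (S.point j)| ≤ Rz :=
    fun a ha j => by
      have h1 := hdiff a ha j
      have h2 := hnet a ha j
      have h3 : E₁ / N ≤ E₁ := div_le_self hE₁0 hN1
      have h4 := abs_sub_abs_le_abs_sub (reluNet s u a (S.point j)) (net r u a (S.point j))
      linarith
  have hmask : ∀ a : EuclideanSpace ℝ (Fin K), ‖a‖ ≤ B → ∀ m j,
      |q.a₂ m * reluNet s u a (S.point j) + q.b m| ≤ C₁ + Cq + C₂ + C₃ + Rz + D₁ + D₂ :=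
    fun a ha m j => by
      refine (abs_add_le _ _).trans ?_
      rw [abs_mul]
      have h1 := mul_le_mul (hq.abs_a₂_le m) (hz a ha j) (abs_nonneg _) zero_le_one
      have h2 := hq.abs_b_le m
      linarith
  have hsig : ∀ a : EuclideanSpace ℝ (Fin K), ‖a‖ ≤ B → ∀ j,
      |q.eval 0 (reluNet s u a (S.point j)) - Real.sigmoid (net r u a (S.point j))| ≤ Es / N :=
    fun a ha j => by
      have h1 := hq.abs_sub_le 0 _ (by simpa using hRz0.le) (hz a ha j)
      rw [abs_sub_comm, one_mul] at h1
      have h2 := (abs_sigmoid_sub_le _ _).trans (hdiff a ha j)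
      refine (abs_sub_le _ _ _).trans ((add_le_add h1 h2).trans (le_of_eq ?_))
      rw [hEs, add_div]
  have hEsN : 0 ≤ Es / N := by positivity
  have e2 : ∀ j, |approxMem s q κ₁ κ₂ κ₃ S u w v j 2 - exactMem r κ₁ κ₂ κ₃ S u w v j 2| ≤
      ρ * (Es / N) := fun j => abs_labelResidual_sub_le
      (z := fun i => reluNet s u w (S.point i)) (z' := fun i => net r u w (S.point i)) k₁ l₁ hEsN
      (hsig w hw) j
  have e3 : ∀ j, |approxMem s q κ₁ κ₂ κ₃ S u w v j 3 - exactMem r κ₁ κ₂ κ₃ S u w v j 3| ≤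
      ρ * (Es / N) := fun j => abs_domainResidual_sub_le
      (z := fun i => reluNet s u v (S.point i)) (z' := fun i => net r u v (S.point i)) k₂ k₃ l₂ l₃
      hEsN (hsig v hv) j
  have x2 : ∀ j, |exactMem r κ₁ κ₂ κ₃ S u w v j 2| ≤ ρ * (1 + By) :=
    fun j => abs_labelResidual_le
      (z := fun i => net r u w (S.point i)) k₁ l₁ hBy.le hS.2.1 j
  have x3 : ∀ j, |exactMem r κ₁ κ₂ κ₃ S u w v j 3| ≤ ρ * (1 + By) :=
    fun j => abs_domainResidual_le
      (z := fun i => net r u v (S.point i)) k₂ k₃ l₂ l₃ hBy.le j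
  have hEle : ρ * (Es / N) ≤ ρ * Es := by gcongr; exact div_le_self hEs0 hN1
  have hρEs : 0 ≤ ρ * Es := mul_nonneg hρ hEs0
  refine ⟨hmask w hw, hmask v hv, ?_, ?_⟩
  · refine (meansClose_of_le (G := G) (F := C₂ / N) (F' := C₃ / N) (E := ρ * (Es / N)) hlam.le
      hBu.le hpt hw hv hu hf hg (fun p t hp ht => ?_) (fun p t hp ht => ?_) (fun j => ?_)
      (fun j => ?_) e2 e3).mono ?_
    · have := hs₂.abs_sub_le p t (by linarith) (by linarith)
      rwa [abs_sub_comm, one_mul] at this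
    · have := hs₃.abs_sub_le p t (by linarith) (by linarith)
      rwa [abs_sub_comm] at this
    · have := abs_sub_abs_le_abs_sub (approxMem s q κ₁ κ₂ κ₃ S u w v j 2)
        (exactMem r κ₁ κ₂ κ₃ S u w v j 2)
      linarith [e2 j, x2 j]
    · have := abs_sub_abs_le_abs_sub (approxMem s q κ₁ κ₂ κ₃ S u w v j 3)
        (exactMem r κ₁ κ₂ κ₃ S u w v j 3)
      linarith [e3 j, x3 j]
    · calc _ = D₁ / N := by rw [hD₁]; ring
        _ ≤ _ := div_le_div_of_nonneg_right (by linarith) hN'.le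
  · refine (meansClose_of_le (G := G) (F := M) (F' := (1 + lam) * (B * G) * M) (E := 0) hlam.le
      hBu.le hpt hw hv hu hf hg (fun p t hp ht => ?_) (fun p t hp ht => ?_)
      (fun j => (x2 j).trans (by linarith)) (fun j => (x3 j).trans (by linarith)) (by simp)
      (by simp)).mono (by linarith)
    · rw [zero_sub, abs_neg]; exact hf t ht
    · rw [zero_sub, abs_neg, abs_mul]
      exact mul_le_mul hp (hg t ht) (abs_nonneg _) hp0

section Assembly

variable {d K n n' : ℕ}

lemma tokenMean_zero (lam : ℝ) (S : Data d n n') (u : EuclideanSpace ℝ (Fin K × Fin d))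
    (w v : EuclideanSpace ℝ (Fin K)) (mem : ColIdx n n' → Fin 4 → ℝ) (g : ColIdx n n' → ℝ)
    (k : Fin K) : tokenMean (fun _ _ => 0) lam S u w v mem g k = 0 := by
  simp [tokenMean]

/-- Approximate gradient directions give a perturbed gradient step. -/
lemma exists_step_eq {r : ℝ → ℝ} (hr : Differentiable ℝ r) {c lam η E : ℝ} (hlam : 0 ≤ lam)
    (hη : 0 ≤ η) (hE : 0 ≤ E) {S : Data d n n'} {u : EuclideanSpace ℝ (Fin K × Fin d)}
    {w v : EuclideanSpace ℝ (Fin K)} {φ ψ : ℝ → ℝ → ℝ} {mem : ColIdx n n' → Fin 4 → ℝ}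
    (h : MeansClose lam S u w v φ ψ (fun _ t => r t) (fun p t => p * deriv r t) mem
      (exactMem r (Fintype.card (ColIdx n n') * c) (Fintype.card (ColIdx n n') / n)
        (Fintype.card (ColIdx n n') / n') S u w v) E) :
    ∃ (eu : EuclideanSpace ℝ (Fin K × Fin d)) (ew ev : EuclideanSpace ℝ (Fin K)),
      ‖eu‖ ≤ (K * d + K + 1) * (1 + lam) * (η * E) ∧
      ‖ew‖ ≤ (K * d + K + 1) * (1 + lam) * (η * E) ∧
      ‖ev‖ ≤ (K * d + K + 1) * (1 + lam) * (η * E) ∧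
      Param.mk
        (WithLp.toLp 2 fun ki =>
          u ki - η * tokenMean ψ lam S u w v mem (fun j => S.point j ki.2) ki.1)
        (WithLp.toLp 2 fun k => w k - η * tokenMean φ lam S u w v mem (fun j => mem j 2) k)
        (WithLp.toLp 2 fun k => v k - η * lam * tokenMean φ lam S u w v mem (fun j => mem j 3) k) =
      step r c lam η S u w v eu ew ev := by
  set gu := gradient (fun u' => labelLoss r c S u' w - lam * domainLoss r S u' v) u with hgu
  set gw := gradient (fun w' => labelLoss r c S u w') w with hgw
  set gv := gradient (fun v' => domainLoss r S u v') v with hgv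
  have hK : (0 : ℝ) ≤ K := Nat.cast_nonneg K
  have hKd : (0 : ℝ) ≤ K * d := by positivity
  have hηE : 0 ≤ η * E := mul_nonneg hη hE
  -- The perturbations are the discrepancies between the true and the computed displacement, so the
  -- last identity is exact. The common factor `(K * d + K + 1) * (1 + lam)` covers the number of
  -- coordinates of each vector and the extra `lam` in the update of `v`.
  refine ⟨WithLp.toLp 2 fun ki =>
      η * (gu ki - tokenMean ψ lam S u w v mem (fun j => S.point j ki.2) ki.1),
    WithLp.toLp 2 fun k => η * (gw k - tokenMean φ lam S u w v mem (fun j => mem j 2) k),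
    WithLp.toLp 2 fun k => η * lam * (gv k - tokenMean φ lam S u w v mem (fun j => mem j 3) k),
    ?_, ?_, ?_, ?_⟩
  · refine (norm_le_card_mul (B := η * E) hηE fun ki => ?_).trans ?_
    · show |η * _| ≤ _
      rw [abs_mul, abs_of_nonneg hη, hgu, gradient_loss_inner_apply c lam S u w v hr, abs_sub_comm]
      exact mul_le_mul_of_nonneg_left (h.1 _ _) hη
    · refine mul_le_mul_of_nonneg_right ?_ hηE
      simp only [Fintype.card_prod, Fintype.card_fin, Nat.cast_mul]
      nlinarith
  · refine (norm_le_card_mul (B := η * E) hηE fun k => ?_).trans ?_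
    · show |η * _| ≤ _
      rw [abs_mul, abs_of_nonneg hη, hgw, gradient_labelLoss_outer_apply c lam S u w v
        (Fintype.card (ColIdx n n') / n) (Fintype.card (ColIdx n n') / n'), abs_sub_comm]
      exact mul_le_mul_of_nonneg_left (h.2.1 _) hη
    · refine mul_le_mul_of_nonneg_right ?_ hηE
      simp only [Fintype.card_fin]
      nlinarith
  · refine (norm_le_card_mul (B := lam * (η * E)) (mul_nonneg hlam hηE) fun k => ?_).trans ?_
    · show |η * lam * _| ≤ _
      rw [abs_mul, abs_of_nonneg (mul_nonneg hη hlam), hgv,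
        gradient_domainLoss_outer_apply lam S u w v (Fintype.card (ColIdx n n') * c), abs_sub_comm]
      refine (mul_le_mul_of_nonneg_left (h.2.2 _) (mul_nonneg hη hlam)).trans (le_of_eq ?_)
      ring
    · rw [← mul_assoc]
      refine mul_le_mul_of_nonneg_right ?_ hηE
      simp only [Fintype.card_fin]
      nlinarith
  · rw [step, ← hgu, ← hgw, ← hgv]
    congr 1 <;> ext k <;> simp <;> ring

/-! ### Norms and sizes of the two layers -/

/-- The first layer: evaluation of the networks and of the residuals. -/
def firstLayer (d K : ℕ) (s q : ReluSum) (κ₁ κ₂ κ₃ B : ℝ) : Layer (TokIdx d K) :=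
  evalLayer d K s (balancedIn (residCoef κ₁ κ₂ κ₃ q) (residRow B q))
    (balancedOut (residCoef κ₁ κ₂ κ₃ q) (residOut q))

/-- The second layer: gradient step, projection, and clearing of the memory. -/
def secondLayer {d K D : ℕ} (lam η : ℝ) (s s' : ReluSum)
    (A₁ : Matrix (Fin D) (Unit ⊕ ParamIdx d K) ℝ) (A₂ : Matrix (ParamIdx d K) (Fin D) ℝ) :
    Layer (TokIdx d K) :=
  stepLayer d K lam η s s' (Matrix.fromRows (paramRead A₁) clearRead)
    (Matrix.fromCols (paramWrite A₂) clearWrite)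

lemma firstLayer_heads (s q : ReluSum) (κ₁ κ₂ κ₃ B : ℝ) :
    (firstLayer d K s q κ₁ κ₂ κ₃ B).heads = 2 * (K * Fintype.card s.ι) := by
  show Fintype.card (Fin 2 × Fin K × s.ι) = _
  simp

lemma firstLayer_hidden (s q : ReluSum) (κ₁ κ₂ κ₃ B : ℝ) :
    (firstLayer d K s q κ₁ κ₂ κ₃ B).hidden = 3 * Fintype.card q.ι + 3 := by
  show Fintype.card ((Fin 3 × q.ι) ⊕ Fin 3) = _
  simp

lemma secondLayer_heads {D : ℕ} (lam η : ℝ) (s s' : ReluSum)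
    (A₁ : Matrix (Fin D) (Unit ⊕ ParamIdx d K) ℝ) (A₂ : Matrix (ParamIdx d K) (Fin D) ℝ) :
    (secondLayer lam η s s' A₁ A₂).heads =
      2 * (K * Fintype.card s.ι) + K * Fintype.card s'.ι := by
  show Fintype.card ((Fin 2 × Fin K × s.ι) ⊕ (Fin K × s'.ι)) = _
  simp

lemma secondLayer_hidden {D : ℕ} (lam η : ℝ) (s s' : ReluSum)
    (A₁ : Matrix (Fin D) (Unit ⊕ ParamIdx d K) ℝ) (A₂ : Matrix (ParamIdx d K) (Fin D) ℝ) :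
    (secondLayer lam η s s' A₁ A₂).hidden = D + 8 := by
  show Fintype.card (Fin D ⊕ (Fin 4 × Fin 2)) = _
  simp

lemma opNorm_keySel_le {B : ℝ} (hB : 1 ≤ B) (k : Fin K) :
    opNorm (selMat (keySel (d := d) k)) ≤ Fintype.card (TokIdx d K) * B :=
  opNorm_le_of_abs_le (by linarith) fun i j => (abs_selMat_le _ i j).trans hB

lemma opNorm_featMat_le {s : ReluSum} {C lam : ℝ} {N : ℕ} (hlam : 0 ≤ lam) (hC : 0 ≤ C)
    (hs : s.HasSize C N) (m : s.ι) {a₁ : ℝ} (h₁ : |a₁| ≤ 1) :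
    opNorm (featMat (d := d) (K := K) lam a₁ (s.a₂ m) (s.b m)) ≤
      Fintype.card (TokIdx d K) * (1 + C + lam) :=
  opNorm_le_of_abs_le (by positivity) fun i j =>
    abs_featMat_le hlam h₁ (hs.abs_a₂_le m) (hs.abs_b_le m) i j

lemma sum_abs_residCoef_le {κ₁ κ₂ κ₃ ρ C : ℝ} {N : ℕ} {q : ReluSum} (hq : q.HasSize C N)
    (k₁ : 0 ≤ κ₁) (k₂ : 0 ≤ κ₂) (k₃ : 0 ≤ κ₃) (l₁ : κ₁ ≤ ρ) (l₂ : κ₂ ≤ ρ) (l₃ : κ₃ ≤ ρ) : ∑ h, |residCoef κ₁ κ₂ κ₃ q h| ≤ 3 * ρ * (C + 1) := by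
  have e : ∑ h, |residCoef κ₁ κ₂ κ₃ q h| =
      (κ₁ + κ₂ + κ₃) * ∑ m, |q.c m| + (2 * κ₁ + κ₃) := by
    simp [residCoef, Fintype.sum_prod_type, Fin.sum_univ_three, abs_mul, ← Finset.mul_sum,
      abs_of_nonneg k₁, abs_of_nonneg k₂, abs_of_nonneg k₃]
    ring
  rw [e]
  have h1 : (κ₁ + κ₂ + κ₃) * ∑ m, |q.c m| ≤ 3 * ρ * C :=
    mul_le_mul (by linarith) hq.mass_le (Finset.sum_nonneg fun _ _ => abs_nonneg _) (by linarith)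
  linarith

lemma abs_residRow_le {C : ℝ} {N : ℕ} {q : ReluSum} (hq : q.HasSize C N) (hC : 0 ≤ C)
    (h : (Fin 3 × q.ι) ⊕ Fin 3) (b : TokIdx d K) : |residRow C q h b| ≤ 2 * C + 1 := by
  have h0 : |(0 : ℝ)| ≤ 2 * C + 1 := by rw [abs_zero]; positivity
  have h1 : |(1 : ℝ)| ≤ 2 * C + 1 := by rw [abs_one]; linarith
  have h1' : |(-1 : ℝ)| ≤ 2 * C + 1 := by rw [abs_neg]; exact h1
  have hC1 : |C| ≤ 2 * C + 1 := by rw [abs_of_nonneg hC]; linarith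
  have hC1' : |-C| ≤ 2 * C + 1 := by rw [abs_neg]; exact hC1
  rcases h with ⟨e, m⟩ | e
  · have h2 : |q.a₂ m| ≤ 2 * C + 1 := (hq.abs_a₂_le m).trans (by linarith)
    have h3 : |q.b m - C| ≤ 2 * C + 1 := by
      refine (abs_sub _ _).trans ?_
      rw [abs_of_nonneg hC]
      linarith [hq.abs_b_le m]
    refine abs_flagMem_le (by positivity) ?_ ?_ b
    · intro x; fin_cases e <;> fin_cases x <;> assumption
    · intro x; fin_cases e <;> fin_cases x <;> assumption
  · refine abs_flagMem_le (by positivity) ?_ ?_ b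
    · intro x; fin_cases e <;> fin_cases x <;> assumption
    · intro x; exact h0

lemma abs_residOut_le (q : ReluSum) (h : (Fin 3 × q.ι) ⊕ Fin 3) (b : TokIdx d K) :
    |residOut q h b| ≤ 1 := by
  have h0 : |(0 : ℝ)| ≤ 1 := by simp
  have h1 : |(1 : ℝ)| ≤ 1 := by simp
  rcases h with ⟨e, m⟩ | e
  all_goals
    refine abs_flagMem_le zero_le_one (fun _ => h0) ?_ b
    intro x; fin_cases e <;> fin_cases x <;> assumption

/-- Queries and keys enter through a maximum, and values and feed-forward weights through masses.
None of these depends on the number of heads or hidden units, so the bound does not contain `N`. -/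
lemma firstLayer_norm_le {s q : ReluSum} {C κ₁ κ₂ κ₃ ρ : ℝ} {N : ℕ} (hs : s.HasSize C N)
    (hq : q.HasSize C N) (hC : 0 ≤ C) (k₁ : 0 ≤ κ₁) (k₂ : 0 ≤ κ₂) (k₃ : 0 ≤ κ₃) (l₁ : κ₁ ≤ ρ)
    (l₂ : κ₂ ≤ ρ) (l₃ : κ₃ ≤ ρ) :
    (firstLayer d K s q κ₁ κ₂ κ₃ C).norm ≤
      Fintype.card (TokIdx d K) * (1 + C + 0) + Fintype.card (TokIdx d K) * (2 * (K * C)) +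
      (1 + 3 * ρ * (C + 1)) * ((Fintype.card (TokIdx d K) + 1) * (2 * C + 1)) +
      (1 + 3 * ρ * (C + 1)) * ((Fintype.card (TokIdx d K) + 1) * 1) := by
  classical
  refine Layer.norm_of_le _ _ _ _ _ (by positivity)
    (fun m => opNorm_keySel_le (by linarith) _)
    (fun m => opNorm_featMat_le le_rfl hC hs m.2.2 (by simp)) ?_
    (opNorm_balancedIn_le (by positivity) (sum_abs_residCoef_le hq k₁ k₂ k₃ l₁ l₂ l₃)
      (abs_residRow_le hq hC))
    (opNorm_balancedOut_le zero_le_one (sum_abs_residCoef_le hq k₁ k₂ k₃ l₁ l₂ l₃)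
      (abs_residOut_le q))
  refine (Finset.sum_le_sum fun m _ => opNorm_smul_selMat_le (s.c m.2.2) _).trans ?_
  rw [← Finset.mul_sum]
  refine mul_le_mul_of_nonneg_left ?_ (Nat.cast_nonneg _)
  simp only [Fintype.sum_prod_type, Finset.sum_const, Finset.card_univ, Fintype.card_fin,
    nsmul_eq_mul, Nat.cast_ofNat]
  exact mul_le_mul_of_nonneg_left (mul_le_mul_of_nonneg_left hs.mass_le (Nat.cast_nonneg K))
    zero_le_two

/-- The learning rate occurs only in the value matrices, hence the bound is affine in `η`. The
projection matrices keep their norms when embedded into token space, and clearing the memory adds 3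
to each feed-forward matrix. -/
lemma secondLayer_norm_le {D : ℕ} {lam η C C_MLP : ℝ} {N : ℕ} {s s' : ReluSum}
    {A₁ : Matrix (Fin D) (Unit ⊕ ParamIdx d K) ℝ} {A₂ : Matrix (ParamIdx d K) (Fin D) ℝ}
    (hs : s.HasSize C N) (hs' : s'.HasSize C N) (hC : 0 ≤ C) (hlam : 0 ≤ lam) (hη : 0 ≤ η)
    (hA : opNorm A₁ + opNorm A₂ ≤ C_MLP) :
    (secondLayer lam η s s' A₁ A₂).norm ≤
      Fintype.card (TokIdx d K) * (1 + C + lam) +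
      Fintype.card (TokIdx d K) * (η * ((2 + lam) * (K * C))) + 6 + C_MLP := by
  have h1 := (opNorm_fromRows_le (paramRead A₁) (clearRead (d := d) (K := K))).trans
    (add_le_add (opNorm_paramRead_le A₁) opNorm_clearRead_le)
  have h2 := (opNorm_fromCols_le (paramWrite A₂) (clearWrite (d := d) (K := K))).trans
    (add_le_add (opNorm_paramWrite_le A₂) opNorm_clearWrite_le)
  have hV : (Sum.elim (fun m : Fin 2 × Fin K × s.ι =>
        (-(η * ![1, lam] m.1 * s.c m.2.2)) • selMat (outerSel (d := d) m.1 m.2.1))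
      fun m : Fin K × s'.ι => (-(η * s'.c m.2)) • selMat (innerSel m.1)) = fun m =>
      Sum.elim (fun m : Fin 2 × Fin K × s.ι => -(η * ![1, lam] m.1 * s.c m.2.2))
        (fun m : Fin K × s'.ι => -(η * s'.c m.2)) m •
      selMat (Sum.elim (fun m : Fin 2 × Fin K × s.ι => outerSel m.1 m.2.1)
        (fun m : Fin K × s'.ι => innerSel m.1) m) := by
    ext m; rcases m with m | m <;> rfl
  have h3 : (secondLayer lam η s s' A₁ A₂).norm ≤
      Fintype.card (TokIdx d K) * (1 + C + lam) +
      Fintype.card (TokIdx d K) * (η * ((2 + lam) * (K * C))) + (opNorm A₁ + 3) +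
      (opNorm A₂ + 3) := by
    refine Layer.norm_of_le _ _ _ _ _ (by positivity) ?_ ?_ ?_ h1 h2
    · rintro (m | m)
      · exact opNorm_featMat_le hlam hC hs m.2.2 (hs.abs_a₁_le _)
      · exact opNorm_featMat_le hlam hC hs' m.2 (hs'.abs_a₁_le _)
    · rintro (m | m) <;> exact opNorm_keySel_le (by linarith) _
    · rw [hV]
      refine (Finset.sum_le_sum fun m _ => opNorm_smul_selMat_le _ _).trans ?_
      rw [← Finset.mul_sum]
      refine mul_le_mul_of_nonneg_left ?_ (Nat.cast_nonneg _)
      have e : ∑ m, |Sum.elim (fun m : Fin 2 × Fin K × s.ι => -(η * ![1, lam] m.1 * s.c m.2.2))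
          (fun m : Fin K × s'.ι => -(η * s'.c m.2)) m| =
          η * ((1 + lam) * (K * ∑ m, |s.c m|) + K * ∑ m, |s'.c m|) := by
        simp [Fintype.sum_prod_type, abs_mul, ← Finset.mul_sum, abs_of_nonneg hη,
          abs_of_nonneg hlam]
        ring
      rw [e]
      refine mul_le_mul_of_nonneg_left ?_ hη
      have e1 := mul_le_mul_of_nonneg_left hs.mass_le (Nat.cast_nonneg (α := ℝ) K)
      have e2 := mul_le_mul_of_nonneg_left hs'.mass_le (Nat.cast_nonneg (α := ℝ) K)
      nlinarith
  linarith

/-! ### Layers without attention, and alternation of two layers -/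

/-- The layer with no attention which projects the parameters. -/
def projectLayer {d K D : ℕ} (A₁ : Matrix (Fin D) (Unit ⊕ ParamIdx d K) ℝ)
    (A₂ : Matrix (ParamIdx d K) (Fin D) ℝ) : Layer (TokIdx d K) :=
  Layer.of (ι := Empty) Empty.elim Empty.elim Empty.elim (paramRead A₁) (paramWrite A₂)

/-- The layer which does nothing. -/
def idleLayer (d K : ℕ) : Layer (TokIdx d K) :=
  Layer.of (ι := Empty) (κ := Empty) Empty.elim Empty.elim Empty.elim 0 0

lemma attn_of_isEmpty {T ι κ Col : Type} [Fintype T] [Fintype ι] [IsEmpty ι] [Fintype κ]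
    [Fintype Col] (Q K V : ι → Matrix T T ℝ) (W₁ : Matrix κ T ℝ) (W₂ : Matrix T κ ℝ)
    (X : Matrix T Col ℝ) : (Layer.of Q K V W₁ W₂).attn X = X := by
  ext a i
  simp [Layer.attn_of]

lemma idleLayer_apply {Col : Type} [Fintype Col] (X : Matrix (TokIdx d K) Col ℝ) :
    (idleLayer d K).apply X = X := by
  rw [Layer.apply, idleLayer, attn_of_isEmpty]
  ext a i
  simp [Layer.mlp_of]

lemma idleLayer_norm_le : (idleLayer d K).norm ≤ 0 := by
  have h1 : opNorm (0 : Matrix Empty (TokIdx d K) ℝ) ≤ 0 :=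
    opNorm_le_of_sum_sq_le le_rfl (by simp)
  have h2 : opNorm (0 : Matrix (TokIdx d K) Empty ℝ) ≤ 0 :=
    opNorm_le_of_sum_sq_le le_rfl (by simp)
  refine (Layer.norm_of_le _ _ _ _ _ le_rfl (fun m => m.elim) (fun m => m.elim) (B₂ := 0)
    (by simp) h1 h2).trans (by simp)

lemma projectLayer_norm_le {D : ℕ} (A₁ : Matrix (Fin D) (Unit ⊕ ParamIdx d K) ℝ)
    (A₂ : Matrix (ParamIdx d K) (Fin D) ℝ) :
    (projectLayer A₁ A₂).norm ≤ opNorm A₁ + opNorm A₂ := by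
  refine (Layer.norm_of_le _ _ _ _ _ le_rfl (fun m => m.elim) (fun m => m.elim) (B₂ := 0)
    (by simp) (opNorm_paramRead_le A₁) (opNorm_paramWrite_le A₂)).trans (by simp)

/-- Alternating two layers. -/
lemma exists_alternating {A B : Layer (TokIdx d K)} {H H' Z : ℝ} (hA : (A.heads : ℝ) ≤ H)
    (hB : (B.heads : ℝ) ≤ H) (hA' : (A.hidden : ℝ) ≤ H') (hB' : (B.hidden : ℝ) ≤ H')
    (nA : A.norm ≤ Z) (nB : B.norm ≤ Z) {L : ℕ} (hL : 0 < L) :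
    ∃ TF : Fin (2 * L) → Layer (TokIdx d K),
      (∀ j, ((TF j).heads : ℝ) ≤ H) ∧ (∀ j, ((TF j).hidden : ℝ) ≤ H') ∧ tfNorm TF ≤ Z ∧
      ∀ l, (∀ h : 2 * l < 2 * L, TF ⟨2 * l, h⟩ = A) ∧
        ∀ h : 2 * l + 1 < 2 * L, TF ⟨2 * l + 1, h⟩ = B := by
  refine ⟨fun j => if j.1 % 2 = 0 then A else B, fun j => ?_, fun j => ?_, ?_, fun l => ?_⟩
  · dsimp only; split_ifs <;> assumption
  · dsimp only; split_ifs <;> assumption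
  · have : Nonempty (Fin (2 * L)) := ⟨⟨0, by omega⟩⟩
    refine ciSup_le fun j => ?_
    dsimp only; split_ifs <;> assumption
  · refine ⟨fun _ => by simp, fun _ => ?_⟩
    simp only [ite_eq_right_iff]
    omega

end Assembly

lemma Param.mk_inj {d K : ℕ} {u u' : EuclideanSpace ℝ (Fin K × Fin d)}
    {w w' v v' : EuclideanSpace ℝ (Fin K)} (h : Param.mk u w v = Param.mk u' w' v') :
    u = u' ∧ w = w' ∧ v = v' := by
  refine ⟨?_, ?_, ?_⟩ <;> ext k
  · exact congrArg (fun θ : Param d K => θ (.inl k)) h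
  · exact congrArg (fun θ : Param d K => θ (.inr (.inl k))) h
  · exact congrArg (fun θ : Param d K => θ (.inr (.inr k))) h

/-! ### Action and size of a pair of consecutive layers -/

section Apply

variable {d K n n' D : ℕ} {P : Param d K → Param d K}
  {A₁ : Matrix (Fin D) (Unit ⊕ ParamIdx d K) ℝ} {A₂ : Matrix (ParamIdx d K) (Fin D) ℝ}

lemma projectLayer_idleLayer_apply
    (hP : ∀ θ i, P θ i = θ i + (A₂ *ᵥ fun h => relu ((A₁ *ᵥ Sum.elim (fun _ => 1) θ) h)) i)
    (S : Data d n n') (θ : Param d K) :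
    (projectLayer A₁ A₂).apply ((idleLayer d K).apply (tokens S θ)) = tokens S (P θ) := by
  rw [idleLayer_apply, Layer.apply, projectLayer, attn_of_isEmpty, tokens_eq_memTokens,
    tokens_eq_memTokens, mlp_project _ _ _ hP]

lemma secondLayer_firstLayer_apply
    (hP : ∀ θ i, P θ i = θ i + (A₂ *ᵥ fun h => relu ((A₁ *ᵥ Sum.elim (fun _ => 1) θ) h)) i)
    {s q s₂ s₃ : ReluSum} {κ₁ κ₂ κ₃ C lam η : ℝ} {S : Data d n n'}
    {u : EuclideanSpace ℝ (Fin K × Fin d)} {w v : EuclideanSpace ℝ (Fin K)}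
    (hw : ∀ m j, |q.a₂ m * reluNet s u w (S.point j) + q.b m| ≤ C)
    (hv : ∀ m j, |q.a₂ m * reluNet s u v (S.point j) + q.b m| ≤ C) :
    (secondLayer lam η s₂ s₃ A₁ A₂).apply
        ((firstLayer d K s q κ₁ κ₂ κ₃ C).apply (tokens S (Param.mk u w v))) =
      tokens S (P (Param.mk
        (WithLp.toLp 2 fun ki => u ki - η * tokenMean s₃.eval lam S u w v
          (approxMem s q κ₁ κ₂ κ₃ S u w v) (fun j => S.point j ki.2) ki.1)
        (WithLp.toLp 2 fun k => w k - η * tokenMean s₂.eval lam S u w v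
          (approxMem s q κ₁ κ₂ κ₃ S u w v) (fun j => approxMem s q κ₁ κ₂ κ₃ S u w v j 2) k)
        (WithLp.toLp 2 fun k => v k - η * lam * tokenMean s₂.eval lam S u w v
          (approxMem s q κ₁ κ₂ κ₃ S u w v)
          (fun j => approxMem s q κ₁ κ₂ κ₃ S u w v j 3) k))) := by
  rw [Layer.apply, Layer.apply, tokens_eq_memTokens, tokens_eq_memTokens,
    firstLayer, evalLayer_attn, evalLayer, mlp_residual _ _ _ q S _ _ _ hw hv]
  exact (congrArg _ (stepLayer_attn lam η s₂ s₃ _ _ S u w v _)).trans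
    (mlp_project_clear _ _ _ hP S _ _)

/-- The constant 11 leaves room for the three linear residual units and the eight clearing units,
which are absorbed because `N ^ 2` is at least 1. -/
lemma layer_sizes_le {C lam η κ₁ κ₂ κ₃ B : ℝ} {N : ℕ} (hN : 0 < N) (hC : 0 ≤ C)
    {s q s₂ s₃ : ReluSum} (hs : s.HasSize C N) (hq : q.HasSize C N) (hs₂ : s₂.HasSize C N)
    (hs₃ : s₃.HasSize C N) :
    ((firstLayer d K s q κ₁ κ₂ κ₃ B).heads : ℝ) ≤ (3 * K * C + 3 * C + 11) * N ^ 2 ∧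
    ((firstLayer d K s q κ₁ κ₂ κ₃ B).hidden : ℝ) ≤ (3 * K * C + 3 * C + 11) * N ^ 2 + D ∧
    ((secondLayer lam η s₂ s₃ A₁ A₂).heads : ℝ) ≤ (3 * K * C + 3 * C + 11) * N ^ 2 ∧
    ((secondLayer lam η s₂ s₃ A₁ A₂).hidden : ℝ) ≤ (3 * K * C + 3 * C + 11) * N ^ 2 + D := by
  have hK0 : (0 : ℝ) ≤ K := Nat.cast_nonneg _
  have hN1 : (1 : ℝ) ≤ (N : ℝ) ^ 2 := by exact_mod_cast Nat.one_le_pow 2 N hN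
  have p0 : 0 ≤ C * (N : ℝ) ^ 2 := by positivity
  have p1 : 0 ≤ K * (C * (N : ℝ) ^ 2) := by positivity
  have p2 : (0 : ℝ) ≤ D := Nat.cast_nonneg _
  have g1 := mul_le_mul_of_nonneg_left hs.card_le hK0
  have g2 := mul_le_mul_of_nonneg_left hs₂.card_le hK0
  have g3 := mul_le_mul_of_nonneg_left hs₃.card_le hK0
  have g4 := hq.card_le
  rw [firstLayer_heads, firstLayer_hidden, secondLayer_heads, secondLayer_hidden]
  push_cast
  refine ⟨?_, ?_, ?_, ?_⟩ <;> linarith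

end Apply

end DANN

end

/-! ### Choice of the constants and conclusion -/

open DANN in
theorem theorem2 (d K : ℕ) (r : ℝ → ℝ) (hr : ContDiff ℝ 4 r)
    (lam Bx By Bu Bw Bv ρ : ℝ) (hlam : 0 < lam) (hBx : 0 < Bx) (hBy : 0 < By)
    (hBu : 0 < Bu) (hBw : 0 < Bw) (hBv : 0 < Bv) :
    ∃ C₀ > 0, ∀ η > 0, ∃ C₁ > 0, ∃ p : ℕ,
      ∀ (n n' : ℕ) (c : ℝ), 0 < c →
        (n + n' + 1 : ℝ) ≤ ρ * n → (n + n' + 1 : ℝ) ≤ ρ * n' → (n + n' + 1 : ℝ) * c ≤ ρ →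
      ∀ (W : Set (Param d K)) (P : Param d K → Param d K) (D_MLP : ℕ) (C_MLP : ℝ),
        W ⊆ constraintBall d K Bu Bw Bv → IsProjection W P → IsMLPBlock P D_MLP C_MLP →
      ∀ (ε : ℝ), 0 < ε → ∀ (L : ℕ), 0 < L →
      ∃ TF : Fin (2 * L) → Layer (TokIdx d K),
        (∀ j, ((TF j).heads : ℝ) ≤ C₁ / ε ^ 2 * Real.log (2 + 1 / ε) ^ p) ∧
        (∀ j, ((TF j).hidden : ℝ) ≤ C₁ / ε ^ 2 * Real.log (2 + 1 / ε) ^ p + D_MLP) ∧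
        tfNorm TF ≤ C₀ * (1 + η) + C_MLP ∧
        ∀ S : Data d n n', S.Bounded Bx By →
        ∀ (l : Fin L) (u : EuclideanSpace ℝ (Fin K × Fin d)) (w v : EuclideanSpace ℝ (Fin K)),
          Param.mk u w v ∈ W →
          ∃ (eu : EuclideanSpace ℝ (Fin K × Fin d)) (ew ev : EuclideanSpace ℝ (Fin K)),
            ‖eu‖ ≤ ε ∧ ‖ew‖ ≤ ε ∧ ‖ev‖ ≤ ε ∧
            (TF ⟨2 * l.1 + 1, by omega⟩).apply
                ((TF ⟨2 * l.1, by omega⟩).apply (tokens S (Param.mk u w v))) =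
              tokens S (P (step r c lam η S u w v eu ew ev)) := by
  obtain ⟨T, hT⟩ : ∃ x, x = (Fintype.card (TokIdx d K) : ℝ) := ⟨_, rfl⟩
  have hT0 : 0 ≤ T := hT ▸ Nat.cast_nonneg _
  have hK0 : (0 : ℝ) ≤ K := Nat.cast_nonneg _
  -- The sum `Bw + Bv` serves as a common bound for `w` and `v`. The absolute value of `ρ` is taken
  -- because no sign of `ρ` is assumed.
  obtain ⟨C, hC, H⟩ := exists_reluSums hr d K hlam hBx hBy hBu (add_pos hBw hBv) (abs_nonneg ρ)
  -- `Z₁` is the norm bound of the first layer. `Z₂` is that of the second at `η = 1` without the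
  -- projection part; since that bound is affine in `η` with nonnegative coefficients, it is at most
  -- `Z₂ * (1 + η)`.
  obtain ⟨Z₁, hZ₁⟩ : ∃ x, x = T * (1 + C + 0) + T * (2 * (K * C)) +
      (1 + 3 * |ρ| * (C + 1)) * ((T + 1) * (2 * C + 1)) +
      (1 + 3 * |ρ| * (C + 1)) * ((T + 1) * 1) := ⟨_, rfl⟩
  obtain ⟨Z₂, hZ₂⟩ : ∃ x, x = T * (1 + C + lam) + T * ((2 + lam) * (K * C)) + 6 := ⟨_, rfl⟩
  have hZ₁0 : 0 ≤ Z₁ := by rw [hZ₁]; positivity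
  have hZ₂0 : 0 < Z₂ := by rw [hZ₂]; positivity
  have hdiff : Differentiable ℝ r := hr.differentiable (by norm_num)
  refine ⟨Z₁ + Z₂, by positivity, fun η hη => ?_⟩
  obtain ⟨F, hF⟩ : ∃ x : ℝ, x = (K * d + K + 1) * (1 + lam) := ⟨_, rfl⟩
  have hF0 : 0 < F := by rw [hF]; positivity
  -- `A / N` bounds the perturbations when the ReLU sums have parameter `N`, and `A` bounds those
  -- which replace the whole gradient step by no step at all.
  obtain ⟨A, hA⟩ : ∃ x, x = F * (η * C) := ⟨_, rfl⟩
  have hA0 : 0 < A := by rw [hA]; positivity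
  -- The factor 4 comes from `⌈A / ε⌉ ≤ 2 * (A / ε)` in the case `A > ε`. The exponent of the
  -- logarithm is 0.
  refine ⟨(3 * K * C + 3 * C + 11) * (4 * A ^ 2), by positivity, 0, ?_⟩
  intro n n' c hc hn hn' hcρ W P D C_MLP hW _ hP ε hε L hL
  obtain ⟨A₁, A₂, hAC, hPA⟩ := hP
  have hC_MLP : 0 ≤ C_MLP := (add_nonneg (opNorm_nonneg A₁) (opNorm_nonneg A₂)).trans hAC
  have hcard : (Fintype.card (ColIdx n n') : ℝ) = n + n' + 1 := by
    simp only [Fintype.card_sum, Fintype.card_fin, Fintype.card_unit]; push_cast; ring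
  have hn0 : (0 : ℝ) < n := by
    rcases Nat.eq_zero_or_pos n with rfl | h
    · have : (0 : ℝ) ≤ n' := Nat.cast_nonneg _
      norm_num at hn; linarith
    · exact_mod_cast h
  have hn0' : (0 : ℝ) < n' := by
    rcases Nat.eq_zero_or_pos n' with rfl | h
    · norm_num at hn'; linarith
    · exact_mod_cast h
  have hρ : ρ ≤ |ρ| := le_abs_self ρ
  have hκ₁ : (Fintype.card (ColIdx n n') : ℝ) * c ≤ |ρ| := by rw [hcard]; linarith
  have hκ₂ : (Fintype.card (ColIdx n n') : ℝ) / n ≤ |ρ| := by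
    rw [hcard, div_le_iff₀ hn0]; exact hn.trans (by gcongr)
  have hκ₃ : (Fintype.card (ColIdx n n') : ℝ) / n' ≤ |ρ| := by
    rw [hcard, div_le_iff₀ hn0']; exact hn'.trans (by gcongr)
  have hκ₁0 : 0 ≤ (Fintype.card (ColIdx n n') : ℝ) * c := by positivity
  have hκ₂0 : 0 ≤ (Fintype.card (ColIdx n n') : ℝ) / n := by positivity
  have hκ₃0 : 0 ≤ (Fintype.card (ColIdx n n') : ℝ) / n' := by positivity
  have hball : ∀ (u : EuclideanSpace ℝ (Fin K × Fin d)) (w v : EuclideanSpace ℝ (Fin K)),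
      Param.mk u w v ∈ W → ‖w‖ ≤ Bw + Bv ∧ ‖v‖ ≤ Bw + Bv ∧
      ∀ k, ‖(WithLp.toLp 2 (fun i => u (k, i)) : EuclideanSpace ℝ (Fin d))‖ ≤ Bu := by
    intro u w v huv
    obtain ⟨u', w', v', e, hw, hv, hu⟩ := hW huv
    obtain ⟨rfl, rfl, rfl⟩ := Param.mk_inj e
    exact ⟨by linarith, by linarith, hu⟩
  simp only [pow_zero, mul_one]
  -- For large `ε` the admissible number of heads falls below 1, so no approximation is affordable.
  -- The full gradient displacement then counts as error, and it suffices to idle and to project,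
  -- with no heads and only the hidden units of the projection.
  rcases le_or_gt A ε with hAε | hAε
  · obtain ⟨TF, h1, h2, h3, h4⟩ := exists_alternating (A := idleLayer d K)
      (B := projectLayer A₁ A₂) (H := (3 * K * C + 3 * C + 11) * (4 * A ^ 2) / ε ^ 2)
      (H' := (3 * K * C + 3 * C + 11) * (4 * A ^ 2) / ε ^ 2 + D)
      (Z := (Z₁ + Z₂) * (1 + η) + C_MLP)
      (by simp only [idleLayer, Layer.of, Fintype.card_empty, Nat.cast_zero]; positivity)
      (by simp only [projectLayer, Layer.of, Fintype.card_empty, Nat.cast_zero]; positivity)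
      (by simp only [idleLayer, Layer.of, Fintype.card_empty, Nat.cast_zero]; positivity)
      (by
        simp only [projectLayer, Layer.of, Fintype.card_fin]
        exact le_add_of_nonneg_left (by positivity))
      (idleLayer_norm_le.trans (by positivity))
      ((projectLayer_norm_le A₁ A₂).trans (hAC.trans (le_add_of_nonneg_left (by positivity)))) hL
    refine ⟨TF, h1, h2, h3, fun S hS l u w v huv => ?_⟩
    obtain ⟨hw, hv, hu⟩ := hball u w v huv
    -- Any positive `N` would do: only the last clause, the bound on the exact gradient directions,
    -- is used, and it involves neither `N` nor the ReLU sums.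
    obtain ⟨s, q, s₂, s₃, -, Hs⟩ := H 1 one_pos
    obtain ⟨-, -, -, hm⟩ := Hs n n' _ _ _ hκ₁0 hκ₂0 hκ₃0 hκ₁ hκ₂ hκ₃ S hS u w v hw hv hu
    obtain ⟨eu, ew, ev, e1, e2, e3, e4⟩ := exists_step_eq hdiff hlam.le hη.le hC.le hm
    rw [← hF] at e1 e2 e3
    rw [← hA] at e1 e2 e3
    refine ⟨eu, ew, ev, e1.trans hAε, e2.trans hAε, e3.trans hAε, ?_⟩
    simp only [tokenMean_zero, mul_zero, sub_zero] at e4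
    rw [(h4 l).1 _, (h4 l).2 _, projectLayer_idleLayer_apply hPA, ← e4]
  -- This is the least `N` for which the perturbation bound `A / N` is at most `ε`.
  · set N := ⌈A / ε⌉₊ with hN
    have hAε0 : 0 < A / ε := div_pos hA0 hε
    have hN0 : 0 < N := Nat.ceil_pos.2 hAε0
    have hN' : (0 : ℝ) < N := Nat.cast_pos.2 hN0
    have hNle : A / ε ≤ N := Nat.le_ceil _
    have hN2 : (N : ℝ) ^ 2 ≤ 4 * A ^ 2 / ε ^ 2 := by
      have h1 : (N : ℝ) < A / ε + 1 := Nat.ceil_lt_add_one hAε0.le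
      have h2 : 1 ≤ A / ε := (one_le_div hε).2 hAε.le
      have h3 : (N : ℝ) ^ 2 ≤ (2 * (A / ε)) ^ 2 := pow_le_pow_left₀ hN'.le (by linarith) 2
      rwa [mul_pow, div_pow, ← mul_div_assoc, show (2 : ℝ) ^ 2 = 4 by norm_num] at h3
    have herr : F * (η * (C / N)) ≤ ε := by
      have : F * (η * (C / N)) = A / N := by rw [hA]; ring
      rw [this, div_le_iff₀ hN', mul_comm]
      exact (div_le_iff₀ hε).1 hNle
    have hcount : (3 * K * C + 3 * C + 11) * (N : ℝ) ^ 2 ≤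
        (3 * K * C + 3 * C + 11) * (4 * A ^ 2) / ε ^ 2 := by
      rw [mul_div_assoc]
      gcongr
    obtain ⟨s, q, s₂, s₃, ⟨hs, hq, hs₂, hs₃⟩, Hs⟩ := H N hN0
    obtain ⟨b1, b2, b3, b4⟩ := layer_sizes_le (lam := lam) (η := η) (A₁ := A₁) (A₂ := A₂)
      (κ₁ := Fintype.card (ColIdx n n') * c) (κ₂ := Fintype.card (ColIdx n n') / n)
      (κ₃ := Fintype.card (ColIdx n n') / n') (B := C) hN0 hC.le hs hq hs₂ hs₃
    obtain ⟨TF, h1, h2, h3, h4⟩ := exists_alternating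
      (A := firstLayer d K s q (Fintype.card (ColIdx n n') * c) (Fintype.card (ColIdx n n') / n)
        (Fintype.card (ColIdx n n') / n') C)
      (B := secondLayer lam η s₂ s₃ A₁ A₂)
      (H := (3 * K * C + 3 * C + 11) * (4 * A ^ 2) / ε ^ 2)
      (H' := (3 * K * C + 3 * C + 11) * (4 * A ^ 2) / ε ^ 2 + D)
      (Z := (Z₁ + Z₂) * (1 + η) + C_MLP)
      (b1.trans hcount) (b3.trans hcount) (b2.trans (by linarith)) (b4.trans (by linarith))
      (by
        refine (firstLayer_norm_le hs hq hC.le hκ₁0 hκ₂0 hκ₃0 hκ₁ hκ₂ hκ₃).trans ?_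
        have : 0 ≤ (Z₁ + Z₂) * η := by positivity
        rw [← hT, ← hZ₁]
        linarith)
      (by
        refine (secondLayer_norm_le hs₂ hs₃ hC.le hlam.le hη.le hAC).trans ?_
        have t1 : 0 ≤ Z₁ * (1 + η) := by positivity
        have t2 : 0 ≤ (T * (1 + C + lam) + 6) * η := by positivity
        have t3 : 0 ≤ T * ((2 + lam) * (K * C)) := by positivity
        rw [← hT, hZ₂]
        linarith) hL
    refine ⟨TF, h1, h2, h3, fun S hS l u w v huv => ?_⟩
    obtain ⟨hw, hv, hu⟩ := hball u w v huv
    obtain ⟨hm₁, hm₂, hm, -⟩ := Hs n n' _ _ _ hκ₁0 hκ₂0 hκ₃0 hκ₁ hκ₂ hκ₃ S hS u w v hw hv hu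
    obtain ⟨eu, ew, ev, e1, e2, e3, e4⟩ :=
      exists_step_eq hdiff hlam.le hη.le (by positivity) hm
    rw [← hF] at e1 e2 e3
    refine ⟨eu, ew, ev, e1.trans herr, e2.trans herr, e3.trans herr, ?_⟩
    rw [(h4 l).1 _, (h4 l).2 _, secondLayer_firstLayer_apply hPA hm₁ hm₂, e4]
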